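/- Let $a,c,L,R>0$, $k\in\mathbb Z\setminus\{0\}$, and let $b^2=0$. Write $\mathcal S_0$ for the space of symmetric traceless real $3\times3$ matrices, $|Q|^2=\operatorname{tr}(Q^2)$, $B_R\subset\mathbb R^2$ for the open disk of radius $R$ centred at $0$, $(r,\varphi)$ for polar coordinates, $n(\varphi)=(\cos\frac{k\varphi}{2},\sin\frac{k\varphi}{2},0)$, $Q_k(\varphi)=n(\varphi)\otimes n(\varphi)-\frac13 I$, $$F_n(\varphi)=\sqrt2\Big(n(\varphi)\otimes n(\varphi)-\tfrac12 (e_1\otimes e_1+e_2\otimes e_2)\Big),\qquad F_3=\sqrt{\tfrac32}\Big(e_3\otimes e_3-\tfrac13 I\Big),\qquad s_+=\frac{b^2+\sqrt{b^4+24a^2c^2}}{4c^2}.$$ The Landau–de Gennes energy of $Q\in H^1(B_R;\mathcal S_0)$ is $$\mathcal F[Q]=\int_{B_R}\tfrac12|\nabla Q|^2+\tfrac1L f(Q)\,dx,\qquad f(Q)=-\tfrac{a^2}{2}|Q|^2-\tfrac{b^2}{3}\operatorname{tr}(Q^3)+\tfrac{c^2}{4}|Q|^4 .$$ Let $S$ be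 the set of pairs $(u,v)$ of real functions on $(0,R]$, locally absolutely continuous on $(0,R]$, with $\sqrt r\,u',\ \sqrt r\,v',\ u/\sqrt r,\ \sqrt r\,v\in L^2(0,R)$, $u(R)=s_+/\sqrt2$ and $v(R)=-s_+/\sqrt6$, and let $$\mathcal E(u,v)=\int_0^R\Big[\tfrac12\Big(u'^2+v'^2+\tfrac{k^2}{r^2}u^2\Big)-\tfrac{a^2}{2L}(u^2+v^2)+\tfrac{c^2}{4L}(u^2+v^2)^2\Big]r\,dr-\frac{b^2}{3L\sqrt6}\int_0^R v(v^2-3u^2)\,r\,dr .$$ Let $(u,v)\in S$ be a global minimiser of $\mathcal E$ on $S$, and let $Y(r,\varphi)=u(r)F_n(\varphi)+v(r)F_3$. Then $Y$ is the unique global minimiser of $\mathcal F$ among all $Q\in H^1(B_R;\mathcal S_0)$ with $Q=s_+Q_k$ on $\partial B_R$ in the sense of traces (in particular $Y$ itself belongs to this class, and uniqueness is up to null sets). Moreover, there is a constant $C>0$ such that $$\mathcal F[Y+P]-\mathcal F[Y]\ \ge\ C\int_{B_R}|P|^2\,dx\qquad\text{for every }P\in H^1_0(B_R;\mathcal S_0).$$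 -/

import Mathlib

open MeasureTheory Filter Topology Set
open scoped ContDiff Matrix

noncomputable section

namespace QTensor

/-! ### Sobolev spaces on an open set of the plane -/

/-- The Euclidean plane. -/
abbrev Plane : Type := EuclideanSpace ℝ (Fin 2)

/-- Real `3 × 3` matrices. -/
abbrev Mat3 : Type := Matrix (Fin 3) (Fin 3) ℝ

/-- The classical partial derivative `∂_l φ`. -/
def partialDeriv (l : Fin 2) (φ : Plane → ℝ) (x : Plane) : ℝ :=
  fderiv ℝ φ x (EuclideanSpace.single l 1)

/-- `φ ∈ C_c^∞(Ω)`. -/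
structure IsTestFunction (Ω : Set Plane) (φ : Plane → ℝ) : Prop where
  smooth : ContDiff ℝ ∞ φ
  compact : HasCompactSupport φ
  support : tsupport φ ⊆ Ω

/-- `g ∈ L²(Ω)` is the weak partial derivative `∂_l f` of `f` in `Ω`. -/
structure IsWeakPartial (Ω : Set Plane) (l : Fin 2) (f g : Plane → ℝ) : Prop where
  memLp : MemLp g 2 (volume.restrict Ω)
  integral_eq : ∀ φ : Plane → ℝ, IsTestFunction Ω φ →
    ∫ x in Ω, f x * partialDeriv l φ x = - ∫ x in Ω, g x * φ x

/-- `f ∈ H¹(Ω)`. -/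
structure MemH1 (Ω : Set Plane) (f : Plane → ℝ) : Prop where
  memLp : MemLp f 2 (volume.restrict Ω)
  exists_weakPartial : ∀ l, ∃ g, IsWeakPartial Ω l f g

open Classical in
/-- The weak partial derivative `∂_l f` in `Ω` of a function `f ∈ H¹(Ω)`; it is determined up to
null sets (see `IsWeakPartial.ae_eq`). -/
def weakPartial (Ω : Set Plane) (l : Fin 2) (f : Plane → ℝ) : Plane → ℝ :=
  if h : ∃ g, IsWeakPartial Ω l f g then h.choose else 0

/-- Weak partial derivatives are unique up to null sets. -/
theorem IsWeakPartial.ae_eq {Ω : Set Plane} (hΩ : IsOpen Ω) {l : Fin 2} {f g₁ g₂ : Plane → ℝ}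
    (h₁ : IsWeakPartial Ω l f g₁) (h₂ : IsWeakPartial Ω l f g₂) :
    g₁ =ᵐ[volume.restrict Ω] g₂ := by
  have hloc : ∀ {g : Plane → ℝ}, MemLp g 2 (volume.restrict Ω) → LocallyIntegrableOn g Ω := by
    intro g hg
    exact locallyIntegrableOn_of_locallyIntegrable_restrict (hg.locallyIntegrable (by norm_num))
  have key := hΩ.ae_eq_zero_of_integral_contDiff_smul_eq_zero
    (μ := volume) (f := fun x => g₁ x - g₂ x)
    ((hloc h₁.memLp).sub (hloc h₂.memLp)) (by
      intro φ hφ hc hs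
      have ht : IsTestFunction Ω φ := ⟨hφ, hc, hs⟩
      have hmem : MemLp φ 2 (volume.restrict Ω) :=
        (hφ.continuous.memLp_of_hasCompactSupport hc).restrict Ω
      have i₁ : Integrable (fun x => g₁ x * φ x) (volume.restrict Ω) :=
        h₁.memLp.integrable_mul hmem
      have i₂ : Integrable (fun x => g₂ x * φ x) (volume.restrict Ω) :=
        h₂.memLp.integrable_mul hmem
      have e : ∫ x, φ x • (g₁ x - g₂ x) = ∫ x in Ω, (g₁ x * φ x - g₂ x * φ x) := by
        rw [← setIntegral_eq_integral_of_forall_compl_eq_zero (s := Ω)]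
        · refine integral_congr_ae (Eventually.of_forall fun x => ?_)
          simp only [smul_eq_mul]; ring
        · intro x hx
          have : φ x = 0 := image_eq_zero_of_notMem_tsupport fun hx' => hx (hs hx')
          simp [this]
      rw [e, integral_sub i₁ i₂]
      have a₁ := h₁.integral_eq φ ht
      have a₂ := h₂.integral_eq φ ht
      linarith)
  rw [Filter.EventuallyEq, ae_restrict_iff' hΩ.measurableSet]
  filter_upwards [key] with x hx hxΩ
  exact sub_eq_zero.mp (hx hxΩ)

/-- `f ∈ H¹₀(Ω)`, the closure of `C_c^∞(Ω)` in `H¹(Ω)`. -/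
def MemH10 (Ω : Set Plane) (f : Plane → ℝ) : Prop :=
  MemH1 Ω f ∧ ∃ φ : ℕ → Plane → ℝ, (∀ m, IsTestFunction Ω (φ m)) ∧
    Tendsto (fun m => eLpNorm (f - φ m) 2 (volume.restrict Ω)) atTop (𝓝 0) ∧
    ∀ l, Tendsto (fun m => eLpNorm (weakPartial Ω l f - partialDeriv l (φ m)) 2
      (volume.restrict Ω)) atTop (𝓝 0)

/-! ### `Q`-tensor fields -/

/-- The space `S₀` of symmetric traceless matrices. -/
def S0 : Set Mat3 := {Q | Qᵀ = Q ∧ Q.trace = 0}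

/-- `|Q|² = tr(Q²)`. -/
def normSq (Q : Mat3) : ℝ := (Q * Q).trace

/-- `Q ∈ H¹(Ω; S₀)`. -/
structure MemH1S0 (Ω : Set Plane) (Q : Plane → Mat3) : Prop where
  memS0 : ∀ᵐ x ∂volume.restrict Ω, Q x ∈ S0
  memH1 : ∀ i j, MemH1 Ω fun x => Q x i j

/-- `P ∈ H¹₀(Ω; S₀)`. -/
structure MemH10S0 (Ω : Set Plane) (P : Plane → Mat3) : Prop where
  memS0 : ∀ᵐ x ∂volume.restrict Ω, P x ∈ S0
  memH10 : ∀ i j, MemH10 Ω fun x => P x i j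

/-- `|∇Q|² = ∑ (∂_l Q_ij)²`, with weak derivatives in `Ω`. -/
def gradNormSq (Ω : Set Plane) (Q : Plane → Mat3) (x : Plane) : ℝ :=
  ∑ i, ∑ j, ∑ l, (weakPartial Ω l (fun y => Q y i j) x) ^ 2

/-- The bulk energy density `f(Q) = -a²/2 |Q|² - b²/3 tr(Q³) + c²/4 |Q|⁴`. -/
def bulk (a b c : ℝ) (Q : Mat3) : ℝ :=
  -(a ^ 2 / 2) * normSq Q - b ^ 2 / 3 * (Q * Q * Q).trace + c ^ 2 / 4 * normSq Q ^ 2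

/-- The Landau–de Gennes energy `∫_Ω ½|∇Q|² + (1/L) f(Q)` of `Q ∈ H¹(Ω; S₀)`. -/
def energy (a b c L : ℝ) (Ω : Set Plane) (Q : Plane → Mat3) : ℝ :=
  ∫ x in Ω, (1 / 2 * gradNormSq Ω Q x + 1 / L * bulk a b c (Q x))

/-- The open disk `B_R`. -/
def disk (R : ℝ) : Set Plane := Metric.ball 0 R

/-- The polar angle of a point of the plane. -/
def angle (x : Plane) : ℝ := Complex.arg ⟨x 0, x 1⟩

/-- `n(φ) = (cos(kφ/2), sin(kφ/2), 0)`. -/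
def director (k : ℤ) (φ : ℝ) : Fin 3 → ℝ :=
  ![Real.cos (k / 2 * φ), Real.sin (k / 2 * φ), 0]

/-- `Q_k(φ) = n ⊗ n - I/3`. -/
def Qk (k : ℤ) (φ : ℝ) : Mat3 :=
  Matrix.vecMulVec (director k φ) (director k φ) - (1 / 3 : ℝ) • (1 : Mat3)

/-- `s₊ = (b² + √(b⁴ + 24 a² c²)) / (4 c²)`. -/
def sPlus (a b c : ℝ) : ℝ :=
  (b ^ 2 + √(b ^ 4 + 24 * a ^ 2 * c ^ 2)) / (4 * c ^ 2)

/-- `Q = g` on `∂B_R` in the sense of traces, for `Q` in `H¹(B_R)` and boundary data `g` that extend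
smoothly to the plane: `Q - G ∈ H¹₀(B_R)` for some (equivalently, every) smooth extension `G`
of `g`. -/
def HasBoundaryValues (R : ℝ) (Q g : Plane → Mat3) : Prop :=
  ∃ G : Plane → Mat3, (∀ i j, ContDiff ℝ ∞ fun x => G x i j) ∧
    (∀ x ∈ Metric.sphere (0 : Plane) R, G x = g x) ∧
    ∀ i j, MemH10 (disk R) fun x => Q x i j - G x i j

/-- The fields `Q ∈ H¹(B_R; S₀)` with `Q = s₊ Q_k` on `∂B_R`. -/
def Admissible (a b c R : ℝ) (k : ℤ) (Q : Plane → Mat3) : Prop :=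
  MemH1S0 (disk R) Q ∧ HasBoundaryValues R Q fun x => sPlus a b c • Qk k (angle x)

/-- `Y` is the unique (up to null sets) global minimiser of the Landau–de Gennes energy among the
fields in `H¹(B_R; S₀)` with `Q = s₊ Q_k` on `∂B_R`. -/
def IsUniqueGlobalMinimiser (a b c L R : ℝ) (k : ℤ) (Y : Plane → Mat3) : Prop :=
  Admissible a b c R k Y ∧
  (∀ Q, Admissible a b c R k Q → energy a b c L (disk R) Y ≤ energy a b c L (disk R) Q) ∧
  ∀ Q, Admissible a b c R k Q → energy a b c L (disk R) Q ≤ energy a b c L (disk R) Y →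
    Q =ᵐ[volume.restrict (disk R)] Y

/-! ### The ansatz and the reduced energy -/

/-- `F_n(φ) = √2 (n ⊗ n - I₂/2)`. -/
def Fn (k : ℤ) (φ : ℝ) : Mat3 :=
  √2 • (Matrix.vecMulVec (director k φ) (director k φ) -
    (1 / 2 : ℝ) • Matrix.diagonal ![1, 1, 0])

/-- `F₃ = √(3/2) (e₃ ⊗ e₃ - I/3)`. -/
def F3 : Mat3 :=
  √(3 / 2) • (Matrix.vecMulVec ![0, 0, 1] ![0, 0, 1] - (1 / 3 : ℝ) • (1 : Mat3))

/-- The field `Y = u(r) F_n(φ) + v(r) F₃`. -/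
def ansatz (k : ℤ) (u v : ℝ → ℝ) (x : Plane) : Mat3 :=
  u ‖x‖ • Fn k (angle x) + v ‖x‖ • F3

/-- `u` is locally absolutely continuous on `(0, R]`. For functions of one variable this expresses,
for the continuous representative, that the weak derivative is locally integrable on `(0, R]`; the
weak derivative is then the a.e. derivative, and `u(R)` has a meaning. -/
def LocallyAC (R : ℝ) (u : ℝ → ℝ) : Prop :=
  ∀ δ ∈ Ioo 0 R, AbsolutelyContinuousOnInterval u δ R

/-- `f ∈ L²(0, R)`. -/
def MemL2 (R : ℝ) (f : ℝ → ℝ) : Prop := MemLp f 2 (volume.restrict (Ioo 0 R))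

/-- The pair `(u, v)` belongs to the admissible set `S` of the reduced energy:
`√r u', √r v', u/√r, √r v ∈ L²(0, R)`, `u(R) = s₊/√2`, `v(R) = -s₊/√6`. -/
structure MemS (a b c R : ℝ) (u v : ℝ → ℝ) : Prop where
  ac_u : LocallyAC R u
  ac_v : LocallyAC R v
  deriv_u : MemL2 R fun r => √r * deriv u r
  deriv_v : MemL2 R fun r => √r * deriv v r
  weight_u : MemL2 R fun r => u r / √r
  weight_v : MemL2 R fun r => √r * v r
  boundary_u : u R = sPlus a b c / √2
  boundary_v : v R = -(sPlus a b c / √6)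

/-- The reduced energy `E(u, v)`. -/
def reducedEnergy (a b c L R : ℝ) (k : ℤ) (u v : ℝ → ℝ) : ℝ :=
  (∫ r in (0 : ℝ)..R,
    (1 / 2 * (deriv u r ^ 2 + deriv v r ^ 2 + (k : ℝ) ^ 2 / r ^ 2 * u r ^ 2)
      - a ^ 2 / (2 * L) * (u r ^ 2 + v r ^ 2)
      + c ^ 2 / (4 * L) * (u r ^ 2 + v r ^ 2) ^ 2) * r)
  - b ^ 2 / (3 * L * √6) * ∫ r in (0 : ℝ)..R, v r * (v r ^ 2 - 3 * u r ^ 2) * r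

/-- `(u, v)` is a global minimiser of the reduced energy on `S`. -/
def IsReducedMinimiser (a b c L R : ℝ) (k : ℤ) (u v : ℝ → ℝ) : Prop :=
  MemS a b c R u v ∧ ∀ ξ η : ℝ → ℝ, MemS a b c R ξ η →
    reducedEnergy a b c L R k u v ≤ reducedEnergy a b c L R k ξ η

end QTensor

end

/-! For `b² = 0` the energy can be expanded exactly around `Y`. With `q = (c²|Y|² - a²)/L`, `F[Y+P]
- F[Y] = ∫ (∇Y:∇P + q Y:P) + ½ ∫ (|∇P|² + q|P|²) + c²/(4L) ∫ (2 Y:P + |P|²)²`. The last integral is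
nonnegative, and the first vanishes once `-ΔY + qY = 0` weakly. Since `|Y|² = u² + v²`, the
coefficient `q` is scalar and radial, so the middle integral is a sum over matrix entries of the
quadratic form of `-Δ + q`. It remains to show that this scalar form is coercive on `H¹₀`
(`le_energy_add_sub`).

Coercivity comes from `v`, which solves the same equation `-Δv + qv = 0` and is negative, bounded
away from zero. Writing `p = v g` on each ray (Hardy's trick) gives `∫ (p'² + q p²) r dr = ∫ v² g'²
r dr`, and a weighted Poincaré inequality for `g` finishes (`RadialWeakSolution.coercive`,
`RadialWeakSolution.coercive_disk`).

The bound on `v` is obtained by truncation (`IsReducedMinimiser.bounds`). Up to a constant the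
potential is a positive multiple of `(u² + v² - ρ²)²` with `ρ = a/c`, and the boundary values lie on
the circle of radius `ρ`. Cutting `|u|` at its boundary value and forcing `|v|` between its boundary
value and `ρ` does not increase the density, so minimality makes the truncation inactive.

The rest passes between the interval and the disk. Every entry of `Y` is a sum of fields `w(r)(α cos
κφ + β sin κφ)`. Such a field has the expected weak gradient and boundary values
(`memH10_radialField_sub`), and testing its equation with `φ` amounts to testing the radial equation
with a Fourier coefficient of `φ` (`RadialWeakSolution.integral_disk_eq_zero`). The Sobolev
embedding of `H¹₀` into `L⁴` keeps all energies finite. -/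

namespace QTensor

/-! ### Square integrable functions -/

section L2

variable {α : Type*} [MeasurableSpace α] {μ : Measure α}

theorem memLp_two_of_sq_le {f g : α → ℝ} (hf : AEStronglyMeasurable f μ) (hg : MemLp g 2 μ)
    {K : ℝ} (h : ∀ᵐ x ∂μ, |f x| ≤ K * |g x|) : MemLp f 2 μ :=
  hg.of_le_mul (c := K) hf (by simpa only [Real.norm_eq_abs] using h)

theorem integrable_mul_of_memLp {f g : α → ℝ} (hf : MemLp f 2 μ) (hg : MemLp g 2 μ) :
    Integrable (fun x => f x * g x) μ :=
  hf.integrable_mul hg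

theorem integrable_sq_of_memLp {f : α → ℝ} (hf : MemLp f 2 μ) :
    Integrable (fun x => f x ^ 2) μ :=
  (memLp_two_iff_integrable_sq hf.1).1 hf

/-- `∫ (f + t g)²` is a nonnegative quadratic polynomial in `t`, so its discriminant is nonpositive.
-/
theorem sq_integral_mul_le {f g : α → ℝ} (hf : MemLp f 2 μ) (hg : MemLp g 2 μ) :
    (∫ x, f x * g x ∂μ) ^ 2 ≤ (∫ x, f x ^ 2 ∂μ) * ∫ x, g x ^ 2 ∂μ := by
  have h : ∀ t : ℝ, 0 ≤ (∫ x, g x ^ 2 ∂μ) * (t * t) + (2 * ∫ x, f x * g x ∂μ) * t +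
      ∫ x, f x ^ 2 ∂μ := by
    intro t
    have e : (∫ x, g x ^ 2 ∂μ) * (t * t) + (2 * ∫ x, f x * g x ∂μ) * t + ∫ x, f x ^ 2 ∂μ =
        ∫ x, (f x + t * g x) ^ 2 ∂μ := by
      have i₁ := (integrable_sq_of_memLp hg).mul_const (t * t)
      have i₂ := ((integrable_mul_of_memLp hf hg).const_mul 2).mul_const t
      rw [← integral_mul_const, ← integral_const_mul, ← integral_mul_const,
        ← integral_add i₁ i₂]
      refine (integral_add (i₁.add i₂) (integrable_sq_of_memLp hf)).symm.trans ?_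
      congr 1
      ext x
      simp only [Pi.add_apply]
      ring
    rw [e]
    exact integral_nonneg fun x => sq_nonneg _
  have := discrim_le_zero h
  rw [discrim] at this
  nlinarith

theorem eLpNorm_two_eq {f : α → ℝ} (hf : MemLp f 2 μ) :
    eLpNorm f 2 μ = ENNReal.ofReal √(∫ x, f x ^ 2 ∂μ) := by
  rw [hf.eLpNorm_eq_integral_rpow_norm (by norm_num) (by norm_num), Real.sqrt_eq_rpow]
  norm_num

theorem tendsto_eLpNorm_two_iff {ι : Type*} {l : Filter ι} {f : ι → α → ℝ}
    (hf : ∀ n, MemLp (f n) 2 μ) :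
    Tendsto (fun n => eLpNorm (f n) 2 μ) l (𝓝 0) ↔
      Tendsto (fun n => ∫ x, f n x ^ 2 ∂μ) l (𝓝 0) := by
  simp_rw [fun n => eLpNorm_two_eq (hf n)]
  constructor
  · intro h
    have h₁ := (ENNReal.tendsto_toReal ENNReal.zero_ne_top).comp h
    have h₂ := h₁.pow 2
    refine (h₂.congr fun n => ?_).trans (by simp)
    simp only [Function.comp_apply]
    rw [ENNReal.toReal_ofReal (Real.sqrt_nonneg _),
      Real.sq_sqrt (integral_nonneg fun x => sq_nonneg _)]
  · intro h
    have := ENNReal.tendsto_ofReal ((Real.continuous_sqrt.tendsto 0).comp h)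
    simpa using this

theorem tendsto_eLpNorm_two_of_dominated {f : ℕ → α → ℝ} {b : α → ℝ}
    (hf : ∀ n, AEStronglyMeasurable (f n) μ) (hb : MemLp b 2 μ)
    (h : ∀ n, ∀ᵐ x ∂μ, |f n x| ≤ b x) (hlim : ∀ᵐ x ∂μ, Tendsto (fun n => f n x) atTop (𝓝 0)) :
    Tendsto (fun n => eLpNorm (f n) 2 μ) atTop (𝓝 0) := by
  have hm : ∀ n, MemLp (f n) 2 μ := fun n =>
    memLp_two_of_sq_le (K := 1) (hf n) hb ((h n).mono fun x hx => by
      rw [one_mul]; exact hx.trans (le_abs_self _))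
  rw [tendsto_eLpNorm_two_iff hm]
  have := tendsto_integral_of_dominated_convergence (μ := μ) (F := fun n x => f n x ^ 2)
    (f := fun _ => 0) (fun x => b x ^ 2) (fun n => (hf n).pow 2) (integrable_sq_of_memLp hb)
    (fun n => (h n).mono fun x hx => by
      rw [Real.norm_eq_abs, abs_pow]
      exact pow_le_pow_left₀ (abs_nonneg _) hx 2)
    (hlim.mono fun x hx => by simpa using hx.pow 2)
  simpa using this

theorem tendsto_integral_mul {ι : Type*} {l : Filter ι} {f g : ι → α → ℝ} {F G : α → ℝ}
    (hf : ∀ n, MemLp (f n) 2 μ) (hg : ∀ n, MemLp (g n) 2 μ) (hF : MemLp F 2 μ)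
    (hG : MemLp G 2 μ) (h₁ : Tendsto (fun n => eLpNorm (f n - F) 2 μ) l (𝓝 0))
    (h₂ : Tendsto (fun n => eLpNorm (g n - G) 2 μ) l (𝓝 0)) :
    Tendsto (fun n => ∫ x, f n x * g n x ∂μ) l (𝓝 (∫ x, F x * G x ∂μ)) := by
  have t₁ := (Lp.tendsto_Lp_iff_tendsto_eLpNorm'' f hf F hF).2 h₁
  have t₂ := (Lp.tendsto_Lp_iff_tendsto_eLpNorm'' g hg G hG).2 h₂
  have key : ∀ {f g : α → ℝ} (hf : MemLp f 2 μ) (hg : MemLp g 2 μ),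
      inner ℝ (hf.toLp f) (hg.toLp g) = ∫ x, f x * g x ∂μ := by
    intro f g hf hg
    rw [L2.inner_def]
    refine integral_congr_ae ?_
    filter_upwards [hf.coeFn_toLp, hg.coeFn_toLp] with x hx hx'
    rw [hx, hx']
    simp [mul_comm]
  have := t₁.inner (𝕜 := ℝ) t₂
  simpa only [key] using this

theorem tendsto_eLpNorm_bdd_mul {ι : Type*} {l : Filter ι} {f : ι → α → ℝ} {F q : α → ℝ}
    {K : ℝ}
    (hK : ∀ᵐ x ∂μ, |q x| ≤ K)
    (h : Tendsto (fun n => eLpNorm (f n - F) 2 μ) l (𝓝 0)) :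
    Tendsto (fun n => eLpNorm ((fun x => q x * f n x) - fun x => q x * F x) 2 μ) l (𝓝 0) := by
  have hle : ∀ n, eLpNorm ((fun x => q x * f n x) - fun x => q x * F x) 2 μ ≤
      ENNReal.ofReal K * eLpNorm (f n - F) 2 μ := fun n =>
    eLpNorm_le_mul_eLpNorm_of_ae_le_mul (hK.mono fun x hx => by
      simp only [Pi.sub_apply, Real.norm_eq_abs, ← mul_sub, abs_mul]
      exact mul_le_mul_of_nonneg_right hx (abs_nonneg _)) 2
  have := ENNReal.Tendsto.const_mul (a := ENNReal.ofReal K) h (Or.inr ENNReal.ofReal_ne_top)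
  rw [mul_zero] at this
  exact tendsto_of_tendsto_of_tendsto_of_le_of_le tendsto_const_nhds this (fun _ => zero_le)
    hle

theorem memLp_bdd_mul {f q : α → ℝ} {K : ℝ} (hf : MemLp f 2 μ) (hq : AEStronglyMeasurable q μ)
    (hK : ∀ᵐ x ∂μ, |q x| ≤ K) : MemLp (fun x => q x * f x) 2 μ :=
  memLp_two_of_sq_le (hq.mul hf.1) hf (hK.mono fun x hx => by
    rw [abs_mul]; exact mul_le_mul_of_nonneg_right hx (abs_nonneg _))

end L2

/-! ### Locally absolutely continuous functions on `(0, R]` -/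

/-- The oscillation sums of `g` are at most `K` times those of `f`. This serves truncations and the
reciprocal of `v`. -/
theorem AbsolutelyContinuousOnInterval.of_dist_le {f g : ℝ → ℝ} {a b K : ℝ}
    (hf : AbsolutelyContinuousOnInterval f a b)
    (h : ∀ x ∈ uIcc a b, ∀ y ∈ uIcc a b, |g x - g y| ≤ K * |f x - f y|) :
    AbsolutelyContinuousOnInterval g a b := by
  unfold AbsolutelyContinuousOnInterval at hf ⊢
  refine squeeze_zero' (Eventually.of_forall fun E => Finset.sum_nonneg fun i _ => dist_nonneg)
    ?_ (by simpa using hf.const_mul K)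
  refine eventually_inf_principal.2 (Eventually.of_forall fun E hE => ?_)
  rw [Finset.mul_sum]
  refine Finset.sum_le_sum fun i hi => ?_
  rw [Real.dist_eq, Real.dist_eq]
  exact h _ (hE.1 i hi).1 _ (hE.1 i hi).2

section LocallyAC

variable {R : ℝ} {f g : ℝ → ℝ}

theorem LocallyAC.add (hf : LocallyAC R f) (hg : LocallyAC R g) :
    LocallyAC R fun r => f r + g r := fun δ hδ => (hf δ hδ).fun_add (hg δ hδ)

theorem LocallyAC.sub (hf : LocallyAC R f) (hg : LocallyAC R g) :
    LocallyAC R fun r => f r - g r := fun δ hδ => (hf δ hδ).fun_sub (hg δ hδ)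

theorem LocallyAC.mul (hf : LocallyAC R f) (hg : LocallyAC R g) :
    LocallyAC R fun r => f r * g r := fun δ hδ => (hf δ hδ).fun_mul (hg δ hδ)

theorem LocallyAC.const_mul (hf : LocallyAC R f) (t : ℝ) :
    LocallyAC R fun r => t * f r := fun δ hδ => (hf δ hδ).const_mul t

theorem LocallyAC.of_dist_le (hf : LocallyAC R f) {K : ℝ}
    (h : ∀ x ∈ Ioc 0 R, ∀ y ∈ Ioc 0 R, |g x - g y| ≤ K * |f x - f y|) : LocallyAC R g := by
  intro δ hδ
  refine AbsolutelyContinuousOnInterval.of_dist_le (hf δ hδ) (K := K) ?_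
  rw [uIcc_of_le hδ.2.le]
  intro x hx y hy
  exact h x ⟨hδ.1.trans_le hx.1, hx.2⟩ y ⟨hδ.1.trans_le hy.1, hy.2⟩

theorem LocallyAC.of_contDiffOn (hf : ContDiffOn ℝ 1 f (Ioc 0 R)) : LocallyAC R f := by
  intro δ hδ
  refine ContDiffOn.absolutelyContinuousOnInterval (hf.mono ?_)
  rw [uIcc_of_le hδ.2.le]
  exact fun x hx => ⟨hδ.1.trans_le hx.1, hx.2⟩

theorem LocallyAC.continuousOn (hf : LocallyAC R f) : ContinuousOn f (Ioc 0 R) := by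
  intro r hr
  have hδ : r / 2 ∈ Ioo 0 R := ⟨by linarith [hr.1], by linarith [hr.1, hr.2]⟩
  have h := (hf _ hδ).continuousOn
  rw [uIcc_of_le hδ.2.le] at h
  refine (h r ⟨by linarith [hr.1], hr.2⟩).mono_of_mem_nhdsWithin ?_
  have : Ioi (r / 2) ∈ 𝓝[Ioc 0 R] r :=
    mem_nhdsWithin_of_mem_nhds (Ioi_mem_nhds (by linarith [hr.1]))
  filter_upwards [this, self_mem_nhdsWithin] with x hx hx'
  exact ⟨le_of_lt hx, hx'.2⟩

theorem LocallyAC.aestronglyMeasurable (hf : LocallyAC R f) :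
    AEStronglyMeasurable f (volume.restrict (Ioo 0 R)) :=
  (hf.continuousOn.mono Ioo_subset_Ioc_self).aestronglyMeasurable measurableSet_Ioo

theorem LocallyAC.ae_differentiableAt (hf : LocallyAC R f) :
    ∀ᵐ r ∂volume.restrict (Ioo 0 R), DifferentiableAt ℝ f r := by
  rw [ae_restrict_iff' measurableSet_Ioo]
  -- The intervals `[R/(n+2), R]` exhaust `(0, R]`; the shift by `2` keeps the left endpoint below
  -- `R` even for `n = 0`.
  have : ∀ n : ℕ, ∀ᵐ r : ℝ, R / (n + 2) ∈ Ioo 0 R → r ∈ uIcc (R / (n + 2)) R →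
      DifferentiableAt ℝ f r := by
    intro n
    by_cases h : R / (n + 2) ∈ Ioo 0 R
    · filter_upwards [(hf _ h).ae_differentiableAt] with r hr _ using hr
    · exact Eventually.of_forall fun r h' => absurd h' h
  filter_upwards [ae_all_iff.2 this] with r hr hr'
  have hR : 0 < R := hr'.1.trans hr'.2
  obtain ⟨n, hn⟩ := exists_nat_gt (R / r)
  have hn' : R / (n + 2) ≤ r := by
    rw [div_le_iff₀ (by positivity)]
    rw [div_lt_iff₀ hr'.1] at hn
    nlinarith [hr'.1]
  have hm : R / (n + 2) ∈ Ioo 0 R :=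
    ⟨by positivity, by rw [div_lt_iff₀ (by positivity)]; nlinarith [n.cast_nonneg (α := ℝ)]⟩
  refine hr n hm ?_
  rw [uIcc_of_le hm.2.le]
  exact ⟨hn', hr'.2.le⟩

theorem aestronglyMeasurable_deriv (f : ℝ → ℝ) (μ : Measure ℝ) :
    AEStronglyMeasurable (deriv f) μ := (measurable_deriv f).aestronglyMeasurable

/-- A weighted pointwise bound for functions vanishing at the outer endpoint. -/
theorem LocallyAC.sq_le (hf : LocallyAC R f) (hR : f R = 0)
    (hd : MemL2 R fun r => √r * deriv f r) {r : ℝ} (hr : r ∈ Ioc 0 R) :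
    f r ^ 2 ≤ 2 * √(R / r) * ∫ s in Ioo 0 R, s * deriv f s ^ 2 := by
  have hR0 : 0 < R := hr.1.trans_le hr.2
  have hD : 0 ≤ ∫ s in Ioo 0 R, s * deriv f s ^ 2 :=
    setIntegral_nonneg measurableSet_Ioo fun s hs => mul_nonneg hs.1.le (sq_nonneg _)
  rcases hr.2.eq_or_lt with rfl | hlt
  · rw [hR, zero_pow two_ne_zero]
    exact mul_nonneg (by positivity) hD
  have hac := hf r ⟨hr.1, hlt⟩
  have hftc := hac.integral_deriv_eq_sub
  rw [hR, zero_sub, intervalIntegral.integral_of_le hlt.le, integral_Ioc_eq_integral_Ioo] at hftc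
  have hsub : Ioo r R ⊆ Ioo 0 R := Ioo_subset_Ioo_left hr.1.le
  have m₁ : MemLp (fun s => √s * deriv f s) 2 (volume.restrict (Ioo r R)) :=
    hd.mono_measure (Measure.restrict_mono hsub le_rfl)
  have i₂ : IntegrableOn (fun s : ℝ => s⁻¹) (Ioo r R) := by
    have : IntervalIntegrable (fun s : ℝ => s⁻¹) volume r R :=
      intervalIntegral.intervalIntegrable_inv (fun x hx => by
        rw [uIcc_of_le hlt.le] at hx; linarith [hx.1, hr.1]) continuousOn_id
    exact ((intervalIntegrable_iff_integrableOn_Ioc_of_le hlt.le).1 this).mono_set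
      Ioo_subset_Ioc_self
  have m₂ : MemLp (fun s => (√s)⁻¹) 2 (volume.restrict (Ioo r R)) := by
    refine (memLp_two_iff_integrable_sq (by fun_prop)).2 ?_
    refine (integrable_congr ((ae_restrict_iff' measurableSet_Ioo).2
      (Eventually.of_forall fun s hs => ?_))).2 i₂
    have : 0 < s := hr.1.trans hs.1
    simp only [inv_pow, Real.sq_sqrt this.le]
  -- Cauchy–Schwarz for `f' = √s f' · 1/√s` on `(r, R)`; the second factor contributes `log (R /
  -- r)`.
  have hcs := sq_integral_mul_le m₁ m₂
  have e₁ : ∫ s in Ioo r R, √s * deriv f s * (√s)⁻¹ = -f r := by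
    rw [← hftc]
    refine setIntegral_congr_fun measurableSet_Ioo fun s hs => ?_
    have : √s ≠ 0 := (Real.sqrt_pos.2 (hr.1.trans hs.1)).ne'
    field_simp
  have e₂ : ∫ s in Ioo r R, (√s * deriv f s) ^ 2 ≤ ∫ s in Ioo 0 R, s * deriv f s ^ 2 := by
    have : ∀ s ∈ Ioo 0 R, (√s * deriv f s) ^ 2 = s * deriv f s ^ 2 := fun s hs => by
      rw [mul_pow, Real.sq_sqrt hs.1.le]
    rw [← setIntegral_congr_fun measurableSet_Ioo this]
    exact setIntegral_mono_set (integrable_sq_of_memLp hd)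
      (Eventually.of_forall fun s => sq_nonneg _) hsub.eventuallyLE
  have e₃ : ∫ s in Ioo r R, ((√s)⁻¹) ^ 2 ≤ 2 * √(R / r) := by
    have : ∫ s in Ioo r R, ((√s)⁻¹) ^ 2 = Real.log (R / r) := by
      rw [← integral_inv_of_pos hr.1 hR0, intervalIntegral.integral_of_le hlt.le,
        integral_Ioc_eq_integral_Ioo]
      refine setIntegral_congr_fun measurableSet_Ioo fun s hs => ?_
      simp only [inv_pow, Real.sq_sqrt (hr.1.trans hs.1).le]
    rw [this]
    have hp : 0 < R / r := by have := hr.1; positivity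
    -- `log x = 2 log √x ≤ 2 (√x - 1)`. The square root is a sufficient substitute for the logarithm
    -- because `r √(R / r) ≤ R`.
    have := Real.log_le_sub_one_of_pos (Real.sqrt_pos.2 hp)
    rw [Real.log_sqrt hp.le] at this
    linarith
  rw [e₁, neg_sq] at hcs
  calc f r ^ 2 ≤ _ := hcs
    _ ≤ (∫ s in Ioo 0 R, s * deriv f s ^ 2) * (2 * √(R / r)) :=
      mul_le_mul e₂ e₃ (integral_nonneg fun s => sq_nonneg _) hD
    _ = _ := by ring

/-- Weighted Poincaré inequality. -/
theorem LocallyAC.integral_sq_le (hf : LocallyAC R f) (hR0 : 0 < R) (hR : f R = 0)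
    (hd : MemL2 R fun r => √r * deriv f r) :
    ∫ r in Ioo 0 R, r * f r ^ 2 ≤ 2 * R ^ 2 * ∫ s in Ioo 0 R, s * deriv f s ^ 2 := by
  set D := ∫ s in Ioo 0 R, s * deriv f s ^ 2 with hDdef
  have hD : 0 ≤ D :=
    setIntegral_nonneg measurableSet_Ioo fun s hs => mul_nonneg hs.1.le (sq_nonneg _)
  have hle : ∀ r ∈ Ioo 0 R, r * f r ^ 2 ≤ 2 * R * D := by
    intro r hr
    have h₁ := hf.sq_le hR hd ⟨hr.1, hr.2.le⟩
    rw [← hDdef] at h₁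
    have h₂ : r * √(R / r) ≤ R := by
      have h1 : 1 ≤ R / r := (one_le_div hr.1).2 hr.2.le
      have : √(R / r) ≤ R / r := Real.sqrt_le_self_iff.2 (Or.inr h1)
      calc r * √(R / r) ≤ r * (R / r) := mul_le_mul_of_nonneg_left this hr.1.le
        _ = R := mul_div_cancel₀ _ hr.1.ne'
    calc r * f r ^ 2 ≤ r * (2 * √(R / r) * D) := mul_le_mul_of_nonneg_left h₁ hr.1.le
      _ = 2 * (r * √(R / r)) * D := by ring
      _ ≤ 2 * R * D := by gcongr
  have hm : AEStronglyMeasurable (fun r => r * f r ^ 2) (volume.restrict (Ioo 0 R)) :=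
    aestronglyMeasurable_id.mul (hf.aestronglyMeasurable.pow 2)
  have hi : IntegrableOn (fun r => r * f r ^ 2) (Ioo 0 R) := by
    have : IsFiniteMeasure (volume.restrict (Ioo 0 R)) := ⟨by simp⟩
    refine Integrable.of_bound hm (2 * R * D) ?_
    refine (ae_restrict_iff' measurableSet_Ioo).2 (Eventually.of_forall fun r hr => ?_)
    rw [Real.norm_eq_abs, abs_of_nonneg (mul_nonneg hr.1.le (sq_nonneg _))]
    exact hle r hr
  calc ∫ r in Ioo 0 R, r * f r ^ 2 ≤ ∫ r in Ioo 0 R, 2 * R * D :=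
        setIntegral_mono_on hi (integrableOn_const (by simp)) measurableSet_Ioo hle
    _ = 2 * R ^ 2 * D := by
        simp [hR0.le]; ring

end LocallyAC

end QTensor

namespace QTensor

/-! ### Radial profiles -/

/-- The radial functions `w` for which `w(r) e^{iκφ}` has finite Dirichlet energy. -/
structure RadialProfile (R κ : ℝ) (w : ℝ → ℝ) : Prop where
  ac : LocallyAC R w
  deriv : MemL2 R fun r => √r * deriv w r
  weight : MemL2 R fun r => κ * (w r / √r)
  memL2 : MemL2 R fun r => √r * w r

theorem ae_mem_Ioo (R : ℝ) : ∀ᵐ r ∂volume.restrict (Ioo 0 R), r ∈ Ioo 0 R :=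
  ae_restrict_mem measurableSet_Ioo

theorem integrable_of_abs_le {R M : ℝ} {f : ℝ → ℝ}
    (hf : AEStronglyMeasurable f (volume.restrict (Ioo 0 R)))
    (h : ∀ r ∈ Ioo 0 R, |f r| ≤ M) : IntegrableOn f (Ioo 0 R) := by
  have : IsFiniteMeasure (volume.restrict (Ioo 0 R)) := ⟨by simp⟩
  exact Integrable.of_bound hf M ((ae_mem_Ioo R).mono h)

theorem memL2_of_abs_le {R M : ℝ} {f : ℝ → ℝ}
    (hf : AEStronglyMeasurable f (volume.restrict (Ioo 0 R)))
    (h : ∀ r ∈ Ioo 0 R, |f r| ≤ M) : MemL2 R f := by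
  have : IsFiniteMeasure (volume.restrict (Ioo 0 R)) := ⟨by simp⟩
  exact MemLp.of_bound hf M ((ae_mem_Ioo R).mono h)

namespace RadialProfile

variable {R κ : ℝ} {w ξ : ℝ → ℝ}

theorem deriv_add_mul (hw : LocallyAC R w) (hξ : LocallyAC R ξ) (t : ℝ) :
    ∀ᵐ r ∂volume.restrict (Ioo 0 R),
      _root_.deriv (fun r => w r + t * ξ r) r = _root_.deriv w r + t * _root_.deriv ξ r := by
  filter_upwards [hw.ae_differentiableAt, hξ.ae_differentiableAt] with r h₁ h₂
  rw [deriv_fun_add h₁ (h₂.const_mul t), deriv_const_mul t h₂]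

theorem add_mul (hw : RadialProfile R κ w) (hξ : RadialProfile R κ ξ) (t : ℝ) :
    RadialProfile R κ fun r => w r + t * ξ r where
  ac := hw.ac.add (hξ.ac.const_mul t)
  deriv := by
    refine (MemLp.add hw.deriv (hξ.deriv.const_mul t)).ae_eq ?_
    filter_upwards [deriv_add_mul hw.ac hξ.ac t] with r hr
    rw [hr]
    simp only [Pi.add_apply]
    ring
  weight := by
    refine (MemLp.add hw.weight (hξ.weight.const_mul t)).ae_eq (Eventually.of_forall fun r => ?_)
    simp only [Pi.add_apply]
    ring
  memL2 := by
    refine (MemLp.add hw.memL2 (hξ.memL2.const_mul t)).ae_eq (Eventually.of_forall fun r => ?_)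
    simp only [Pi.add_apply]
    ring

/-- A smooth function on `[0, R]` that is `O(r)` at the origin if `κ ≠ 0` is a radial profile. -/
theorem of_contDiff (hR : 0 < R) (hw : ContDiff ℝ 1 w) {M : ℝ}
    (h : ∀ r ∈ Ioo 0 R, |κ * w r| ≤ M * r) : RadialProfile R κ w := by
  have hd : Continuous (_root_.deriv w) := hw.continuous_deriv_one
  have bound : ∀ f : ℝ → ℝ, Continuous f → MemL2 R f := by
    intro f hf
    obtain ⟨C, hC⟩ := isCompact_Icc (a := (0 : ℝ)) (b := R) |>.exists_bound_of_continuousOn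
      hf.continuousOn
    exact memL2_of_abs_le hf.aestronglyMeasurable fun r hr => hC r (Ioo_subset_Icc_self hr)
  refine ⟨.of_contDiffOn hw.contDiffOn, bound _ (by fun_prop), ?_,
    bound _ (Real.continuous_sqrt.mul hw.continuous)⟩
  have hM : 0 ≤ M := by
    have := (abs_nonneg _).trans (h (R / 2) ⟨by linarith, by linarith⟩)
    exact nonneg_of_mul_nonneg_left this (by linarith)
  refine memL2_of_abs_le (M := M * √R) ?_ fun r hr => ?_
  · have : Measurable fun r => κ * (w r / √r) :=
      (hw.continuous.measurable.div Real.continuous_sqrt.measurable).const_mul κ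
    exact this.aestronglyMeasurable
  · have h₁ := h r hr
    have h₂ : 0 < √r := Real.sqrt_pos.2 hr.1
    rw [mul_div_assoc', abs_div, abs_of_pos h₂, div_le_iff₀ h₂]
    calc |κ * w r| ≤ M * (√r * √r) := by rw [Real.mul_self_sqrt hr.1.le]; exact h₁
      _ ≤ M * (√R * √r) := by gcongr; exact hr.2.le
      _ = M * √R * √r := by ring

/-- `LocallyAC.sq_le` applies to `w - w R`, and `w² ≤ 2 (w - w R)² + 2 (w R)²`; the constant is
absorbed because `√(R / r) ≥ 1`. The resulting growth `r^(-1/4)` keeps `w⁴ r` bounded. -/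
theorem abs_le_of_sqrt (hw : RadialProfile R κ w) :
    ∃ M, 0 ≤ M ∧ ∀ r ∈ Ioo 0 R, w r ^ 2 ≤ √(R / r) * M := by
  have hac : LocallyAC R fun r => w r - w R :=
    hw.ac.sub (.of_contDiffOn contDiffOn_const)
  have hd : MemL2 R fun r => √r * _root_.deriv (fun r => w r - w R) r := by
    simp_rw [deriv_sub_const]
    exact hw.deriv
  set D := ∫ s in Ioo 0 R, s * _root_.deriv (fun r => w r - w R) s ^ 2 with hD
  have hD0 : 0 ≤ D :=
    setIntegral_nonneg measurableSet_Ioo fun s hs => mul_nonneg hs.1.le (sq_nonneg _)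
  refine ⟨4 * D + 2 * w R ^ 2, by positivity, fun r hr => ?_⟩
  have h₁ := hac.sq_le (sub_self _) hd ⟨hr.1, hr.2.le⟩
  rw [← hD] at h₁
  have h₂ : 1 ≤ √(R / r) := by
    rw [Real.one_le_sqrt]
    exact (one_le_div hr.1).2 hr.2.le
  nlinarith [sq_nonneg (w r - 2 * w R), sq_nonneg (w R)]

theorem integrable_pow_four (hw : RadialProfile R κ w) :
    IntegrableOn (fun r => w r ^ 4 * r) (Ioo 0 R) := by
  obtain ⟨M, hM, h⟩ := hw.abs_le_of_sqrt
  refine integrable_of_abs_le (M := R * M ^ 2)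
    ((hw.ac.aestronglyMeasurable.pow 4).mul aestronglyMeasurable_id) fun r hr => ?_
  have hp : 0 ≤ R / r := div_nonneg (hr.1.trans hr.2).le hr.1.le
  rw [abs_of_nonneg (mul_nonneg (by positivity) hr.1.le)]
  calc w r ^ 4 * r = (w r ^ 2) ^ 2 * r := by ring
    _ ≤ (√(R / r) * M) ^ 2 * r := by have := h r hr; have := hr.1.le; gcongr
    _ = R / r * r * M ^ 2 := by rw [mul_pow, Real.sq_sqrt hp]; ring
    _ = R * M ^ 2 := by rw [div_mul_cancel₀ _ hr.1.ne']

theorem integrable_deriv_mul (hw : RadialProfile R κ w) (hξ : RadialProfile R κ ξ) :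
    IntegrableOn (fun r => _root_.deriv w r * _root_.deriv ξ r * r) (Ioo 0 R) := by
  refine (integrable_mul_of_memLp hw.deriv hξ.deriv).congr ((ae_mem_Ioo R).mono fun r hr => ?_)
  calc √r * _root_.deriv w r * (√r * _root_.deriv ξ r)
      = _root_.deriv w r * _root_.deriv ξ r * (√r * √r) := by ring
    _ = _ := by rw [Real.mul_self_sqrt hr.1.le]

theorem integrable_weight_mul (hw : RadialProfile R κ w) (hξ : RadialProfile R κ ξ) :
    IntegrableOn (fun r => κ ^ 2 / r ^ 2 * (w r * ξ r) * r) (Ioo 0 R) := by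
  refine (integrable_mul_of_memLp hw.weight hξ.weight).congr
    ((ae_mem_Ioo R).mono fun r hr => ?_)
  have h0 : r ≠ 0 := hr.1.ne'
  calc κ * (w r / √r) * (κ * (ξ r / √r))
      = κ ^ 2 * (w r * ξ r) / (√r * √r) := by
        field_simp
    _ = κ ^ 2 / r ^ 2 * (w r * ξ r) * r := by
        rw [Real.mul_self_sqrt hr.1.le]
        field_simp

theorem integrable_mul (hw : RadialProfile R κ w) (hξ : RadialProfile R κ ξ) :
    IntegrableOn (fun r => w r * ξ r * r) (Ioo 0 R) := by
  refine (integrable_mul_of_memLp hw.memL2 hξ.memL2).congr ((ae_mem_Ioo R).mono fun r hr => ?_)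
  calc √r * w r * (√r * ξ r) = w r * ξ r * (√r * √r) := by ring
    _ = _ := by rw [Real.mul_self_sqrt hr.1.le]

end RadialProfile

/-! ### Admissible pairs and the density of the reduced energy -/

section Admissible

variable {a b c L R : ℝ} {k : ℤ} {u v : ℝ → ℝ}

theorem cast_natAbs_sq (k : ℤ) : ((k.natAbs : ℕ) : ℝ) ^ 2 = (k : ℝ) ^ 2 := by
  rw [Nat.cast_natAbs, Int.cast_abs, sq_abs]

theorem MemS.profile_u (h : MemS a b c R u v) (κ : ℝ) : RadialProfile R κ u where
  ac := h.ac_u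
  deriv := h.deriv_u
  weight := h.weight_u.const_mul κ
  memL2 := by
    refine memLp_two_of_sq_le (K := R) ?_ h.weight_u ((ae_mem_Ioo R).mono fun r hr => ?_)
    · exact Real.continuous_sqrt.aestronglyMeasurable.mul h.ac_u.aestronglyMeasurable
    · have h₂ : 0 < √r := Real.sqrt_pos.2 hr.1
      rw [abs_mul, abs_div, abs_of_pos h₂, mul_div_assoc', le_div_iff₀ h₂]
      calc √r * |u r| * √r = √r * √r * |u r| := by ring
        _ ≤ R * |u r| := by
          rw [Real.mul_self_sqrt hr.1.le]
          exact mul_le_mul_of_nonneg_right hr.2.le (abs_nonneg _)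

theorem MemS.profile_v (h : MemS a b c R u v) : RadialProfile R 0 v where
  ac := h.ac_v
  deriv := h.deriv_v
  weight := by
    have : (fun r => 0 * (v r / √r)) = fun _ => (0 : ℝ) := by ext; simp
    rw [this]
    exact memL2_of_abs_le (M := 0) aestronglyMeasurable_const (by simp)
  memL2 := h.weight_v

theorem memS_of_profile {κ : ℝ} (hκ : κ ≠ 0) (hu : RadialProfile R κ u)
    (hv : RadialProfile R 0 v) (bu : u R = sPlus a b c / √2) (bv : v R = -(sPlus a b c / √6)) :
    MemS a b c R u v where
  ac_u := hu.ac
  ac_v := hv.ac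
  deriv_u := hu.deriv
  deriv_v := hv.deriv
  weight_u := by
    refine (hu.weight.const_mul κ⁻¹).ae_eq (Eventually.of_forall fun r => ?_)
    rw [inv_mul_cancel_left₀ hκ]
  weight_v := hv.memL2
  boundary_u := bu
  boundary_v := bv

/-- The density of the reduced energy for `b² = 0`. -/
noncomputable def reducedDensity (a c L κ : ℝ) (u v : ℝ → ℝ) (r : ℝ) : ℝ :=
  (1 / 2 * (deriv u r ^ 2 + deriv v r ^ 2 + κ ^ 2 / r ^ 2 * u r ^ 2)
      - a ^ 2 / (2 * L) * (u r ^ 2 + v r ^ 2)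
      + c ^ 2 / (4 * L) * (u r ^ 2 + v r ^ 2) ^ 2) * r

theorem reducedEnergy_eq (hb : b ^ 2 = 0) (hR : 0 < R) :
    reducedEnergy a b c L R k u v = ∫ r in Ioo 0 R, reducedDensity a c L k.natAbs u v r := by
  rw [reducedEnergy, hb, zero_div, zero_mul, sub_zero,
    intervalIntegral.integral_of_le hR.le, integral_Ioc_eq_integral_Ioo]
  simp only [reducedDensity, cast_natAbs_sq]

/-- The integral of a non-integrable function is `0` by convention, so comparing energies is
meaningful only once every pair in `S` has an integrable density. The quartic term is covered by
`RadialProfile.integrable_pow_four`. -/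
theorem integrable_reducedDensity {κ : ℝ} (hu : RadialProfile R κ u) (hv : RadialProfile R 0 v) :
    IntegrableOn (reducedDensity a c L κ u v) (Ioo 0 R) := by
  have hq : IntegrableOn (fun r => (u r ^ 2 + v r ^ 2) ^ 2 * r) (Ioo 0 R) := by
    refine Integrable.mono' ((hu.integrable_pow_four.add hv.integrable_pow_four).const_mul 2)
      ((((hu.ac.aestronglyMeasurable.pow 2).add (hv.ac.aestronglyMeasurable.pow 2)).pow 2).mul
        aestronglyMeasurable_id) ((ae_mem_Ioo R).mono fun r hr => ?_)
    rw [Real.norm_eq_abs, abs_of_nonneg (mul_nonneg (sq_nonneg _) hr.1.le)]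
    simp only [Pi.add_apply]
    nlinarith [mul_nonneg (sq_nonneg (u r ^ 2 - v r ^ 2)) hr.1.le]
  have h := ((((hu.integrable_deriv_mul hu).add (hv.integrable_deriv_mul hv)).add
    (hu.integrable_weight_mul hu)).const_mul (1 / 2)).sub
    (((hu.integrable_mul hu).add (hv.integrable_mul hv)).const_mul (a ^ 2 / (2 * L))) |>.add
    (hq.const_mul (c ^ 2 / (4 * L)))
  refine h.congr (Eventually.of_forall fun r => ?_)
  simp only [reducedDensity, Pi.add_apply, Pi.sub_apply]
  ring

/-! ### Pointwise bounds for minimisers of the reduced energy -/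

/-- The gap between the densities is nonnegative and, by minimality, has nonpositive integral, so it
vanishes almost everywhere. This turns minimality into pointwise information without any
differential equation. -/
theorem IsReducedMinimiser.density_ae_eq (hb : b ^ 2 = 0) (hR : 0 < R)
    (h : IsReducedMinimiser a b c L R k u v) {ξ η : ℝ → ℝ} (hS : MemS a b c R ξ η)
    (hle : ∀ᵐ r ∂volume.restrict (Ioo 0 R),
      reducedDensity a c L k.natAbs ξ η r ≤ reducedDensity a c L k.natAbs u v r) :
    ∀ᵐ r ∂volume.restrict (Ioo 0 R),
      reducedDensity a c L k.natAbs u v r = reducedDensity a c L k.natAbs ξ η r := by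
  have h₁ := h.2 ξ η hS
  rw [reducedEnergy_eq hb hR, reducedEnergy_eq hb hR] at h₁
  have i₁ := integrable_reducedDensity (a := a) (c := c) (L := L)
    (h.1.profile_u (k.natAbs : ℝ)) h.1.profile_v
  have i₂ := integrable_reducedDensity (a := a) (c := c) (L := L)
    (hS.profile_u (k.natAbs : ℝ)) hS.profile_v
  have hnn : 0 ≤ᵐ[volume.restrict (Ioo 0 R)] fun r =>
      reducedDensity a c L k.natAbs u v r - reducedDensity a c L k.natAbs ξ η r :=
    hle.mono fun r hr => sub_nonneg.2 hr
  have hz : ∫ r in Ioo 0 R,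
      (reducedDensity a c L k.natAbs u v r - reducedDensity a c L k.natAbs ξ η r) = 0 := by
    refine le_antisymm ?_ (integral_nonneg_of_ae hnn)
    rw [integral_sub i₁ i₂]
    linarith
  rw [integral_eq_zero_iff_of_nonneg_ae hnn (i₁.sub i₂)] at hz
  exact hz.mono fun r hr => sub_eq_zero.1 hr

theorem abs_deriv_le_of_dist_le {f g : ℝ → ℝ} {r : ℝ} (hr : r ∈ Ioo 0 R)
    (h : ∀ x ∈ Ioc 0 R, ∀ y ∈ Ioc 0 R, |g x - g y| ≤ |f x - f y|)
    (hf : DifferentiableAt ℝ f r) (hg : DifferentiableAt ℝ g r) :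
    |deriv g r| ≤ |deriv f r| := by
  have tf := (hasDerivAt_iff_tendsto_slope.1 hf.hasDerivAt).abs
  have tg := (hasDerivAt_iff_tendsto_slope.1 hg.hasDerivAt).abs
  refine le_of_tendsto_of_tendsto tg tf ?_
  have : Ioo 0 R ∈ 𝓝[≠] r := mem_nhdsWithin_of_mem_nhds (Ioo_mem_nhds hr.1 hr.2)
  filter_upwards [this] with x hx
  rw [slope_def_field, slope_def_field, abs_div, abs_div]
  exact div_le_div_of_nonneg_right (h x (Ioo_subset_Ioc_self hx) r (Ioo_subset_Ioc_self hr))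
    (abs_nonneg _)

theorem le_of_ae_le {f : ℝ → ℝ} {C : ℝ} (hf : ContinuousOn f (Ioo 0 R))
    (h : ∀ᵐ r ∂volume.restrict (Ioo 0 R), f r ≤ C) : ∀ r ∈ Ioo 0 R, f r ≤ C := by
  have := Measure.eqOn_open_of_ae_eq (μ := volume) (f := fun r => max (f r) C)
    (g := fun _ => C) (h.mono fun r hr => max_eq_right hr) isOpen_Ioo
    (hf.sup continuousOn_const) continuousOn_const
  intro r hr
  exact (le_max_left _ _).trans_eq (this hr)

/-- Truncation does not increase the distance to the circle `x² + y² = ρ²`. -/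
theorem truncation_potential_le {x y m n ρ : ℝ} (hx : 0 ≤ x) (hρ : m + n = ρ)
    (hm : 0 ≤ m) :
    (min x m + max (min y ρ) n - ρ) ^ 2 ≤ (x + y - ρ) ^ 2 := by
  rcases le_total x m with h₁ | h₁ <;> rcases le_total y n with h₂ | h₂ <;>
    rcases le_total y ρ with h₃ | h₃
  all_goals
    simp only [h₁, h₃, min_eq_left, min_eq_right, max_eq_left, max_eq_right, h₂]
  all_goals first
    | (have h4 : n ≤ ρ := by linarith
       simp only [h4, max_eq_left]; nlinarith)
    | nlinarith

end Admissible

end QTensor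

namespace QTensor

/-! ### Truncation bounds and the first variation of the reduced energy -/

section Bounds

variable {a b c L R : ℝ} {k : ℤ} {u v : ℝ → ℝ}

theorem sPlus_pos (ha : 0 < a) (hc : 0 < c) : 0 < sPlus a b c := by
  have h : 0 < b ^ 4 + 24 * a ^ 2 * c ^ 2 := by positivity
  have := Real.sqrt_pos.2 h
  unfold sPlus
  positivity

/-- Consequently the squares of the boundary values of `u` and `v` are `3/4` and `1/4` of `(a/c)²`:
the boundary point lies on the circle of zeros of the completed-square potential. -/
theorem sPlus_sq (hb : b ^ 2 = 0) (hc : 0 < c) : sPlus a b c ^ 2 = 3 / 2 * (a / c) ^ 2 := by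
  have h4 : b ^ 4 = 0 := by rw [show b ^ 4 = (b ^ 2) ^ 2 by ring, hb]; norm_num
  rw [sPlus, hb, h4, zero_add, zero_add, div_pow, Real.sq_sqrt (by positivity)]
  field_simp
  ring

theorem memL2_deriv_of_dist_le {f g : ℝ → ℝ} (hf : LocallyAC R f)
    (hd : MemL2 R fun r => √r * deriv f r)
    (h : ∀ x ∈ Ioc 0 R, ∀ y ∈ Ioc 0 R, |g x - g y| ≤ |f x - f y|) :
    LocallyAC R g ∧ (∀ᵐ r ∂volume.restrict (Ioo 0 R), deriv g r ^ 2 ≤ deriv f r ^ 2) ∧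
      MemL2 R fun r => √r * deriv g r := by
  have hg : LocallyAC R g := hf.of_dist_le (K := 1) (by simpa using h)
  have hle : ∀ᵐ r ∂volume.restrict (Ioo 0 R), |deriv g r| ≤ |deriv f r| := by
    filter_upwards [ae_mem_Ioo R, hf.ae_differentiableAt, hg.ae_differentiableAt] with r hr h₁ h₂
    exact abs_deriv_le_of_dist_le hr h h₁ h₂
  refine ⟨hg, hle.mono fun r hr => sq_le_sq.2 hr, memLp_two_of_sq_le (K := 1)
    (Real.continuous_sqrt.aestronglyMeasurable.mul (aestronglyMeasurable_deriv _ _)) hd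
    (hle.mono fun r hr => ?_)⟩
  rw [one_mul, abs_mul, abs_mul]
  exact mul_le_mul_of_nonneg_left hr (abs_nonneg _)

theorem min_abs_sq {x m : ℝ} (hm : 0 ≤ m) : (min |x| m) ^ 2 = min (x ^ 2) (m ^ 2) := by
  rcases le_total |x| m with h | h
  · rw [min_eq_left h, sq_abs, min_eq_left (sq_le_sq.2 (by rwa [abs_of_nonneg hm]))]
  · rw [min_eq_right h, min_eq_right (sq_le_sq.2 (by rwa [abs_of_nonneg hm]))]

theorem max_sq {x n : ℝ} (hx : 0 ≤ x) (hn : 0 ≤ n) : (max x n) ^ 2 = max (x ^ 2) (n ^ 2) := by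
  rcases le_total x n with h | h
  · rw [max_eq_right h, max_eq_right (pow_le_pow_left₀ hx h 2)]
  · rw [max_eq_left h, max_eq_left (pow_le_pow_left₀ hn h 2)]

/-- Equality of truncated and original potential forces the truncation to be inactive. -/
theorem bounds_of_potential_eq {x y m n ρ : ℝ} (hx : 0 ≤ x) (hxm : x ≤ m) (hρ : m + n = ρ)
    (h : (x + y - ρ) ^ 2 = (x + max (min y ρ) n - ρ) ^ 2) : n ≤ y ∧ y ≤ ρ := by
  have hnρ : n ≤ ρ := by linarith
  constructor
  · by_contra! hy
    rw [min_eq_left (by linarith), max_eq_right hy.le] at h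
    nlinarith
  · by_contra! hy
    rw [min_eq_right hy.le, max_eq_left hnρ] at h
    nlinarith

theorem IsReducedMinimiser.bounds (ha : 0 < a) (hb : b ^ 2 = 0) (hc : 0 < c) (hL : 0 < L)
    (hR : 0 < R) (hk : k ≠ 0) (h : IsReducedMinimiser a b c L R k u v) :
    ∀ r ∈ Ioc 0 R, |u r| ≤ a / c ∧ |v r| ≤ a / c ∧ v r ≤ -(sPlus a b c / √6) := by
  set s := sPlus a b c with hs
  have hs0 : 0 < s := sPlus_pos ha hc
  have hs2 := sPlus_sq (a := a) hb hc
  rw [← hs] at hs2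
  set ρ := a / c with hρ
  have hρ0 : 0 < ρ := div_pos ha hc
  set m := s / √2 with hm
  set n := s / √6 with hn
  have hm0 : 0 < m := by positivity
  have hn0 : 0 < n := by positivity
  have hm2 : m ^ 2 = 3 / 4 * ρ ^ 2 := by
    rw [hm, div_pow, Real.sq_sqrt (by norm_num), hs2]; ring
  have hn2 : n ^ 2 = 1 / 4 * ρ ^ 2 := by
    rw [hn, div_pow, Real.sq_sqrt (by norm_num), hs2]; ring
  have hmn : m ^ 2 + n ^ 2 = ρ ^ 2 := by rw [hm2, hn2]; ring
  have hnρ : n ≤ ρ := by nlinarith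
  have hS := h.1
  have bu : u R = m := hS.boundary_u
  have bv : v R = -n := hS.boundary_v
  have hκ : (k.natAbs : ℝ) ≠ 0 := by exact_mod_cast Int.natAbs_ne_zero.2 hk
  set κ : ℝ := Nat.cast k.natAbs with hκdef
  -- The competitor cuts `|u|` at `m` and replaces `v` by a negative value of modulus in `[n, ρ]`.
  -- Both maps are 1-Lipschitz and fix the boundary values, so the Dirichlet part does not grow.
  set ξ : ℝ → ℝ := fun r => min |u r| m with hξ
  set η : ℝ → ℝ := fun r => -max (min |v r| ρ) n with hη
  have dξ : ∀ x ∈ Ioc 0 R, ∀ y ∈ Ioc 0 R, |ξ x - ξ y| ≤ |u x - u y| := by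
    intro x _ y _
    refine (abs_min_sub_min_le_max _ _ _ _).trans ?_
    simpa using abs_abs_sub_abs_le (u x) (u y)
  have dη : ∀ x ∈ Ioc 0 R, ∀ y ∈ Ioc 0 R, |η x - η y| ≤ |v x - v y| := by
    intro x _ y _
    have e : η x - η y = max (min |v y| ρ) n - max (min |v x| ρ) n := by simp only [hη]; ring
    rw [e, abs_sub_comm]
    refine (abs_max_sub_max_le_max _ _ _ _).trans ?_
    refine max_le ((abs_min_sub_min_le_max _ _ _ _).trans ?_) (by simp)
    simpa using abs_abs_sub_abs_le (v x) (v y)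
  obtain ⟨aξ, leξ, mξ⟩ := memL2_deriv_of_dist_le hS.ac_u hS.deriv_u dξ
  obtain ⟨aη, leη, mη⟩ := memL2_deriv_of_dist_le hS.ac_v hS.deriv_v dη
  have ξ2 : ∀ r, ξ r ^ 2 = min (u r ^ 2) (m ^ 2) := fun r => min_abs_sq hm0.le
  have η2 : ∀ r, η r ^ 2 = max (min (v r ^ 2) (ρ ^ 2)) (n ^ 2) := fun r => by
    simp only [hη]
    rw [neg_sq, max_sq (le_min (abs_nonneg _) hρ0.le) hn0.le, min_abs_sq hρ0.le]
  have hξη : MemS a b c R ξ η :=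
    { ac_u := aξ
      ac_v := aη
      deriv_u := mξ
      deriv_v := mη
      weight_u := by
        refine memLp_two_of_sq_le (K := 1) (aξ.aestronglyMeasurable.mul
          (Real.continuous_sqrt.measurable.inv.aestronglyMeasurable)) hS.weight_u
          (Eventually.of_forall fun r => ?_)
        rw [one_mul, abs_div, abs_div]
        refine div_le_div_of_nonneg_right ?_ (abs_nonneg _)
        rw [← sq_le_sq, ξ2]
        exact min_le_left _ _
      weight_v := by
        refine memL2_of_abs_le (M := √R * ρ) (Real.continuous_sqrt.aestronglyMeasurable.mul
          aη.aestronglyMeasurable) fun r hr => ?_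
        rw [abs_mul, abs_of_nonneg (Real.sqrt_nonneg r)]
        have h₁ : |η r| ≤ ρ := by
          simp only [hη]
          rw [abs_neg, abs_of_nonneg (hn0.le.trans (le_max_right _ _))]
          exact max_le (min_le_right _ _) hnρ
        exact mul_le_mul (Real.sqrt_le_sqrt hr.2.le) h₁ (abs_nonneg _) (Real.sqrt_nonneg _)
      boundary_u := by
        simp only [hξ]
        rw [bu, abs_of_pos hm0, min_self]
      boundary_v := by
        simp only [hη]
        rw [bv, abs_neg, abs_of_pos hn0, min_eq_left hnρ, max_self] }
  have pot : ∀ r, (ξ r ^ 2 + η r ^ 2 - ρ ^ 2) ^ 2 ≤ (u r ^ 2 + v r ^ 2 - ρ ^ 2) ^ 2 := fun r => by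
    rw [ξ2, η2]
    exact truncation_potential_le (sq_nonneg _) hmn (sq_nonneg _)
  -- Completing the square turns the potential into `c²/(4L) (u² + v² - ρ²)²` up to a constant,
  -- which cancels in the difference.
  have diff : ∀ r, reducedDensity a c L κ u v r - reducedDensity a c L κ ξ η r =
      (1 / 2 * ((deriv u r ^ 2 - deriv ξ r ^ 2) + (deriv v r ^ 2 - deriv η r ^ 2) +
        κ ^ 2 / r ^ 2 * (u r ^ 2 - ξ r ^ 2)) +
        c ^ 2 / (4 * L) * ((u r ^ 2 + v r ^ 2 - ρ ^ 2) ^ 2 -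
          (ξ r ^ 2 + η r ^ 2 - ρ ^ 2) ^ 2)) * r := by
    intro r
    have e : a ^ 2 / (2 * L) = c ^ 2 / (4 * L) * (2 * ρ ^ 2) := by
      rw [hρ]; field_simp; ring
    simp only [reducedDensity, e]
    ring
  have cpos : 0 < c ^ 2 / (4 * L) := by positivity
  have ξle : ∀ r, ξ r ^ 2 ≤ u r ^ 2 := fun r => by rw [ξ2]; exact min_le_left _ _
  have hle : ∀ᵐ r ∂volume.restrict (Ioo 0 R),
      reducedDensity a c L κ ξ η r ≤ reducedDensity a c L κ u v r := by
    filter_upwards [leξ, leη, ae_mem_Ioo R] with r h₁ h₂ hr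
    rw [← sub_nonneg, diff]
    have h₃ := mul_nonneg (by positivity : 0 ≤ κ ^ 2 / r ^ 2) (sub_nonneg.2 (ξle r))
    have h₄ := mul_nonneg cpos.le (sub_nonneg.2 (pot r))
    exact mul_nonneg (by linarith) hr.1.le
  have hae : ∀ᵐ r ∂volume.restrict (Ioo 0 R), u r ^ 2 ≤ m ^ 2 ∧ n ^ 2 ≤ v r ^ 2 ∧
      v r ^ 2 ≤ ρ ^ 2 := by
    filter_upwards [leξ, leη, ae_mem_Ioo R, h.density_ae_eq hb hR hξη hle] with r h₁ h₂ hr h₅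
    have d := diff r
    rw [← hκdef] at h₅
    rw [h₅, sub_self] at d
    -- Three nonnegative contributions sum to zero. Since `κ ≠ 0`, the `1/r²` term forces `u² = ξ² ≤
    -- m²`; equality of the potentials then confines `v²`.
    have hkr : 0 < κ ^ 2 / r ^ 2 := by have := hr.1; positivity
    have h₃ := mul_nonneg hkr.le (sub_nonneg.2 (ξle r))
    have h₄ := mul_nonneg cpos.le (sub_nonneg.2 (pot r))
    have d' := (mul_eq_zero.1 d.symm).resolve_right hr.1.ne'
    have z₁ : κ ^ 2 / r ^ 2 * (u r ^ 2 - ξ r ^ 2) = 0 := by linarith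
    have z₂ : c ^ 2 / (4 * L) * ((u r ^ 2 + v r ^ 2 - ρ ^ 2) ^ 2 -
          (ξ r ^ 2 + η r ^ 2 - ρ ^ 2) ^ 2) = 0 := by linarith
    have y₁ : u r ^ 2 = ξ r ^ 2 := sub_eq_zero.1 ((mul_eq_zero.1 z₁).resolve_left hkr.ne')
    have y₂ := sub_eq_zero.1 ((mul_eq_zero.1 z₂).resolve_left cpos.ne')
    have hum : u r ^ 2 ≤ m ^ 2 := by rw [y₁, ξ2]; exact min_le_right _ _
    rw [← y₁, η2] at y₂
    exact ⟨hum, bounds_of_potential_eq (sq_nonneg _) hum hmn y₂⟩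
  have cu : ContinuousOn u (Ioo 0 R) := hS.ac_u.continuousOn.mono Ioo_subset_Ioc_self
  have cv : ContinuousOn v (Ioo 0 R) := hS.ac_v.continuousOn.mono Ioo_subset_Ioc_self
  have B₁ := le_of_ae_le (R := R) (cu.pow 2) (hae.mono fun r hr => hr.1)
  have B₂ := le_of_ae_le (R := R) (cv.pow 2) (hae.mono fun r hr => hr.2.2)
  have B₃ := le_of_ae_le (R := R) (f := fun r => -v r ^ 2) (C := -n ^ 2) (cv.pow 2).neg
    (hae.mono fun r hr => neg_le_neg hr.2.1)
  -- `v` is continuous with `|v| ≥ n` and `v R = -n`, so a positive value would force a zero in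
  -- between.
  have vneg : ∀ r ∈ Ioo 0 R, v r ≤ -n := by
    intro r hr
    have h₁ : n ≤ |v r| := by
      have := neg_le_neg_iff.1 (B₃ r hr)
      rw [sq_le_sq, abs_of_pos hn0] at this
      exact this
    by_contra! hv
    have hvn : n ≤ v r := by
      rcases le_abs.1 h₁ with h₁ | h₁
      · exact h₁
      · linarith
    have hcont : ContinuousOn v (Icc r R) :=
      hS.ac_v.continuousOn.mono fun x hx => ⟨hr.1.trans_le hx.1, hx.2⟩
    obtain ⟨x, hx, hx0⟩ := intermediate_value_Icc' hr.2.le hcont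
      (show (0 : ℝ) ∈ Icc (v R) (v r) from ⟨by rw [bv]; linarith, by linarith⟩)
    have hxR : x ≠ R := by rintro rfl; rw [bv] at hx0; linarith
    have := B₃ x ⟨hr.1.trans_le hx.1, lt_of_le_of_ne hx.2 hxR⟩
    simp only [hx0] at this
    nlinarith
  intro r hr
  rcases hr.2.eq_or_lt with rfl | hlt
  · refine ⟨?_, ?_, bv.le⟩
    · rw [bu, abs_of_pos hm0]; nlinarith
    · rw [bv, abs_neg, abs_of_pos hn0]; exact hnρ
  · have hr' : r ∈ Ioo 0 R := ⟨hr.1, hlt⟩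
    refine ⟨abs_le_of_sq_le_sq ((B₁ r hr').trans (by nlinarith)) hρ0.le,
      abs_le_of_sq_le_sq (B₂ r hr') hρ0.le, vneg r hr'⟩

/-! ### The Euler–Lagrange equation in weak form -/

/-- The coefficient `(c²|Y|² - a²)/L` of the linearised equation. -/
noncomputable def linCoeff (a c L : ℝ) (u v : ℝ → ℝ) (r : ℝ) : ℝ :=
  (c ^ 2 * (u r ^ 2 + v r ^ 2) - a ^ 2) / L

/-- `w` solves `-(r w')' / r + κ² w / r² + q w = 0` weakly on `(0, R)`. -/
def RadialWeakSolution (R κ : ℝ) (q w : ℝ → ℝ) : Prop :=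
  ∀ ξ : ℝ → ℝ, RadialProfile R κ ξ → (∃ M, ∀ r ∈ Ioo 0 R, |ξ r| ≤ M) → ξ R = 0 →
    ∫ r in Ioo 0 R, (deriv w r * deriv ξ r + κ ^ 2 / r ^ 2 * (w r * ξ r) + q r * w r * ξ r) * r = 0

/-- Dividing by `t` and letting `t` tend to `0` from the right and from the left gives both signs
for `A`; in the proof `s = ±1` selects the side. -/
theorem eq_zero_of_quartic_nonneg {A B C D : ℝ}
    (h : ∀ t : ℝ, 0 ≤ t * A + t ^ 2 * B + t ^ 3 * C + t ^ 4 * D) : A = 0 := by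
  have lim : ∀ s : ℝ, Tendsto (fun t : ℝ => A + (s * t) * B + (s * t) ^ 2 * C + (s * t) ^ 3 * D)
      (𝓝[>] 0) (𝓝 A) := by
    intro s
    have : Continuous fun t : ℝ => A + (s * t) * B + (s * t) ^ 2 * C + (s * t) ^ 3 * D := by
      fun_prop
    have := this.tendsto 0
    simp only [mul_zero, zero_mul, add_zero, ne_eq, OfNat.ofNat_ne_zero, not_false_eq_true,
      zero_pow] at this
    exact this.mono_left nhdsWithin_le_nhds
  refine le_antisymm ?_ ?_
  · refine le_of_tendsto (lim (-1)) ?_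
    filter_upwards [self_mem_nhdsWithin] with t ht
    have ht : 0 < t := ht
    have := h (-1 * t)
    by_contra! hneg
    nlinarith
  · refine ge_of_tendsto (lim 1) ?_
    filter_upwards [self_mem_nhdsWithin] with t ht
    have ht : 0 < t := ht
    have := h (1 * t)
    by_contra! hneg
    nlinarith

/-- The potential is a polynomial, so the energy gained along `(u + tξ, v + tη)` is exactly `tA +
t²B + t³C + t⁴D`. The pointwise bounds make all four coefficients integrable, and no differentiation
under the integral is needed. -/
theorem IsReducedMinimiser.weak_equation (hb : b ^ 2 = 0) (hR : 0 < R)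
    (hk : k ≠ 0) (h : IsReducedMinimiser a b c L R k u v) {N : ℝ}
    (hN : ∀ r ∈ Ioc 0 R, |u r| ≤ N ∧ |v r| ≤ N) {ξ η : ℝ → ℝ}
    (hξ : RadialProfile R k.natAbs ξ) (hη : RadialProfile R 0 η)
    (bξ : ∃ M, ∀ r ∈ Ioo 0 R, |ξ r| ≤ M) (bη : ∃ M, ∀ r ∈ Ioo 0 R, |η r| ≤ M)
    (zξ : ξ R = 0) (zη : η R = 0) :
    IntegrableOn (fun r => (deriv u r * deriv ξ r + deriv v r * deriv η r +
      (k.natAbs : ℝ) ^ 2 / r ^ 2 * (u r * ξ r) +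
      linCoeff a c L u v r * (u r * ξ r + v r * η r)) * r) (Ioo 0 R) ∧
    ∫ r in Ioo 0 R, (deriv u r * deriv ξ r + deriv v r * deriv η r +
      (k.natAbs : ℝ) ^ 2 / r ^ 2 * (u r * ξ r) +
      linCoeff a c L u v r * (u r * ξ r + v r * η r)) * r = 0 := by
  have hκ : (k.natAbs : ℝ) ≠ 0 := by exact_mod_cast Int.natAbs_ne_zero.2 hk
  set κ : ℝ := Nat.cast k.natAbs with hκdef
  obtain ⟨M, hM⟩ := bξ
  obtain ⟨M', hM'⟩ := bη
  have hu := h.1.profile_u κ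
  have hv := h.1.profile_v
  have mu := hu.ac.aestronglyMeasurable
  have mv := hv.ac.aestronglyMeasurable
  have mξ := hξ.ac.aestronglyMeasurable
  have mη := hη.ac.aestronglyMeasurable
  set K := max N (max M M') with hK
  have K1 : ∀ r ∈ Ioo 0 R, |u r| ≤ K ∧ |v r| ≤ K ∧ |ξ r| ≤ K ∧ |η r| ≤ K := fun r hr => by
    obtain ⟨h₁, h₂⟩ := hN r (Ioo_subset_Ioc_self hr)
    exact ⟨h₁.trans (le_max_left _ _), h₂.trans (le_max_left _ _),
      (hM r hr).trans ((le_max_left _ _).trans (le_max_right _ _)),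
      (hM' r hr).trans ((le_max_right _ _).trans (le_max_right _ _))⟩
  -- Terms without derivatives or the weight `1/r²` are continuous functions of bounded quantities.
  have bdd : ∀ P : ℝ × ℝ × ℝ × ℝ × ℝ → ℝ, Continuous P →
      IntegrableOn (fun r => P (u r, v r, ξ r, η r, r)) (Ioo 0 R) := by
    intro P hP
    have hc : IsCompact (Icc (-K) K ×ˢ Icc (-K) K ×ˢ Icc (-K) K ×ˢ Icc (-K) K ×ˢ Icc 0 R) :=
      isCompact_Icc.prod (isCompact_Icc.prod (isCompact_Icc.prod
        (isCompact_Icc.prod isCompact_Icc)))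
    obtain ⟨C, hC⟩ := hc.exists_bound_of_continuousOn hP.continuousOn
    refine integrable_of_abs_le (M := C) (hP.comp_aestronglyMeasurable
      (mu.prodMk (mv.prodMk (mξ.prodMk (mη.prodMk aestronglyMeasurable_id))))) fun r hr => ?_
    obtain ⟨h₁, h₂, h₃, h₄⟩ := K1 r hr
    exact hC _ ⟨abs_le.1 h₁, abs_le.1 h₂, abs_le.1 h₃, abs_le.1 h₄, hr.1.le, hr.2.le⟩
  set A : ℝ → ℝ := fun r => (deriv u r * deriv ξ r + deriv v r * deriv η r +
      κ ^ 2 / r ^ 2 * (u r * ξ r) + linCoeff a c L u v r * (u r * ξ r + v r * η r)) * r with hA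
  set B : ℝ → ℝ := fun r => 1 / 2 * (deriv ξ r * deriv ξ r * r + deriv η r * deriv η r * r +
      κ ^ 2 / r ^ 2 * (ξ r * ξ r) * r) + (-(a ^ 2 / (2 * L)) * (ξ r ^ 2 + η r ^ 2) +
      c ^ 2 / (4 * L) * (4 * (u r * ξ r + v r * η r) ^ 2 +
        2 * (u r ^ 2 + v r ^ 2) * (ξ r ^ 2 + η r ^ 2))) * r with hB
  set C : ℝ → ℝ := fun r => c ^ 2 / L * (u r * ξ r + v r * η r) * (ξ r ^ 2 + η r ^ 2) * r with hC
  set D : ℝ → ℝ := fun r => c ^ 2 / (4 * L) * (ξ r ^ 2 + η r ^ 2) ^ 2 * r with hD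
  have iA : IntegrableOn A (Ioo 0 R) := by
    have i₁ := ((hu.integrable_deriv_mul hξ).add (hv.integrable_deriv_mul hη)).add
      (hu.integrable_weight_mul hξ)
    have i₂ := bdd (fun p => (c ^ 2 * (p.1 ^ 2 + p.2.1 ^ 2) - a ^ 2) / L *
      (p.1 * p.2.2.1 + p.2.1 * p.2.2.2.1) * p.2.2.2.2) (by fun_prop)
    refine (i₁.add i₂).congr (Eventually.of_forall fun r => ?_)
    simp only [Pi.add_apply, hA, linCoeff]
    ring
  have iB : IntegrableOn B (Ioo 0 R) := by
    have i₁ := (((hξ.integrable_deriv_mul hξ).add (hη.integrable_deriv_mul hη)).add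
      (hξ.integrable_weight_mul hξ)).const_mul (1 / 2)
    have i₂ := bdd (fun p => (-(a ^ 2 / (2 * L)) * (p.2.2.1 ^ 2 + p.2.2.2.1 ^ 2) +
      c ^ 2 / (4 * L) * (4 * (p.1 * p.2.2.1 + p.2.1 * p.2.2.2.1) ^ 2 +
        2 * (p.1 ^ 2 + p.2.1 ^ 2) * (p.2.2.1 ^ 2 + p.2.2.2.1 ^ 2))) * p.2.2.2.2) (by fun_prop)
    exact i₁.add i₂
  have iC : IntegrableOn C (Ioo 0 R) :=
    bdd (fun p => c ^ 2 / L * (p.1 * p.2.2.1 + p.2.1 * p.2.2.2.1) *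
      (p.2.2.1 ^ 2 + p.2.2.2.1 ^ 2) * p.2.2.2.2) (by fun_prop)
  have iD : IntegrableOn D (Ioo 0 R) :=
    bdd (fun p => c ^ 2 / (4 * L) * (p.2.2.1 ^ 2 + p.2.2.2.1 ^ 2) ^ 2 * p.2.2.2.2) (by fun_prop)
  refine ⟨iA, eq_zero_of_quartic_nonneg (B := ∫ r in Ioo 0 R, B r) (C := ∫ r in Ioo 0 R, C r)
    (D := ∫ r in Ioo 0 R, D r) fun t => ?_⟩
  have hS : MemS a b c R (fun r => u r + t * ξ r) fun r => v r + t * η r :=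
    memS_of_profile hκ (hu.add_mul hξ t) (hv.add_mul hη t)
      (by rw [zξ, mul_zero, add_zero]; exact h.1.boundary_u)
      (by rw [zη, mul_zero, add_zero]; exact h.1.boundary_v)
  have hmin := h.2 _ _ hS
  rw [reducedEnergy_eq hb hR, reducedEnergy_eq hb hR, ← sub_nonneg,
    ← integral_sub (integrable_reducedDensity (hu.add_mul hξ t) (hv.add_mul hη t))
      (integrable_reducedDensity hu hv)] at hmin
  refine hmin.trans_eq ?_
  have iA' := iA.const_mul t
  have iB' := iB.const_mul (t ^ 2)
  have iC' := iC.const_mul (t ^ 3)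
  have iD' := iD.const_mul (t ^ 4)
  calc _ = ∫ r in Ioo 0 R, (t * A r + t ^ 2 * B r + t ^ 3 * C r + t ^ 4 * D r) := by
        refine integral_congr_ae ?_
        filter_upwards [RadialProfile.deriv_add_mul hu.ac hξ.ac t,
          RadialProfile.deriv_add_mul hv.ac hη.ac t] with r h₁ h₂
        simp only [reducedDensity, h₁, h₂, hA, hB, hC, hD, linCoeff]
        ring
    _ = _ := by
        have iAB : Integrable (fun r => t * A r + t ^ 2 * B r) (volume.restrict (Ioo 0 R)) :=
          iA'.add iB'
        have iABC : Integrable (fun r => t * A r + t ^ 2 * B r + t ^ 3 * C r)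
          (volume.restrict (Ioo 0 R)) := iAB.add iC'
        rw [integral_add iABC iD', integral_add iAB iC',
          integral_add iA' iB', integral_const_mul, integral_const_mul, integral_const_mul,
          integral_const_mul]

end Bounds

end QTensor

namespace QTensor

/-! ### Radial equations for `u` and `v`, and coercivity on the interval -/

section Hardy

variable {a b c L R : ℝ} {k : ℤ} {u v : ℝ → ℝ}

theorem RadialProfile.zero (hR : 0 < R) (κ : ℝ) : RadialProfile R κ fun _ => 0 :=
  .of_contDiff hR contDiff_const (M := 0) (by simp)

theorem IsReducedMinimiser.weakSolution_u (hb : b ^ 2 = 0) (hR : 0 < R)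
    (hk : k ≠ 0) (h : IsReducedMinimiser a b c L R k u v) {N : ℝ}
    (hN : ∀ r ∈ Ioc 0 R, |u r| ≤ N ∧ |v r| ≤ N) :
    RadialWeakSolution R k.natAbs (linCoeff a c L u v) u := by
  intro ξ hξ bξ zξ
  refine Eq.trans ?_ (h.weak_equation hb hR hk hN hξ (.zero hR 0) bξ ⟨0, by simp⟩ zξ rfl).2
  congr 1
  ext r
  simp only [deriv_const, mul_zero, add_zero]
  ring

theorem IsReducedMinimiser.weakSolution_v (hb : b ^ 2 = 0) (hR : 0 < R)
    (hk : k ≠ 0) (h : IsReducedMinimiser a b c L R k u v) {N : ℝ}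
    (hN : ∀ r ∈ Ioc 0 R, |u r| ≤ N ∧ |v r| ≤ N) :
    RadialWeakSolution R 0 (linCoeff a c L u v) v := by
  intro η hη bη zη
  refine Eq.trans ?_ (h.weak_equation hb hR hk hN (.zero hR _) hη ⟨0, by simp⟩ bη rfl zη).2
  congr 1
  ext r
  simp only [deriv_const, mul_zero, zero_add]
  ring

/-- Hardy's decomposition: a weak solution that is bounded away from zero makes the quadratic form
coercive. -/
theorem RadialWeakSolution.coercive (hR : 0 < R) {q : ℝ → ℝ} {n ρ K : ℝ} (hn : 0 < n)
    (hv : RadialProfile R 0 v) (hs : RadialWeakSolution R 0 q v)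
    (hvn : ∀ r ∈ Ioc 0 R, v r ≤ -n) (hvρ : ∀ r ∈ Ioc 0 R, |v r| ≤ ρ)
    (mq : AEStronglyMeasurable q (volume.restrict (Ioo 0 R))) (hq : ∀ r ∈ Ioo 0 R, |q r| ≤ K)
    {p : ℝ → ℝ} (hp : ContDiff ℝ 1 p) (pR : p R = 0) :
    n ^ 2 / (2 * R ^ 2 * ρ ^ 2) * ∫ r in Ioo 0 R, p r ^ 2 * r ≤
      ∫ r in Ioo 0 R, (deriv p r ^ 2 + q r * p r ^ 2) * r := by
  have hvn' : ∀ r ∈ Ioc 0 R, n ≤ |v r| := fun r hr =>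
    (le_neg.1 (hvn r hr)).trans (neg_le_abs _)
  have hv0 : ∀ r ∈ Ioc 0 R, v r ≠ 0 := fun r hr h => by
    have := hvn r hr; rw [h] at this; linarith
  have hρ : 0 < ρ := hn.trans_le ((hvn' R ⟨hR, le_rfl⟩).trans (hvρ R ⟨hR, le_rfl⟩))
  have acp : LocallyAC R p := .of_contDiffOn hp.contDiffOn
  -- Inversion is Lipschitz with constant `n⁻²` on each half-line `|x| ≥ n`, and all values of `v`
  -- lie in the negative one.
  have aci : LocallyAC R fun r => (v r)⁻¹ := by
    refine hv.ac.of_dist_le (K := (n ^ 2)⁻¹) fun x hx y hy => ?_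
    rw [inv_sub_inv (hv0 x hx) (hv0 y hy), abs_div, abs_mul, abs_sub_comm, div_eq_inv_mul]
    refine mul_le_mul_of_nonneg_right ?_ (abs_nonneg _)
    have := mul_le_mul (hvn' x hx) (hvn' y hy) hn.le (abs_nonneg _)
    exact inv_anti₀ (by positivity) (by rw [pow_two]; exact this)
  have acg := acp.mul aci
  set g : ℝ → ℝ := fun r => p r * (v r)⁻¹ with hg
  have acη := acp.mul acg
  -- The test function is `η = p²/v = v g²`.
  set η : ℝ → ℝ := fun r => p r * g r with hη
  have hdp := hp.continuous_deriv_one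
  obtain ⟨M₁, hM₁⟩ := isCompact_Icc (a := (0 : ℝ)) (b := R) |>.exists_bound_of_continuousOn
    hp.continuous.continuousOn
  obtain ⟨M₂, hM₂⟩ := isCompact_Icc (a := (0 : ℝ)) (b := R) |>.exists_bound_of_continuousOn
    hdp.continuousOn
  simp only [Real.norm_eq_abs] at hM₁ hM₂
  have hM₁0 : 0 ≤ M₁ := (abs_nonneg _).trans (hM₁ 0 ⟨le_rfl, hR.le⟩)
  have hM₂0 : 0 ≤ M₂ := (abs_nonneg _).trans (hM₂ 0 ⟨le_rfl, hR.le⟩)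
  have mv := hv.ac.aestronglyMeasurable
  have mi := aci.aestronglyMeasurable
  have mp : AEStronglyMeasurable p (volume.restrict (Ioo 0 R)) := hp.continuous.aestronglyMeasurable
  have mdp : AEStronglyMeasurable (deriv p) (volume.restrict (Ioo 0 R)) := hdp.aestronglyMeasurable
  have ms : AEStronglyMeasurable (fun r => √r) (volume.restrict (Ioo 0 R)) :=
    Real.continuous_sqrt.aestronglyMeasurable
  have bi : ∀ r ∈ Ioo 0 R, |(v r)⁻¹| ≤ n⁻¹ := fun r hr => by
    rw [abs_inv]; exact inv_anti₀ hn (hvn' r (Ioo_subset_Ioc_self hr))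
  have bg : ∀ r ∈ Ioo 0 R, |g r| ≤ M₁ * n⁻¹ := fun r hr => by
    rw [hg, abs_mul]
    exact mul_le_mul (hM₁ r (Ioo_subset_Icc_self hr)) (bi r hr) (abs_nonneg _) hM₁0
  have dg : ∀ᵐ r ∂volume.restrict (Ioo 0 R),
      deriv g r = deriv p r * (v r)⁻¹ + (-(p r * ((v r)⁻¹ * (v r)⁻¹))) * deriv v r := by
    filter_upwards [ae_mem_Ioo R, hv.ac.ae_differentiableAt] with r hr h₁
    have h₂ := hv0 r (Ioo_subset_Ioc_self hr)
    have := (hp.differentiable_one r).hasDerivAt.mul (h₁.hasDerivAt.inv h₂)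
    have e := this.deriv
    simp only [hg]
    refine Eq.trans ?_ (e.trans ?_)
    · rfl
    · simp only [Pi.inv_apply]
      field_simp
  have dη : ∀ᵐ r ∂volume.restrict (Ioo 0 R), deriv η r = deriv p r * g r + p r * deriv g r := by
    filter_upwards [acg.ae_differentiableAt] with r h₁
    exact ((hp.differentiable_one r).hasDerivAt.mul h₁.hasDerivAt).deriv
  have bs : ∀ r ∈ Ioo 0 R, |√r| ≤ √R := fun r hr => by
    rw [abs_of_nonneg (Real.sqrt_nonneg _)]; exact Real.sqrt_le_sqrt hr.2.le
  have mem₁ : ∀ {f : ℝ → ℝ} {C : ℝ}, AEStronglyMeasurable f (volume.restrict (Ioo 0 R)) →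
      (∀ r ∈ Ioo 0 R, |f r| ≤ C) → MemL2 R fun r => √r * f r := by
    intro f C mf hC
    refine memL2_of_abs_le (M := √R * C) (ms.mul mf) fun r hr => ?_
    rw [abs_mul]
    exact mul_le_mul (bs r hr) (hC r hr) (abs_nonneg _) (Real.sqrt_nonneg _)
  have Lg : MemL2 R fun r => √r * deriv g r := by
    have h₁ : MemL2 R fun r => √r * (deriv p r * (v r)⁻¹) :=
      mem₁ (C := M₂ * n⁻¹) (mdp.mul mi) fun r hr => by
        rw [abs_mul]
        exact mul_le_mul (hM₂ r (Ioo_subset_Icc_self hr)) (bi r hr) (abs_nonneg _) hM₂0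
    have h₂ : MemL2 R fun r => (-(p r * ((v r)⁻¹ * (v r)⁻¹))) * (√r * deriv v r) := by
      refine memLp_bdd_mul (K := M₁ * (n⁻¹ * n⁻¹)) hv.deriv (mp.mul (mi.mul mi)).neg
        ((ae_mem_Ioo R).mono fun r hr => ?_)
      rw [abs_neg, abs_mul, abs_mul]
      have := bi r hr
      exact mul_le_mul (hM₁ r (Ioo_subset_Icc_self hr)) (mul_le_mul this this (abs_nonneg _)
        (by positivity)) (by positivity) hM₁0
    refine (MemLp.add h₁ h₂).ae_eq (dg.mono fun r hr => ?_)
    simp only [Pi.add_apply, hr]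
    ring
  have Lη : MemL2 R fun r => √r * deriv η r := by
    have h₁ : MemL2 R fun r => √r * (deriv p r * g r) :=
      mem₁ (C := M₂ * (M₁ * n⁻¹)) (mdp.mul acg.aestronglyMeasurable) fun r hr => by
        rw [abs_mul]
        exact mul_le_mul (hM₂ r (Ioo_subset_Icc_self hr)) (bg r hr) (abs_nonneg _) hM₂0
    have h₂ : MemL2 R fun r => p r * (√r * deriv g r) :=
      memLp_bdd_mul (K := M₁) Lg mp ((ae_mem_Ioo R).mono fun r hr => hM₁ r (Ioo_subset_Icc_self hr))
    refine (MemLp.add h₁ h₂).ae_eq (dη.mono fun r hr => ?_)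
    simp only [Pi.add_apply, hr]
    ring
  have bη : ∀ r ∈ Ioo 0 R, |η r| ≤ M₁ * (M₁ * n⁻¹) := fun r hr => by
    rw [hη, abs_mul]
    exact mul_le_mul (hM₁ r (Ioo_subset_Icc_self hr)) (bg r hr) (abs_nonneg _) hM₁0
  have Pη : RadialProfile R 0 η :=
    ⟨acη, Lη, memL2_of_abs_le (M := 0) (by simpa using aestronglyMeasurable_const) (by simp),
      mem₁ acη.aestronglyMeasurable bη⟩
  have key := hs η Pη ⟨_, bη⟩ (by simp only [hη, pR, zero_mul])
  have gR : g R = 0 := by simp only [hg, pR, zero_mul]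
  have iG : IntegrableOn (fun r => v r ^ 2 * (√r * deriv g r) ^ 2) (Ioo 0 R) := by
    refine (integrable_sq_of_memLp Lg).bdd_mul (c := ρ ^ 2) (mv.pow 2)
      ((ae_mem_Ioo R).mono fun r hr => ?_)
    rw [Real.norm_eq_abs, abs_pow]
    exact pow_le_pow_left₀ (abs_nonneg _) (hvρ r (Ioo_subset_Ioc_self hr)) 2
  have iP : IntegrableOn (fun r => (deriv p r ^ 2 + q r * p r ^ 2) * r) (Ioo 0 R) := by
    refine integrable_of_abs_le (M := (M₂ ^ 2 + K * M₁ ^ 2) * R)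
      (((mdp.pow 2).add (mq.mul (mp.pow 2))).mul aestronglyMeasurable_id) fun r hr => ?_
    have h₁ := hM₁ r (Ioo_subset_Icc_self hr)
    have h₂ := hM₂ r (Ioo_subset_Icc_self hr)
    have h₃ := hq r hr
    have hK : 0 ≤ K := (abs_nonneg _).trans h₃
    rw [abs_mul, abs_of_pos hr.1]
    refine mul_le_mul ((abs_add_le _ _).trans ?_) hr.2.le hr.1.le (by positivity)
    rw [abs_mul, abs_pow, abs_pow]
    gcongr
  have iD : IntegrableOn (fun r => r * deriv g r ^ 2) (Ioo 0 R) := by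
    refine (integrable_sq_of_memLp Lg).congr ((ae_mem_Ioo R).mono fun r hr => ?_)
    simp only
    rw [mul_pow, Real.sq_sqrt hr.1.le]
  -- With `p = v g` one has `p'² - v² g'² = v' (v g²)' = v' η'` and `q p² = q v η`, so the
  -- difference of the two sides is the weak equation of `v` tested with `η`.
  have e₁ : ∫ r in Ioo 0 R, (deriv p r ^ 2 + q r * p r ^ 2) * r =
      ∫ r in Ioo 0 R, v r ^ 2 * (√r * deriv g r) ^ 2 := by
    rw [← sub_eq_zero, ← integral_sub iP iG]
    refine Eq.trans (integral_congr_ae ?_) key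
    filter_upwards [ae_mem_Ioo R, dg, dη] with r hr h₁ h₂
    have h₃ := hv0 r (Ioo_subset_Ioc_self hr)
    rw [mul_pow, Real.sq_sqrt hr.1.le, h₂, h₁]
    simp only [hη, hg]
    field_simp
    ring
  have e₂ : n ^ 2 * ∫ r in Ioo 0 R, r * deriv g r ^ 2 ≤
      ∫ r in Ioo 0 R, v r ^ 2 * (√r * deriv g r) ^ 2 := by
    rw [← integral_const_mul]
    refine setIntegral_mono_on (iD.const_mul _) iG measurableSet_Ioo fun r hr => ?_
    rw [mul_pow, Real.sq_sqrt hr.1.le]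
    have h₁ : n ^ 2 ≤ v r ^ 2 := by
      rw [← sq_abs (v r)]
      exact pow_le_pow_left₀ hn.le (hvn' r (Ioo_subset_Ioc_self hr)) 2
    exact mul_le_mul_of_nonneg_right h₁ (mul_nonneg hr.1.le (sq_nonneg _))
  -- The Poincaré constant `2R²` for `g`, with `v² ≥ n²` on the derivative side and `v² ≤ ρ²` on the
  -- function side, produces `n²/(2R²ρ²)`.
  have e₃ := acg.integral_sq_le hR gR Lg
  have ig : IntegrableOn (fun r => r * g r ^ 2) (Ioo 0 R) := by
    refine integrable_of_abs_le (M := R * (M₁ * n⁻¹) ^ 2)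
      (aestronglyMeasurable_id.mul (acg.aestronglyMeasurable.pow 2)) fun r hr => ?_
    rw [abs_mul, abs_of_pos hr.1, abs_pow]
    have := bg r hr
    have := hr.2.le
    have := hR.le
    gcongr
  have e₄ : (∫ r in Ioo 0 R, p r ^ 2 * r) ≤ ρ ^ 2 * ∫ r in Ioo 0 R, r * g r ^ 2 := by
    rw [← integral_const_mul]
    refine setIntegral_mono_on ?_ (ig.const_mul _) measurableSet_Ioo fun r hr => ?_
    · exact (hp.continuous.pow 2).mul continuous_id |>.integrableOn_Icc.mono_set Ioo_subset_Icc_self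
    · have h₁ : p r = v r * g r := by
        simp only [hg]
        have := hv0 r (Ioo_subset_Ioc_self hr)
        field_simp
      have h₂ : v r ^ 2 ≤ ρ ^ 2 := by
        rw [← sq_abs (v r)]
        exact pow_le_pow_left₀ (abs_nonneg _) (hvρ r (Ioo_subset_Ioc_self hr)) 2
      rw [h₁]
      nlinarith [mul_le_mul_of_nonneg_right h₂ (mul_nonneg hr.1.le (sq_nonneg (g r)))]
  rw [e₁]
  refine le_trans ?_ e₂
  rw [div_mul_eq_mul_div, div_le_iff₀ (by positivity)]
  calc n ^ 2 * ∫ r in Ioo 0 R, p r ^ 2 * r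
      ≤ n ^ 2 * (ρ ^ 2 * (2 * R ^ 2 * ∫ r in Ioo 0 R, r * deriv g r ^ 2)) :=
        mul_le_mul_of_nonneg_left
        (e₄.trans (mul_le_mul_of_nonneg_left e₃ (sq_nonneg _))) (sq_nonneg _)
    _ = _ := by ring

end Hardy

end QTensor

namespace QTensor

/-! ### Weak derivatives and `H¹₀` -/

section Sobolev

variable {Ω : Set Plane} {l : Fin 2} {f g φ ψ : Plane → ℝ}

theorem contDiff_partialDeriv (hf : ContDiff ℝ ∞ f) (l : Fin 2) :
    ContDiff ℝ ∞ (partialDeriv l f) :=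
  (hf.fderiv_right (m := ∞) (by simp)).clm_apply contDiff_const

theorem partialDeriv_add (hf : ContDiff ℝ ∞ f) (hg : ContDiff ℝ ∞ g) (x : Plane) :
    partialDeriv l (fun y => f y + g y) x = partialDeriv l f x + partialDeriv l g x := by
  simp only [partialDeriv]
  rw [fderiv_fun_add (hf.differentiable (by simp) x) (hg.differentiable (by simp) x)]
  rfl

namespace IsTestFunction

theorem hasCompactSupport_partialDeriv (hφ : IsTestFunction Ω φ) (l : Fin 2) :
    HasCompactSupport (partialDeriv l φ) :=
  hφ.compact.fderiv_apply ℝ _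

theorem memLp (hφ : IsTestFunction Ω φ) (p : ENNReal) : MemLp φ p (volume.restrict Ω) :=
  (hφ.smooth.continuous.memLp_of_hasCompactSupport hφ.compact).restrict Ω

theorem memLp_partialDeriv (hφ : IsTestFunction Ω φ) (l : Fin 2) :
    MemLp (partialDeriv l φ) 2 (volume.restrict Ω) :=
  ((contDiff_partialDeriv hφ.smooth l).continuous.memLp_of_hasCompactSupport
    (hφ.hasCompactSupport_partialDeriv l)).restrict Ω

theorem apply_eq_zero (hφ : IsTestFunction Ω φ) {x : Plane} (hx : x ∉ Ω) : φ x = 0 :=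
  image_eq_zero_of_notMem_tsupport fun h => hx (hφ.support h)

theorem partialDeriv_eq_zero (hφ : IsTestFunction Ω φ) {x : Plane} (hx : x ∉ Ω) :
    partialDeriv l φ x = 0 := by
  have : fderiv ℝ φ x = 0 := by
    by_contra h
    exact hx (hφ.support (support_fderiv_subset ℝ h))
  simp [partialDeriv, this]

theorem add (hφ : IsTestFunction Ω φ) (hψ : IsTestFunction Ω ψ) :
    IsTestFunction Ω fun x => φ x + ψ x :=
  ⟨hφ.smooth.add hψ.smooth, hφ.compact.add hψ.compact,
    (tsupport_add φ ψ).trans (union_subset hφ.support hψ.support)⟩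

end IsTestFunction

/-- As `ψ` has compact support inside `Ω`, both integrals extend to the whole plane, where
integration by parts has no boundary term and `f` needs no decay. -/
theorem setIntegral_mul_partialDeriv (hf : ContDiff ℝ ∞ f) (hψ : IsTestFunction Ω ψ) :
    ∫ x in Ω, f x * partialDeriv l ψ x = - ∫ x in Ω, partialDeriv l f x * ψ x := by
  rw [setIntegral_eq_integral_of_forall_compl_eq_zero fun x hx => by
      rw [hψ.partialDeriv_eq_zero hx, mul_zero],
    setIntegral_eq_integral_of_forall_compl_eq_zero fun x hx => by
      rw [hψ.apply_eq_zero hx, mul_zero]]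
  have hψ' := hψ.smooth.continuous
  have c₁ := (contDiff_partialDeriv hf l).continuous
  have c₂ := (contDiff_partialDeriv hψ.smooth l).continuous
  exact integral_mul_fderiv_eq_neg_fderiv_mul_of_integrable
    ((c₁.mul hψ').integrable_of_hasCompactSupport hψ.compact.mul_left)
    ((hf.continuous.mul c₂).integrable_of_hasCompactSupport
      (hψ.hasCompactSupport_partialDeriv l).mul_left)
    ((hf.continuous.mul hψ').integrable_of_hasCompactSupport hψ.compact.mul_left)
    (fun x _ => hf.differentiable (by simp) x) (fun x _ => hψ.smooth.differentiable (by simp) x)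

theorem memLp_disk_of_continuous (hf : Continuous f) (R : ℝ) (p : ENNReal) :
    MemLp f p (volume.restrict (disk R)) := by
  obtain ⟨C, hC⟩ := (isCompact_closedBall (0 : Plane) R).exists_bound_of_continuousOn
    hf.continuousOn
  have : IsFiniteMeasure (volume.restrict (disk R)) := ⟨by
    rw [Measure.restrict_apply_univ]; exact measure_ball_lt_top⟩
  exact MemLp.of_bound hf.aestronglyMeasurable C
    ((ae_restrict_mem measurableSet_ball).mono fun x hx => hC x (Metric.ball_subset_closedBall hx))

theorem isWeakPartial_of_contDiff (hf : ContDiff ℝ ∞ f) (R : ℝ) (l : Fin 2) :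
    IsWeakPartial (disk R) l f (partialDeriv l f) :=
  ⟨memLp_disk_of_continuous (contDiff_partialDeriv hf l).continuous R 2,
    fun _ hψ => setIntegral_mul_partialDeriv hf hψ⟩

theorem MemH1.isWeakPartial (hf : MemH1 Ω f) (l : Fin 2) :
    IsWeakPartial Ω l f (weakPartial Ω l f) := by
  rw [weakPartial, dif_pos (hf.exists_weakPartial l)]
  exact (hf.exists_weakPartial l).choose_spec

theorem IsWeakPartial.weakPartial_ae_eq (hΩ : IsOpen Ω) (h : IsWeakPartial Ω l f g) :
    weakPartial Ω l f =ᵐ[volume.restrict Ω] g := by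
  have : IsWeakPartial Ω l f (weakPartial Ω l f) := by
    rw [weakPartial, dif_pos ⟨g, h⟩]
    exact Exists.choose_spec (⟨g, h⟩ : ∃ g, IsWeakPartial Ω l f g)
  exact this.ae_eq hΩ h

theorem IsWeakPartial.add {f₁ f₂ g₁ g₂ : Plane → ℝ} (m₁ : MemLp f₁ 2 (volume.restrict Ω))
    (m₂ : MemLp f₂ 2 (volume.restrict Ω)) (h₁ : IsWeakPartial Ω l f₁ g₁)
    (h₂ : IsWeakPartial Ω l f₂ g₂) :
    IsWeakPartial Ω l (fun x => f₁ x + f₂ x) fun x => g₁ x + g₂ x := by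
  refine ⟨MemLp.add h₁.memLp h₂.memLp, fun φ hφ => ?_⟩
  simp_rw [add_mul]
  rw [integral_add (integrable_mul_of_memLp m₁ (hφ.memLp_partialDeriv l))
    (integrable_mul_of_memLp m₂ (hφ.memLp_partialDeriv l)),
    integral_add (integrable_mul_of_memLp h₁.memLp (hφ.memLp 2))
    (integrable_mul_of_memLp h₂.memLp (hφ.memLp 2)), h₁.integral_eq φ hφ, h₂.integral_eq φ hφ,
    neg_add]

theorem IsWeakPartial.neg (h : IsWeakPartial Ω l f g) :
    IsWeakPartial Ω l (fun x => -f x) fun x => -g x := by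
  refine ⟨MemLp.neg h.memLp, fun φ hφ => ?_⟩
  simp_rw [neg_mul, integral_neg]
  rw [h.integral_eq φ hφ]

theorem MemH1.add (hf : MemH1 Ω f) (hg : MemH1 Ω g) : MemH1 Ω fun x => f x + g x :=
  ⟨MemLp.add hf.memLp hg.memLp, fun l =>
    ⟨_, (hf.isWeakPartial l).add hf.memLp hg.memLp (hg.isWeakPartial l)⟩⟩

theorem MemH1.neg (hf : MemH1 Ω f) : MemH1 Ω fun x => -f x :=
  ⟨MemLp.neg hf.memLp, fun l => ⟨_, (hf.isWeakPartial l).neg⟩⟩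

theorem tendsto_eLpNorm_add {α : Type*} [MeasurableSpace α] {μ : Measure α} {f g : ℕ → α → ℝ}
    (hf : ∀ n, AEStronglyMeasurable (f n) μ) (hg : ∀ n, AEStronglyMeasurable (g n) μ)
    (h₁ : Tendsto (fun n => eLpNorm (f n) 2 μ) atTop (𝓝 0))
    (h₂ : Tendsto (fun n => eLpNorm (g n) 2 μ) atTop (𝓝 0)) :
    Tendsto (fun n => eLpNorm (f n + g n) 2 μ) atTop (𝓝 0) :=
  tendsto_of_tendsto_of_tendsto_of_le_of_le tendsto_const_nhds (by simpa using h₁.add h₂)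
    (fun _ => zero_le) fun n => eLpNorm_add_le (hf n) (hg n) (by norm_num)

/-- A limit of test functions whose derivatives converge in `L²` belongs to `H¹₀`. -/
theorem MemH10.of_tendsto (hΩ : IsOpen Ω) {φ : ℕ → Plane → ℝ} {g : Fin 2 → Plane → ℝ}
    (hφ : ∀ m, IsTestFunction Ω (φ m)) (hf : MemLp f 2 (volume.restrict Ω))
    (hg : ∀ l, MemLp (g l) 2 (volume.restrict Ω))
    (h₁ : Tendsto (fun m => eLpNorm (f - φ m) 2 (volume.restrict Ω)) atTop (𝓝 0))
    (h₂ : ∀ l, Tendsto (fun m => eLpNorm (g l - partialDeriv l (φ m)) 2 (volume.restrict Ω))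
      atTop (𝓝 0)) :
    MemH10 Ω f ∧ ∀ l, IsWeakPartial Ω l f (g l) := by
  have hw : ∀ l, IsWeakPartial Ω l f (g l) := by
    intro l
    refine ⟨hg l, fun ψ hψ => ?_⟩
    have zero : ∀ h : Plane → ℝ, Tendsto (fun _ : ℕ => eLpNorm (h - h) 2 (volume.restrict Ω))
        atTop (𝓝 0) := fun h => by simp
    have t₁ := tendsto_integral_mul (fun m => (hφ m).memLp 2)
      (fun _ => hψ.memLp_partialDeriv l) hf (hψ.memLp_partialDeriv l)
      (by simpa only [eLpNorm_sub_comm] using h₁) (zero _)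
    have t₂ := (tendsto_integral_mul (fun m => (hφ m).memLp_partialDeriv l)
      (fun _ => hψ.memLp 2) (hg l) (hψ.memLp 2)
      (by simpa only [eLpNorm_sub_comm] using h₂ l) (zero _)).neg
    refine tendsto_nhds_unique t₁ (t₂.congr fun m => ?_)
    exact (setIntegral_mul_partialDeriv (hφ m).smooth hψ).symm
  refine ⟨⟨⟨hf, fun l => ⟨_, hw l⟩⟩, φ, hφ, h₁, fun l => ?_⟩, hw⟩
  refine (h₂ l).congr fun m => eLpNorm_congr_ae ?_
  filter_upwards [(hw l).weakPartial_ae_eq hΩ] with x hx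
  simp only [Pi.sub_apply, hx]

theorem MemH10.add (hΩ : IsOpen Ω) (hf : MemH10 Ω f) (hg : MemH10 Ω g) :
    MemH10 Ω fun x => f x + g x := by
  obtain ⟨mf, φ, hφ, hφ₁, hφ₂⟩ := hf
  obtain ⟨mg, ψ, hψ, hψ₁, hψ₂⟩ := hg
  refine (MemH10.of_tendsto hΩ (φ := fun m x => φ m x + ψ m x)
    (g := fun l x => weakPartial Ω l f x + weakPartial Ω l g x) (fun m => (hφ m).add (hψ m))
    (mf.add mg).memLp
    (fun l => MemLp.add (mf.isWeakPartial l).memLp (mg.isWeakPartial l).memLp) ?_ fun l => ?_).1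
  · refine (tendsto_eLpNorm_add (fun m => mf.memLp.1.sub ((hφ m).memLp 2).1)
      (fun m => mg.memLp.1.sub ((hψ m).memLp 2).1) hφ₁ hψ₁).congr fun m => ?_
    congr 1
    ext x
    simp only [Pi.add_apply, Pi.sub_apply]
    ring
  · refine (tendsto_eLpNorm_add
      (fun m => (mf.isWeakPartial l).memLp.1.sub ((hφ m).memLp_partialDeriv l).1)
      (fun m => (mg.isWeakPartial l).memLp.1.sub ((hψ m).memLp_partialDeriv l).1)
      (hφ₂ l) (hψ₂ l)).congr fun m => ?_
    congr 1
    ext x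
    simp only [Pi.add_apply, Pi.sub_apply, partialDeriv_add (hφ m).smooth (hψ m).smooth]
    ring

theorem MemH10.neg (hΩ : IsOpen Ω) (hf : MemH10 Ω f) : MemH10 Ω fun x => -f x := by
  obtain ⟨mf, φ, hφ, hφ₁, hφ₂⟩ := hf
  refine (MemH10.of_tendsto hΩ (φ := fun m x => -φ m x)
    (g := fun l x => -weakPartial Ω l f x)
    (fun m => ⟨(hφ m).smooth.neg, (hφ m).compact.neg, by
      have : tsupport (fun x => -φ m x) = tsupport (φ m) := by
        simp only [tsupport, Function.support_fun_neg]
      rw [this]; exact (hφ m).support⟩)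
    mf.neg.memLp (fun l => MemLp.neg (mf.isWeakPartial l).memLp) ?_ fun l => ?_).1
  · refine hφ₁.congr fun m => ?_
    rw [← eLpNorm_neg]
    congr 1
    ext x
    simp only [Pi.neg_apply, Pi.sub_apply]
    ring
  · refine (hφ₂ l).congr fun m => ?_
    rw [← eLpNorm_neg]
    congr 1
    ext x
    have : partialDeriv l (fun x => -φ m x) x = -partialDeriv l (φ m) x := by
      simp only [partialDeriv, fderiv_fun_neg]
      rfl
    simp only [Pi.neg_apply, Pi.sub_apply, this]
    ring

theorem isOpen_disk (R : ℝ) : IsOpen (disk R) := Metric.isOpen_ball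

/-- A smooth function that vanishes on the boundary circle belongs to `H¹₀` of the disk. -/
theorem memH10_of_eq_zero_on_sphere {R : ℝ} (hR : 0 < R) (hf : ContDiff ℝ ∞ f)
    (h0 : ∀ x ∈ Metric.sphere (0 : Plane) R, f x = 0) : MemH10 (disk R) f := by
  obtain ⟨K, hK⟩ := (hf.of_le (by simp : (1 : WithTop ℕ∞) ≤ ∞)).contDiffOn.exists_lipschitzOnWith
    (s := Metric.closedBall (0 : Plane) R) (by decide) (convex_closedBall _ _)
    (isCompact_closedBall _ _)
  -- `f` is Lipschitz and vanishes on the circle, so `|f|` is at most `K (R - ‖x‖)`. The bound is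
  -- restated with `R² - ‖x‖²`, in terms of which a cut-off is smooth at the origin too.
  have hlin : ∀ x ∈ disk R, |f x| ≤ K / R * (R ^ 2 - ‖x‖ ^ 2) := by
    intro x hx
    have hx' : ‖x‖ < R := by simpa [disk] using hx
    have hKR : (K : ℝ) * (R - ‖x‖) ≤ K / R * (R ^ 2 - ‖x‖ ^ 2) := by
      have : (K : ℝ) / R * (R ^ 2 - ‖x‖ ^ 2) = K * (R - ‖x‖) * ((R + ‖x‖) / R) := by
        field_simp
        ring
      rw [this]
      refine le_mul_of_one_le_right (mul_nonneg K.2 (by linarith)) ?_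
      rw [le_div_iff₀ hR]
      linarith [norm_nonneg x]
    refine le_trans ?_ hKR
    rcases eq_or_ne x 0 with rfl | hx0
    -- The centre has no radial projection; any boundary point serves.
    · set y : Plane := EuclideanSpace.single 0 R with hy
      have hyn : ‖y‖ = R := by simp [hy, abs_of_pos hR]
      have := hK.dist_le_mul 0 (by simp [hR.le]) y (by simp [hyn])
      rw [Real.dist_eq, h0 y (by simp [hyn]), sub_zero, dist_zero_left, hyn] at this
      simpa using this
    · have hxp : 0 < ‖x‖ := norm_pos_iff.2 hx0
      set y : Plane := (R / ‖x‖) • x with hy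
      have hyn : ‖y‖ = R := by
        rw [hy, norm_smul, Real.norm_eq_abs, abs_of_pos (div_pos hR hxp),
          div_mul_cancel₀ _ hxp.ne']
      have := hK.dist_le_mul x (by simp [hx'.le]) y (by simp [hyn])
      rw [Real.dist_eq, h0 y (by simp [hyn]), sub_zero, dist_comm, dist_eq_norm] at this
      have e : y - x = (R / ‖x‖ - 1) • x := by rw [hy, sub_smul, one_smul]
      have hn : ‖y - x‖ = R - ‖x‖ := by
        rw [e, norm_smul, Real.norm_eq_abs, abs_of_nonneg, sub_mul, div_mul_cancel₀ _ hxp.ne',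
          one_mul]
        rw [sub_nonneg, le_div_iff₀ hxp]
        linarith
      rwa [hn] at this
  set S := Real.smoothTransition with hS
  have Sd : ContDiff ℝ ∞ S := Real.smoothTransition.contDiff
  obtain ⟨C, hC⟩ : ∃ C, ∀ t, |deriv S t| ≤ C := by
    obtain ⟨C, hC⟩ := (isCompact_Icc (a := (0 : ℝ)) (b := 1)).exists_bound_of_continuousOn
      (Sd.continuous_deriv (by simp)).continuousOn
    refine ⟨max C 0, fun t => ?_⟩
    by_cases ht : t ∈ Icc 0 1
    · exact (hC t ht).trans (le_max_left _ _)
    · have : deriv S t = 0 := by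
        rw [mem_Icc, not_and_or, not_le, not_le] at ht
        rcases ht with ht | ht
        · have : S =ᶠ[𝓝 t] fun _ => 0 := by
            filter_upwards [Iio_mem_nhds ht] with s hs
            exact Real.smoothTransition.zero_of_nonpos (le_of_lt hs)
          rw [this.deriv_eq, deriv_const]
        · have : S =ᶠ[𝓝 t] fun _ => 1 := by
            filter_upwards [Ioi_mem_nhds ht] with s hs
            exact Real.smoothTransition.one_of_one_le (le_of_lt hs)
          rw [this.deriv_eq, deriv_const]
      rw [this, abs_zero]
      exact le_max_right _ _
  have hC0 : 0 ≤ C := (abs_nonneg _).trans (hC 0)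
  set τ : ℕ → Plane → ℝ := fun m x => (m + 1) * (R ^ 2 - ‖x‖ ^ 2) - 1 with hτ
  have τd : ∀ m, ContDiff ℝ ∞ (τ m) := fun m =>
    ((contDiff_const.mul (contDiff_const.sub (contDiff_id.norm_sq ℝ))).sub contDiff_const)
  have Dτ : ∀ m l x, partialDeriv l (τ m) x = -2 * (m + 1) * x l := by
    intro m l x
    have h₁ := (hasStrictFDerivAt_norm_sq x).hasFDerivAt
    have h₂ : HasFDerivAt (τ m) _ x := ((h₁.const_sub (R ^ 2)).const_mul ((m : ℝ) + 1)).sub_const 1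
    rw [partialDeriv, h₂.fderiv]
    simp [EuclideanSpace.inner_single_right]
    ring
  set φ : ℕ → Plane → ℝ := fun m x => S (τ m x) * f x with hφ
  have test : ∀ m, IsTestFunction (disk R) (φ m) := by
    intro m
    have hsub : tsupport (φ m) ⊆ {x | 0 ≤ τ m x} := by
      refine closure_minimal (fun x hx => ?_) (isClosed_le continuous_const (τd m).continuous)
      by_contra hneg
      have : τ m x ≤ 0 := (not_le.1 hneg).le
      exact hx (by simp only [hφ, hS, Real.smoothTransition.zero_of_nonpos this, zero_mul])
    have hball : {x | 0 ≤ τ m x} ⊆ disk R := by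
      intro x hx
      have hx : 0 ≤ τ m x := hx
      have hm : (0 : ℝ) < m + 1 := by positivity
      have : 0 < R ^ 2 - ‖x‖ ^ 2 := by
        simp only [hτ] at hx
        by_contra! hneg
        nlinarith
      have : ‖x‖ < R := lt_of_pow_lt_pow_left₀ 2 hR.le (by linarith)
      simpa [disk] using this
    refine ⟨(Sd.comp (τd m)).mul hf, ?_, hsub.trans hball⟩
    exact (isCompact_closedBall (0 : Plane) R).of_isClosed_subset (isClosed_tsupport _)
      ((hsub.trans hball).trans Metric.ball_subset_closedBall)
  have ev1 : ∀ x ∈ disk R, ∀ᶠ m : ℕ in atTop, 1 < τ m x := by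
    intro x hx
    have hx' : ‖x‖ < R := by simpa [disk] using hx
    have hp : 0 < R ^ 2 - ‖x‖ ^ 2 := by nlinarith [norm_nonneg x]
    obtain ⟨N, hN⟩ := exists_nat_gt (2 / (R ^ 2 - ‖x‖ ^ 2))
    filter_upwards [eventually_ge_atTop N] with m hm
    have h₁ : (N : ℝ) ≤ m := by exact_mod_cast hm
    rw [div_lt_iff₀ hp] at hN
    simp only [hτ]
    nlinarith
  have hfin : IsFiniteMeasure (volume.restrict (disk R)) := ⟨by
    rw [Measure.restrict_apply_univ]; exact measure_ball_lt_top⟩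
  have hmem : ∀ᵐ x ∂volume.restrict (disk R), x ∈ disk R := ae_restrict_mem measurableSet_ball
  have Dφ : ∀ m l x, partialDeriv l (φ m) x =
      S (τ m x) * partialDeriv l f x + deriv S (τ m x) * (-2 * (m + 1) * x l) * f x := by
    intro m l x
    have h₁ : HasFDerivAt (τ m) (fderiv ℝ (τ m) x) x :=
      ((τd m).differentiable (by simp) x).hasFDerivAt
    have h₂ := (Sd.differentiable (by simp) (τ m x)).hasDerivAt.comp_hasFDerivAt x h₁
    have h₃ := h₂.mul (hf.differentiable (by simp) x).hasFDerivAt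
    have h₄ : fderiv ℝ (φ m) x = _ := h₃.fderiv
    rw [partialDeriv, h₄, ← Dτ m l x]
    simp only [partialDeriv, _root_.add_apply, _root_.smul_apply,
      smul_eq_mul, Function.comp_apply]
    ring
  refine (MemH10.of_tendsto (isOpen_disk R) test (memLp_disk_of_continuous hf.continuous R 2)
    (g := fun l => partialDeriv l f)
    (fun l => memLp_disk_of_continuous (contDiff_partialDeriv hf l).continuous R 2) ?_
    fun l => ?_).1
  · refine tendsto_eLpNorm_two_of_dominated (b := fun x => |f x|)
      (fun m => (hf.continuous.sub (test m).smooth.continuous).aestronglyMeasurable)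
      (memLp_disk_of_continuous hf.continuous.abs R 2) (fun m => Eventually.of_forall fun x => ?_)
      (hmem.mono fun x hx => ?_)
    · have : (f - φ m) x = (1 - S (τ m x)) * f x := by simp only [Pi.sub_apply, hφ]; ring
      rw [this, abs_mul]
      refine mul_le_of_le_one_left (abs_nonneg _) (abs_le.2 ⟨?_, ?_⟩)
      · linarith [Real.smoothTransition.le_one (τ m x)]
      · linarith [Real.smoothTransition.nonneg (τ m x)]
    · refine tendsto_const_nhds.congr' ((ev1 x hx).mono fun m hm => ?_)
      simp only [Pi.sub_apply, hφ, hS, Real.smoothTransition.one_of_one_le hm.le, one_mul, sub_self]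
  · refine tendsto_eLpNorm_two_of_dominated
      (b := fun x => |partialDeriv l f x| + 4 * C * K)
      (fun m => ((contDiff_partialDeriv hf l).continuous.sub
        (contDiff_partialDeriv (test m).smooth l).continuous).aestronglyMeasurable)
      (memLp_disk_of_continuous ((contDiff_partialDeriv hf l).continuous.abs.add
        continuous_const) R 2) (fun m => hmem.mono fun x hx => ?_)
      (hmem.mono fun x hx => ?_)
    · have e : (partialDeriv l f - partialDeriv l (φ m)) x = (1 - S (τ m x)) * partialDeriv l f x +
          deriv S (τ m x) * (2 * (m + 1) * x l) * f x := by
        simp only [Pi.sub_apply, Dφ]; ring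
      rw [e]
      refine (abs_add_le _ _).trans (add_le_add ?_ ?_)
      · rw [abs_mul]
        refine mul_le_of_le_one_left (abs_nonneg _) (abs_le.2 ⟨?_, ?_⟩)
        · linarith [Real.smoothTransition.le_one (τ m x)]
        · linarith [Real.smoothTransition.nonneg (τ m x)]
      -- The derivative of the cut-off is of size `m + 1`, but it lives where `(m+1)(R² - ‖x‖²) ≤
      -- 2`, and there `(m+1)|f| ≤ 2K/R`. The product is bounded uniformly in `m`, which permits
      -- dominated convergence.
      · by_cases h1 : 1 < τ m x
        · have : S =ᶠ[𝓝 (τ m x)] fun _ => 1 := by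
            filter_upwards [Ioi_mem_nhds h1] with s hs
            exact Real.smoothTransition.one_of_one_le (le_of_lt hs)
          rw [this.deriv_eq, deriv_const, zero_mul, zero_mul, abs_zero]
          have := K.2
          positivity
        · have hx' : ‖x‖ < R := by simpa [disk] using hx
          have hxl : |x l| ≤ R := (PiLp.norm_apply_le x l).trans hx'.le
          have hm : (0 : ℝ) < m + 1 := by positivity
          have h₂ : (m + 1) * (R ^ 2 - ‖x‖ ^ 2) ≤ 2 := by
            simp only [hτ, not_lt] at h1
            linarith
          have h₃ : (m + 1) * |f x| ≤ K / R * 2 := by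
            calc (m + 1) * |f x| ≤ (m + 1) * (K / R * (R ^ 2 - ‖x‖ ^ 2)) := by
                  have := hlin x hx; gcongr
              _ = K / R * ((m + 1) * (R ^ 2 - ‖x‖ ^ 2)) := by ring
              _ ≤ K / R * 2 := by
                  have := K.2; gcongr
          rw [abs_mul, abs_mul, abs_mul, abs_mul, abs_of_pos hm, abs_two]
          calc |deriv S (τ m x)| * (2 * (m + 1) * |x l|) * |f x|
              = |deriv S (τ m x)| * (2 * |x l|) * ((m + 1) * |f x|) := by ring
            _ ≤ C * (2 * R) * (K / R * 2) := by
              have := hC (τ m x)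
              gcongr
            _ = 4 * C * K := by field_simp; ring
    · refine tendsto_const_nhds.congr' ((ev1 x hx).mono fun m hm => ?_)
      have : S =ᶠ[𝓝 (τ m x)] fun _ => 1 := by
        filter_upwards [Ioi_mem_nhds hm] with s hs
        exact Real.smoothTransition.one_of_one_le (le_of_lt hs)
      have h1 : S (τ m x) = 1 := Real.smoothTransition.one_of_one_le hm.le
      simp only [Pi.sub_apply, Dφ, this.deriv_eq, deriv_const, h1, one_mul, zero_mul, add_zero,
        sub_self]

theorem fderiv_apply_eq (f : Plane → ℝ) (x y : Plane) :
    fderiv ℝ f x y = y 0 * partialDeriv 0 f x + y 1 * partialDeriv 1 f x := by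
  have hy : y = y 0 • EuclideanSpace.single 0 1 + y 1 • EuclideanSpace.single 1 1 := by
    ext i
    fin_cases i <;> simp
  conv_lhs => rw [hy]
  simp only [map_add, map_smul, smul_eq_mul, partialDeriv]

theorem norm_fderiv_le (x : Plane) : ‖fderiv ℝ f x‖ ≤ |partialDeriv 0 f x| +
    |partialDeriv 1 f x| := by
  refine ContinuousLinearMap.opNorm_le_bound _ (by positivity) fun y => ?_
  rw [fderiv_apply_eq, Real.norm_eq_abs]
  refine (abs_add_le _ _).trans ?_
  rw [abs_mul, abs_mul, add_mul]
  have h₀ : |y 0| ≤ ‖y‖ := PiLp.norm_apply_le y 0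
  have h₁ : |y 1| ≤ ‖y‖ := PiLp.norm_apply_le y 1
  rw [mul_comm |y 0|, mul_comm |y 1|]
  gcongr

theorem eLpNorm_fderiv_le (hψ : IsTestFunction Ω ψ) :
    eLpNorm (fderiv ℝ ψ) 2 (volume.restrict Ω) ≤
      eLpNorm (partialDeriv 0 ψ) 2 (volume.restrict Ω) +
        eLpNorm (partialDeriv 1 ψ) 2 (volume.restrict Ω) := by
  have h : eLpNorm (fderiv ℝ ψ) 2 (volume.restrict Ω) ≤
      eLpNorm ((fun x => ‖partialDeriv 0 ψ x‖) + fun x => ‖partialDeriv 1 ψ x‖) 2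
        (volume.restrict Ω) := eLpNorm_mono_real fun x => norm_fderiv_le x
  refine h.trans ((eLpNorm_add_le (hψ.memLp_partialDeriv 0).1.norm
    (hψ.memLp_partialDeriv 1).1.norm (by norm_num)).trans_eq ?_)
  rw [eLpNorm_norm, eLpNorm_norm]

/-- The exponents are critical in dimension two: `3/4 - 1/2 = 1/4`. -/
theorem exists_gagliardo_nirenberg_const (R : ℝ) {p q : NNReal} (hp : (p : ℝ) = 4 / 3)
    (hq : (q : ℝ) = 4) : ∃ C : NNReal, ∀ ψ, IsTestFunction (disk R) ψ →
      eLpNorm ψ q volume ≤ C * eLpNorm (fderiv ℝ ψ) p volume := by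
  have hp1 : 1 ≤ p := by rw [← NNReal.coe_le_coe, hp]; norm_num
  have hd : Module.finrank ℝ Plane = 2 := by rw [finrank_euclideanSpace, Fintype.card_fin]
  have hpd : p < Module.finrank ℝ Plane := by
    rw [hd, ← NNReal.coe_lt_coe, hp]; norm_num
  have hpq : (p : ℝ)⁻¹ - (Module.finrank ℝ Plane : ℝ)⁻¹ ≤ (q : ℝ)⁻¹ := by
    rw [hd, hp, hq]; norm_num
  refine ⟨eLpNormLESNormFDerivOfLeConst ℝ (volume : Measure Plane) (disk R) p q, fun ψ hψ => ?_⟩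
  have h1 : ContDiff ℝ 1 ψ := hψ.smooth.of_le (by simp)
  have h2 : ψ.support ⊆ disk R := (subset_tsupport ψ).trans hψ.support
  have h3 : Bornology.IsBounded (disk R) := Metric.isBounded_ball
  exact eLpNorm_le_eLpNorm_fderiv_of_le (volume : Measure Plane) h1 h2 hp1 hpd
    (by exact_mod_cast hpq) h3

theorem eLpNorm_fderiv_restrict {R : ℝ} {ψ : Plane → ℝ} {p : ENNReal}
    (hψ : IsTestFunction (disk R) ψ) :
    eLpNorm (fderiv ℝ ψ) p (volume.restrict (disk R)) = eLpNorm (fderiv ℝ ψ) p volume := by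
  rw [← eLpNorm_norm, ← eLpNorm_norm (fderiv ℝ ψ)]
  refine eLpNorm_restrict_eq_of_support_subset fun x hx => hψ.support (support_fderiv_subset ℝ ?_)
  exact fun h => hx (by simp only [h, norm_zero])

/-- The disk has finite measure, so the `L²` norm of the gradient controls the `L^(4/3)` norm
required by Gagliardo–Nirenberg. -/
theorem exists_sobolev_const (R : ℝ) : ∃ C : ENNReal, C ≠ ⊤ ∧ ∀ ψ, IsTestFunction (disk R) ψ →
    eLpNorm ψ 4 (volume.restrict (disk R)) ≤
      C * (eLpNorm (partialDeriv 0 ψ) 2 (volume.restrict (disk R)) +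
        eLpNorm (partialDeriv 1 ψ) 2 (volume.restrict (disk R))) := by
  have hfin : IsFiniteMeasure (volume.restrict (disk R)) := ⟨by
    rw [Measure.restrict_apply_univ]; exact measure_ball_lt_top⟩
  obtain ⟨p, hp⟩ : ∃ p : NNReal, (p : ℝ) = 4 / 3 := ⟨⟨4 / 3, by norm_num⟩, rfl⟩
  obtain ⟨q, hq'⟩ : ∃ q : NNReal, (q : ENNReal) = 4 := ⟨4, by simp⟩
  have hq : (q : ℝ) = 4 := by
    have := congrArg ENNReal.toReal hq'
    simpa using this
  have hp2 : p ≤ 2 := by rw [← NNReal.coe_le_coe, hp]; norm_num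
  have hp2' : (p : ENNReal) ≤ 2 := by exact_mod_cast hp2
  obtain ⟨C, hC⟩ := exists_gagliardo_nirenberg_const R hp hq
  obtain ⟨A, hA, hAle⟩ : ∃ A : ENNReal, A ≠ ⊤ ∧ ∀ f : Plane → Plane →L[ℝ] ℝ,
      AEStronglyMeasurable f (volume.restrict (disk R)) →
      eLpNorm f p (volume.restrict (disk R)) ≤ A * eLpNorm f 2 (volume.restrict (disk R)) := by
    refine ⟨_, ?_, fun f hf => (eLpNorm_le_eLpNorm_mul_rpow_measure_univ hp2' hf).trans_eq
      (mul_comm _ _)⟩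
    refine ENNReal.rpow_ne_top_of_nonneg ?_ (measure_ne_top _ _)
    rw [ENNReal.coe_toReal, hp]
    norm_num
  refine ⟨C * A, ENNReal.mul_ne_top ENNReal.coe_ne_top hA, fun ψ hψ => ?_⟩
  have e₃ := hAle (fderiv ℝ ψ) (hψ.smooth.continuous_fderiv (by simp)).aestronglyMeasurable
  have e₄ := eLpNorm_fderiv_le hψ
  have e₅ : eLpNorm ψ q (volume.restrict (disk R)) ≤ eLpNorm ψ q volume :=
    eLpNorm_mono_measure _ Measure.restrict_le_self
  have g := hC ψ hψ
  rw [← eLpNorm_fderiv_restrict hψ] at g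
  rw [← hq']
  generalize eLpNorm ψ q (volume.restrict (disk R)) = x₁ at *
  generalize eLpNorm ψ q volume = x₂ at *
  generalize eLpNorm (fderiv ℝ ψ) p (volume.restrict (disk R)) = x₃ at *
  generalize eLpNorm (fderiv ℝ ψ) 2 (volume.restrict (disk R)) = x₄ at *
  calc x₁ ≤ C * x₃ := e₅.trans g
    _ ≤ C * (A * x₄) := by gcongr
    _ ≤ _ := by rw [mul_assoc]; gcongr

/-- The two-dimensional Sobolev embedding of `H¹₀` into `L⁴`. -/
theorem MemH10.memLp_four {R : ℝ} (hf : MemH10 (disk R) f) :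
    MemLp f 4 (volume.restrict (disk R)) := by
  obtain ⟨mf, φ, hφ, h₁, h₂⟩ := hf
  set μ : Measure Plane := volume.restrict (disk R) with hμ
  have hfin : IsFiniteMeasure μ := ⟨by
    rw [hμ, Measure.restrict_apply_univ]; exact measure_ball_lt_top⟩
  obtain ⟨C, hC, hle⟩ := exists_sobolev_const R
  have bound : ∀ l, ∀ᶠ m in atTop, eLpNorm (partialDeriv l (φ m)) 2 μ ≤
      eLpNorm (weakPartial (disk R) l f) 2 μ + 1 := by
    intro l
    have hw := (mf.isWeakPartial l).memLp
    filter_upwards [(h₂ l).eventually (gt_mem_nhds zero_lt_one)] with m hm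
    have e : partialDeriv l (φ m) = weakPartial (disk R) l f -
        (weakPartial (disk R) l f - partialDeriv l (φ m)) := by simp
    rw [e]
    refine (eLpNorm_sub_le hw.1 (hw.1.sub ((hφ m).memLp_partialDeriv l).1) (by norm_num)).trans ?_
    gcongr
  -- Along an almost everywhere convergent subsequence, Fatou's lemma transfers the uniform `L⁴`
  -- bound from the test functions to `f`.
  have htm := tendstoInMeasure_of_tendsto_eLpNorm (p := 2) (by norm_num)
    (fun m => ((hφ m).memLp 2).1) mf.memLp.1 (by simpa only [eLpNorm_sub_comm] using h₁)
  obtain ⟨ns, hns, hae⟩ := htm.exists_seq_tendsto_ae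
  refine ⟨mf.memLp.1, (Lp.eLpNorm_lim_le_liminf_eLpNorm
    (fun n => ((hφ (ns n)).memLp 2).1) f hae).trans_lt ?_⟩
  set B : ENNReal := C * ((eLpNorm (weakPartial (disk R) 0 f) 2 μ + 1) +
    (eLpNorm (weakPartial (disk R) 1 f) 2 μ + 1)) with hB
  have hBtop : B < ⊤ := by
    have h₀ := (mf.isWeakPartial 0).memLp.2
    have h₁ := (mf.isWeakPartial 1).memLp.2
    refine ENNReal.mul_lt_top hC.lt_top (ENNReal.add_lt_top.2 ⟨?_, ?_⟩) <;>
    exact ENNReal.add_lt_top.2 ⟨by assumption, ENNReal.one_lt_top⟩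
  refine lt_of_le_of_lt (liminf_le_of_frequently_le' (Eventually.frequently ?_)) hBtop
  filter_upwards [hns.tendsto_atTop.eventually (bound 0), hns.tendsto_atTop.eventually (bound 1)]
    with n h₀ h₁
  exact (hle _ (hφ _)).trans (by rw [hB]; gcongr)

end Sobolev

end QTensor

namespace QTensor

/-! ### Polar coordinates -/

/-- The radial unit vector. -/
noncomputable def dir (θ : ℝ) : Plane := !₂[Real.cos θ, Real.sin θ]

/-- The angular unit vector. -/
noncomputable def tang (θ : ℝ) : Plane := !₂[-Real.sin θ, Real.cos θ]

@[simp] theorem dir_zero (θ : ℝ) : dir θ 0 = Real.cos θ := rfl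
@[simp] theorem dir_one (θ : ℝ) : dir θ 1 = Real.sin θ := rfl
@[simp] theorem tang_zero (θ : ℝ) : tang θ 0 = -Real.sin θ := rfl
@[simp] theorem tang_one (θ : ℝ) : tang θ 1 = Real.cos θ := rfl

theorem abs_dir_le (θ : ℝ) (l : Fin 2) : |dir θ l| ≤ 1 := by
  fin_cases l
  · exact Real.abs_cos_le_one θ
  · exact Real.abs_sin_le_one θ

theorem abs_tang_le (θ : ℝ) (l : Fin 2) : |tang θ l| ≤ 1 := by
  fin_cases l
  · change |-Real.sin θ| ≤ 1
    rw [abs_neg]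
    exact Real.abs_sin_le_one θ
  · exact Real.abs_cos_le_one θ

theorem norm_dir (θ : ℝ) : ‖dir θ‖ = 1 := by
  rw [EuclideanSpace.norm_eq, Fin.sum_univ_two]
  simp

theorem norm_smul_dir {r : ℝ} (hr : 0 < r) (θ : ℝ) : ‖r • dir θ‖ = r := by
  rw [norm_smul, norm_dir, mul_one, Real.norm_eq_abs, abs_of_pos hr]

theorem angle_smul_dir {r θ : ℝ} (hr : 0 < r) (hθ : θ ∈ Ioo (-Real.pi) Real.pi) :
    angle (r • dir θ) = θ := by
  have := Complex.arg_mul_cos_add_sin_mul_I hr ⟨hθ.1, hθ.2.le⟩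
  rw [angle]
  convert this using 2
  apply Complex.ext <;> simp [Complex.cos_ofReal_re, Complex.sin_ofReal_re]

theorem smul_dir_angle (x : Plane) : ‖x‖ • dir (angle x) = x := by
  have hn : ‖(⟨x 0, x 1⟩ : ℂ)‖ = ‖x‖ := by
    rw [EuclideanSpace.norm_eq, Fin.sum_univ_two, Complex.norm_def, Complex.normSq_mk]
    simp [pow_two]
  ext l
  fin_cases l
  · have := Complex.norm_mul_cos_arg (⟨x 0, x 1⟩ : ℂ)
    rw [hn] at this
    exact this
  · have := Complex.norm_mul_sin_arg (⟨x 0, x 1⟩ : ℂ)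
    rw [hn] at this
    exact this

theorem measurable_angle : Measurable angle := by
  have : Measurable fun x : Plane => (⟨x 0, x 1⟩ : ℂ) := by
    have h : (fun x : Plane => (⟨x 0, x 1⟩ : ℂ)) =
        fun x : Plane => (x 0 : ℂ) + x 1 * Complex.I := by
      ext x
      apply Complex.ext <;> simp
    rw [h]
    have : Continuous fun x : Plane => (x 0 : ℂ) + x 1 * Complex.I := by fun_prop
    exact this.measurable
  exact Complex.measurable_arg.comp this

theorem continuous_dir : Continuous dir := by
  unfold dir
  fun_prop

theorem continuous_tang (l : Fin 2) : Continuous fun θ => tang θ l := by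
  unfold tang
  fin_cases l
  · exact Real.continuous_sin.neg
  · exact Real.continuous_cos

theorem hasDerivAt_dir (θ : ℝ) : HasDerivAt dir (tang θ) θ := by
  have h : HasDerivAt (fun θ : ℝ => ![Real.cos θ, Real.sin θ]) ![-Real.sin θ, Real.cos θ] θ := by
    rw [hasDerivAt_pi]
    intro l
    fin_cases l
    · exact Real.hasDerivAt_cos θ
    · exact Real.hasDerivAt_sin θ
  exact (PiLp.continuousLinearEquiv 2 ℝ fun _ : Fin 2 => ℝ).symm.hasFDerivAt.comp_hasDerivAt θ h

/-- The coordinates `(r, θ)` of the disk. -/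
def polarRect (R : ℝ) : Set (ℝ × ℝ) := Ioo 0 R ×ˢ Ioo (-Real.pi) Real.pi

theorem measurableSet_polarRect (R : ℝ) : MeasurableSet (polarRect R) :=
  measurableSet_Ioo.prod measurableSet_Ioo

/-- The identification of `ℝ × ℝ` with the Euclidean plane. -/
noncomputable def planeEquiv : ℝ × ℝ ≃ᵐ Plane :=
  (MeasurableEquiv.finTwoArrow (α := ℝ)).symm.trans (MeasurableEquiv.toLp 2 (Fin 2 → ℝ))

theorem planeEquiv_apply (p : ℝ × ℝ) : planeEquiv p = !₂[p.1, p.2] := by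
  ext l
  fin_cases l <;> rfl

theorem measurePreserving_planeEquiv : MeasurePreserving planeEquiv :=
  (PiLp.volume_preserving_toLp (Fin 2)).comp (volume_preserving_finTwoArrow ℝ).symm

theorem planeEquiv_polarCoord_symm (p : ℝ × ℝ) :
    planeEquiv (polarCoord.symm p) = p.1 • dir p.2 := by
  rw [planeEquiv_apply]
  ext l
  fin_cases l <;> simp

/-- The exceptional points lie on the slit outside `polarCoord.source`, which is a null set. -/
theorem polarCoord_image_ae_eq (R : ℝ) :
    planeEquiv ⁻¹' disk R =ᵐ[volume] polarCoord.symm '' polarRect R := by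
  have hsub : polarRect R ⊆ polarCoord.target := by
    rw [polarCoord_target]
    exact prod_mono Ioo_subset_Ioi_self le_rfl
  rw [polarCoord.symm_image_eq_source_inter_preimage hsub]
  have h := polarCoord_source_ae_eq_univ
  filter_upwards [h] with q hq
  have hq' : q ∈ polarCoord.source := by
    have : polarCoord.source q = (univ : Set (ℝ × ℝ)) q := hq
    exact this.mpr trivial
  have hn : ‖planeEquiv q‖ = √(q.1 ^ 2 + q.2 ^ 2) := by
    rw [planeEquiv_apply, EuclideanSpace.norm_eq, Fin.sum_univ_two]
    simp
  have ht := polarCoord.map_source hq'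
  rw [polarCoord_target] at ht
  apply propext
  change planeEquiv q ∈ disk R ↔ q ∈ polarCoord.source ∩ polarCoord ⁻¹' polarRect R
  rw [disk, mem_ball_zero_iff, hn]
  constructor
  · intro h
    exact ⟨hq', ⟨ht.1, h⟩, ht.2⟩
  · intro h
    exact h.2.1.2

theorem integrableOn_disk_iff {R : ℝ} {F : Plane → ℝ} :
    IntegrableOn F (disk R) ↔ IntegrableOn (fun p => p.1 * F (p.1 • dir p.2)) (polarRect R) := by
  have hsub : polarRect R ⊆ polarCoord.target := by
    rw [polarCoord_target]
    exact prod_mono Ioo_subset_Ioi_self le_rfl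
  rw [← measurePreserving_planeEquiv.integrableOn_comp_preimage planeEquiv.measurableEmbedding,
    integrableOn_congr_set_ae (polarCoord_image_ae_eq R),
    integrableOn_image_iff_integrableOn_abs_det_fderiv_smul volume (measurableSet_polarRect R)
      (fun p _ => (hasFDerivAt_polarCoord_symm p).hasFDerivWithinAt)
      (polarCoord.symm.injOn.mono hsub)]
  refine integrableOn_congr_fun (fun p hp => ?_) (measurableSet_polarRect R)
  rw [det_fderivPolarCoordSymm, abs_of_pos hp.1.1, Function.comp_apply,
    planeEquiv_polarCoord_symm, smul_eq_mul]

theorem setIntegral_disk_eq (R : ℝ) (F : Plane → ℝ) :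
    ∫ x in disk R, F x = ∫ p in polarRect R, p.1 * F (p.1 • dir p.2) := by
  have hsub : polarRect R ⊆ polarCoord.target := by
    rw [polarCoord_target]
    exact prod_mono Ioo_subset_Ioi_self le_rfl
  rw [← measurePreserving_planeEquiv.setIntegral_preimage_emb planeEquiv.measurableEmbedding,
    setIntegral_congr_set (polarCoord_image_ae_eq R),
    integral_image_eq_integral_abs_det_fderiv_smul volume (measurableSet_polarRect R)
      (fun p _ => (hasFDerivAt_polarCoord_symm p).hasFDerivWithinAt)
      (polarCoord.symm.injOn.mono hsub)]
  refine setIntegral_congr_fun (measurableSet_polarRect R) (fun p hp => ?_)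
  rw [det_fderivPolarCoordSymm, abs_of_pos hp.1.1, planeEquiv_polarCoord_symm, smul_eq_mul]

theorem volume_restrict_polarRect (R : ℝ) : (volume : Measure (ℝ × ℝ)).restrict (polarRect R) =
    (volume.restrict (Ioo 0 R)).prod (volume.restrict (Ioo (-Real.pi) Real.pi)) := by
  rw [Measure.prod_restrict, polarRect, Measure.volume_eq_prod]

theorem isFiniteMeasure_restrict_Ioo (a b : ℝ) : IsFiniteMeasure (volume.restrict (Ioo a b)) :=
  ⟨by simp⟩

theorem integrableOn_polarRect_of_fst {R : ℝ} {f : ℝ → ℝ} (hf : IntegrableOn f (Ioo 0 R)) :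
    IntegrableOn (fun p : ℝ × ℝ => f p.1) (polarRect R) := by
  have := isFiniteMeasure_restrict_Ioo (-Real.pi) Real.pi
  rw [IntegrableOn, volume_restrict_polarRect]
  exact hf.comp_fst _

theorem setIntegral_polarRect_fst (R : ℝ) {f : ℝ → ℝ} (hf : IntegrableOn f (Ioo 0 R)) :
    ∫ p in polarRect R, f p.1 = 2 * Real.pi * ∫ r in Ioo 0 R, f r := by
  have := isFiniteMeasure_restrict_Ioo (-Real.pi) Real.pi
  rw [volume_restrict_polarRect, integral_prod _ (hf.comp_fst _)]
  simp only [integral_const, smul_eq_mul]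
  rw [integral_const_mul]
  congr 1
  rw [measureReal_restrict_apply_univ, Real.volume_real_Ioo_of_le (by linarith [Real.pi_pos])]
  ring

/-- `L²` bounds on the disk for functions dominated by a radial function. -/
theorem memLp_disk_of_radial_bound {R M : ℝ} {F : Plane → ℝ} {H : ℝ → ℝ}
    (hF : AEStronglyMeasurable F (volume.restrict (disk R))) (hH : MemL2 R fun r => √r * H r)
    (h : ∀ x ∈ disk R, x ≠ 0 → |F x| ≤ M * |H ‖x‖|) :
    MemLp F 2 (volume.restrict (disk R)) ∧
      ∫ x in disk R, F x ^ 2 ≤ M ^ 2 * (2 * Real.pi * ∫ r in Ioo 0 R, r * H r ^ 2) := by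
  have iH : IntegrableOn (fun r => r * H r ^ 2) (Ioo 0 R) := by
    refine (integrable_sq_of_memLp hH).congr ((ae_mem_Ioo R).mono fun r hr => ?_)
    simp only
    rw [mul_pow, Real.sq_sqrt hr.1.le]
  have e : ∀ p ∈ polarRect R, p.1 * H p.1 ^ 2 = p.1 * H ‖p.1 • dir p.2‖ ^ 2 := fun p hp => by
    rw [norm_smul_dir hp.1.1]
  have iD : IntegrableOn (fun x : Plane => H ‖x‖ ^ 2) (disk R) := by
    rw [integrableOn_disk_iff, ← integrableOn_congr_fun e (measurableSet_polarRect R)]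
    exact integrableOn_polarRect_of_fst iH
  have eD : ∫ x in disk R, H ‖x‖ ^ 2 = 2 * Real.pi * ∫ r in Ioo 0 R, r * H r ^ 2 := by
    rw [setIntegral_disk_eq, ← setIntegral_congr_fun (measurableSet_polarRect R) e]
    exact setIntegral_polarRect_fst R iH
  have hne : ∀ᵐ x ∂volume.restrict (disk R), x ≠ (0 : Plane) :=
    ae_restrict_of_ae (by simp [ae_iff])
  have hle : ∀ᵐ x ∂volume.restrict (disk R), F x ^ 2 ≤ M ^ 2 * H ‖x‖ ^ 2 := by
    filter_upwards [ae_restrict_mem measurableSet_ball, hne] with x hx hx0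
    have := pow_le_pow_left₀ (abs_nonneg _) (h x hx hx0) 2
    rwa [sq_abs, mul_pow, sq_abs] at this
  have i : IntegrableOn (fun x => F x ^ 2) (disk R) :=
    (iD.const_mul (M ^ 2)).mono' (hF.pow 2) (hle.mono fun x hx => by
      rwa [Real.norm_eq_abs, abs_of_nonneg (sq_nonneg _)])
  refine ⟨(memLp_two_iff_integrable_sq hF).2 i, ?_⟩
  rw [← eD, ← integral_const_mul]
  exact integral_mono_ae i (iD.const_mul _) hle

theorem aestronglyMeasurable_comp_norm {R : ℝ} {w : ℝ → ℝ} (hw : ContinuousOn w (Ioc 0 R)) :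
    AEStronglyMeasurable (fun x : Plane => w ‖x‖) (volume.restrict (disk R)) := by
  have hm : Measurable ((Ioc 0 R).piecewise w fun _ => 0) :=
    hw.measurable_piecewise continuousOn_const measurableSet_Ioc
  refine (hm.comp measurable_norm).aestronglyMeasurable.congr ?_
  have hne : ∀ᵐ x ∂volume.restrict (disk R), x ≠ (0 : Plane) :=
    ae_restrict_of_ae (by simp [ae_iff])
  filter_upwards [ae_restrict_mem measurableSet_ball, hne] with x hx hx0
  have : ‖x‖ ∈ Ioc 0 R := ⟨norm_pos_iff.2 hx0, (mem_ball_zero_iff.1 hx).le⟩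
  rw [Function.comp_apply, piecewise_eq_of_mem _ _ _ this]

/-! ### Fields with separated variables -/

/-- The angular function `α cos κθ + β sin κθ`. -/
noncomputable def ang (κ : ℕ) (α β θ : ℝ) : ℝ := α * Real.cos (κ * θ) + β * Real.sin (κ * θ)

/-- The derivative of `ang`. -/
noncomputable def dang (κ : ℕ) (α β θ : ℝ) : ℝ :=
  κ * (β * Real.cos (κ * θ) - α * Real.sin (κ * θ))

/-- The field `w(r) (α cos κθ + β sin κθ)`. -/
noncomputable def radialField (κ : ℕ) (α β : ℝ) (w : ℝ → ℝ) (x : Plane) : ℝ :=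
  w ‖x‖ * ang κ α β (angle x)

/-- The gradient of `radialField`. -/
noncomputable def radialGrad (κ : ℕ) (α β : ℝ) (w : ℝ → ℝ) (l : Fin 2) (x : Plane) : ℝ :=
  deriv w ‖x‖ * (ang κ α β (angle x) * dir (angle x) l) +
    w ‖x‖ / ‖x‖ * (dang κ α β (angle x) * tang (angle x) l)

/-- The homogeneous harmonic polynomial `r^κ (α cos κθ + β sin κθ)`. -/
noncomputable def harmonicPoly (κ : ℕ) (α β : ℝ) (x : Plane) : ℝ :=
  (((α : ℂ) - β * Complex.I) * ((x 0 : ℂ) + x 1 * Complex.I) ^ κ).re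

section Angular

variable {κ : ℕ} {α β : ℝ}

theorem abs_mul_cos_add_mul_sin_le (a b t : ℝ) :
    |a * Real.cos t + b * Real.sin t| ≤ |a| + |b| := by
  refine (abs_add_le _ _).trans (add_le_add ?_ ?_) <;> rw [abs_mul]
  · exact mul_le_of_le_one_right (abs_nonneg _) (Real.abs_cos_le_one _)
  · exact mul_le_of_le_one_right (abs_nonneg _) (Real.abs_sin_le_one _)

theorem abs_ang_le (θ : ℝ) : |ang κ α β θ| ≤ |α| + |β| := abs_mul_cos_add_mul_sin_le _ _ _

theorem abs_dang_le (θ : ℝ) : |dang κ α β θ| ≤ κ * (|α| + |β|) := by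
  rw [dang, abs_mul, Nat.abs_cast]
  refine mul_le_mul_of_nonneg_left ?_ (Nat.cast_nonneg _)
  have := abs_mul_cos_add_mul_sin_le β (-α) (κ * θ)
  rwa [neg_mul, ← sub_eq_add_neg, abs_neg, add_comm |β|] at this

theorem hasDerivAt_dang (θ : ℝ) : HasDerivAt (dang κ α β) (-κ ^ 2 * ang κ α β θ) θ := by
  have h : HasDerivAt (fun θ : ℝ => (κ : ℝ) * θ) κ θ := by
    simpa using (hasDerivAt_id θ).const_mul (κ : ℝ)
  have := ((h.cos.const_mul β).sub (h.sin.const_mul α)).const_mul (κ : ℝ)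
  refine this.congr_deriv ?_
  rw [ang]
  ring

theorem continuous_ang : Continuous (ang κ α β) := by unfold ang; fun_prop

theorem continuous_dang : Continuous (dang κ α β) := by unfold dang; fun_prop

theorem contDiff_harmonicPoly : ContDiff ℝ ∞ (harmonicPoly κ α β) := by
  have h : ∀ i : Fin 2, ContDiff ℝ ∞ fun x : Plane => ((x i : ℝ) : ℂ) := fun i =>
    Complex.ofRealCLM.contDiff.comp (EuclideanSpace.proj (𝕜 := ℝ) i).contDiff
  exact Complex.reCLM.contDiff.comp
    (contDiff_const.mul (((h 0).add ((h 1).mul contDiff_const)).pow κ))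

theorem complex_eq_polar (x : Plane) : (x 0 : ℂ) + x 1 * Complex.I =
    ‖x‖ * (Real.cos (angle x) + Real.sin (angle x) * Complex.I) := by
  conv_lhs => rw [← smul_dir_angle x]
  simp only [PiLp.smul_apply, dir_zero, dir_one, smul_eq_mul, Complex.ofReal_mul]
  ring

theorem polar_pow (n : ℕ) (x : Plane) : ((x 0 : ℂ) + x 1 * Complex.I) ^ n =
    (‖x‖ ^ n : ℝ) * (Real.cos (n * angle x) + Real.sin (n * angle x) * Complex.I) := by
  rw [complex_eq_polar, mul_pow]
  have := Complex.cos_add_sin_mul_I_pow n (angle x : ℂ)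
  push_cast
  rw [this]

theorem harmonicPoly_eq (x : Plane) :
    harmonicPoly κ α β x = ‖x‖ ^ κ * ang κ α β (angle x) := by
  rw [harmonicPoly, polar_pow, ang]
  simp only [Complex.mul_re, Complex.sub_re, Complex.sub_im, Complex.add_re, Complex.add_im,
    Complex.ofReal_re, Complex.ofReal_im, Complex.I_re, Complex.I_im, Complex.mul_im]
  ring

/-- This is the real part of the derivative of `(α - βi) z^κ`, written in the polar frame. The
factor `‖x‖ ^ κ / ‖x‖` also covers `κ = 0`, where both angular terms vanish. -/
theorem partialDeriv_harmonicPoly {x : Plane} (hx : x ≠ 0) (l : Fin 2) :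
    partialDeriv l (harmonicPoly κ α β) x = ‖x‖ ^ κ / ‖x‖ *
      (κ * ang κ α β (angle x) * dir (angle x) l + dang κ α β (angle x) * tang (angle x) l) := by
  have h : ∀ i : Fin 2, HasFDerivAt (fun x : Plane => ((x i : ℝ) : ℂ))
      (Complex.ofRealCLM.comp (EuclideanSpace.proj (𝕜 := ℝ) i)) x := fun i =>
    (Complex.ofRealCLM.comp (EuclideanSpace.proj (𝕜 := ℝ) i)).hasFDerivAt
  have hz := ((h 0).add ((h 1).mul_const Complex.I)).pow κ
  have hA := Complex.reCLM.hasFDerivAt.comp x (hz.const_mul ((α : ℂ) - β * Complex.I))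
  have hA' : HasFDerivAt (harmonicPoly κ α β) _ x := hA
  have hn : ‖x‖ ≠ 0 := norm_ne_zero_iff.2 hx
  rw [partialDeriv, hA'.fderiv]
  rcases κ with _ | n
  · simp [dang]
  · have e : ((n : ℝ) + 1) * angle x = n * angle x + angle x := by ring
    have hn' : ‖x‖ ^ (n + 1) / ‖x‖ = ‖x‖ ^ n := by
      rw [pow_succ, mul_div_assoc, div_self hn, mul_one]
    have hp := polar_pow n x
    have sc := Real.sin_sq_add_cos_sq (angle x)
    rw [hn']
    simp only [ang, dang, Nat.cast_add, Nat.cast_one, e, Real.cos_add, Real.sin_add]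
    generalize Real.cos (n * angle x) = C, Real.sin (n * angle x) = S, ‖x‖ ^ n = p at hp ⊢
    fin_cases l
    · simp [hp]
      linear_combination -(p * (n + 1) * (α * C + β * S)) * sc
    · simp [hp]
      linear_combination -(p * (n + 1) * (β * C - α * S)) * sc

end Angular

end QTensor

namespace QTensor

/-! ### Approximation of radial profiles -/

/-- Functions in `L²(0, R)` are limits of smooth functions vanishing near the endpoints. -/
theorem MemL2.exists_smooth_approx {R : ℝ} {g : ℝ → ℝ} (hg : MemL2 R g) :
    ∃ h : ℕ → ℝ → ℝ, (∀ j, ContDiff ℝ ∞ (h j)) ∧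
      (∀ j, ∃ δ, 0 < δ ∧ ∀ r, r ≤ δ ∨ R - δ ≤ r → h j r = 0) ∧
      Tendsto (fun j => eLpNorm (g - h j) 2 (volume.restrict (Ioo 0 R))) atTop (𝓝 0) := by
  have hex : ∀ j : ℕ, ∃ f : ℝ → ℝ, ContDiff ℝ ∞ f ∧
      eLpNorm (g - f) 2 (volume.restrict (Ioo 0 R)) ≤ ENNReal.ofReal (1 / ((j : ℝ) + 1)) := by
    intro j
    obtain ⟨f, -, hf, hle⟩ := MemLp.exist_eLpNorm_sub_le (by norm_num) (by norm_num) hg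
      (Nat.one_div_pos_of_nat (α := ℝ) (n := j))
    exact ⟨f, hf, hle⟩
  choose f hf hfle using hex
  -- The cut-off vanishes within `1/(j+1)` of either endpoint. The error is estimated through `g - χ
  -- f = (1 - χ) g + χ (g - f)`.
  set χ : ℕ → ℝ → ℝ := fun j r =>
    Real.smoothTransition (((j : ℝ) + 1) * r - 1) *
      Real.smoothTransition (((j : ℝ) + 1) * (R - r) - 1) with hχ
  have hχc : ∀ j, ContDiff ℝ ∞ (χ j) := fun j =>
    (Real.smoothTransition.contDiff.comp ((contDiff_const.mul contDiff_id).sub contDiff_const)).mul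
      (Real.smoothTransition.contDiff.comp
        ((contDiff_const.mul (contDiff_const.sub contDiff_id)).sub contDiff_const))
  have hχ0 : ∀ j r, 0 ≤ χ j r := fun j r =>
    mul_nonneg (Real.smoothTransition.nonneg _) (Real.smoothTransition.nonneg _)
  have hχ1 : ∀ j r, χ j r ≤ 1 := fun j r =>
    mul_le_one₀ (Real.smoothTransition.le_one _) (Real.smoothTransition.nonneg _)
      (Real.smoothTransition.le_one _)
  have hlim : ∀ r ∈ Ioo 0 R, ∀ᶠ j in atTop, χ j r = 1 := by
    intro r hr
    have hev : ∀ t : ℝ, 0 < t → ∀ᶠ j : ℕ in atTop, 1 ≤ ((j : ℝ) + 1) * t - 1 := by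
      intro t ht
      have : Tendsto (fun j : ℕ => ((j : ℝ) + 1) * t - 1) atTop atTop :=
        tendsto_atTop_add_const_right _ _
          ((tendsto_atTop_add_const_right _ _ tendsto_natCast_atTop_atTop).atTop_mul_const ht)
      exact this.eventually_ge_atTop 1
    filter_upwards [hev r hr.1, hev (R - r) (sub_pos.2 hr.2)] with j h₁ h₂
    simp only [hχ]
    rw [Real.smoothTransition.one_of_one_le h₁, Real.smoothTransition.one_of_one_le h₂, one_mul]
  refine ⟨fun j r => χ j r * f j r, fun j => (hχc j).mul (hf j), fun j => ?_, ?_⟩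
  · have hj : (0 : ℝ) < (j : ℝ) + 1 := by positivity
    have hz : ∀ t : ℝ, t ≤ 1 / ((j : ℝ) + 1) →
        Real.smoothTransition (((j : ℝ) + 1) * t - 1) = 0 := by
      intro t ht
      refine Real.smoothTransition.zero_of_nonpos ?_
      have := mul_le_mul_of_nonneg_left ht hj.le
      rw [mul_one_div_cancel hj.ne'] at this
      linarith
    refine ⟨1 / ((j : ℝ) + 1), by positivity, fun r hr => ?_⟩
    simp only [hχ]
    rcases hr with hr | hr
    · rw [hz r hr, zero_mul, zero_mul]
    · rw [hz (R - r) (by linarith), mul_zero, zero_mul]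
  · have t₁ : Tendsto (fun j => eLpNorm (fun r => (1 - χ j r) * g r) 2
        (volume.restrict (Ioo 0 R))) atTop (𝓝 0) := by
      refine tendsto_eLpNorm_two_of_dominated (b := fun r => |g r|)
        (fun j => (continuous_const.sub (hχc j).continuous).aestronglyMeasurable.mul hg.1)
        hg.abs (fun j => Eventually.of_forall fun r => ?_) ?_
      · rw [abs_mul]
        refine mul_le_of_le_one_left (abs_nonneg _) ?_
        rw [abs_of_nonneg (sub_nonneg.2 (hχ1 j r))]
        linarith [hχ0 j r]
      · filter_upwards [ae_mem_Ioo R] with r hr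
        refine tendsto_const_nhds.congr' ?_
        filter_upwards [hlim r hr] with j hj
        rw [hj, sub_self, zero_mul]
    have t₂ : Tendsto (fun j => eLpNorm (fun r => χ j r * (g r - f j r)) 2
        (volume.restrict (Ioo 0 R))) atTop (𝓝 0) := by
      have h0 : Tendsto (fun j : ℕ => ENNReal.ofReal (1 / ((j : ℝ) + 1))) atTop (𝓝 0) := by
        simpa using ENNReal.tendsto_ofReal tendsto_one_div_add_atTop_nhds_zero_nat
      refine tendsto_of_tendsto_of_tendsto_of_le_of_le tendsto_const_nhds h0 (fun _ => zero_le)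
        fun j => (eLpNorm_mono fun r => ?_).trans (hfle j)
      rw [Real.norm_eq_abs, abs_mul, abs_of_nonneg (hχ0 j r)]
      exact mul_le_of_le_one_left (abs_nonneg _) (hχ1 j r)
    refine (tendsto_eLpNorm_add
      (fun j => (continuous_const.sub (hχc j).continuous).aestronglyMeasurable.mul hg.1)
      (fun j => (hχc j).continuous.aestronglyMeasurable.mul
        (hg.1.sub (hf j).continuous.aestronglyMeasurable)) t₁ t₂).congr fun j => ?_
    congr 1
    ext r
    simp only [Pi.add_apply, Pi.sub_apply, Pi.mul_apply]
    ring

namespace RadialProfile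

variable {R κ : ℝ} {w : ℝ → ℝ}

/-- On `(δ, R)` the integral equals `-w(δ)²/2`. Only its sign survives the limit `δ → 0`, so nothing
need be known about `w` at the origin. The condition `κ ≠ 0` makes `w w' = (w/√r)(√r w')`
integrable. -/
theorem integral_mul_deriv_nonpos (hw : RadialProfile R κ w) (hκ : κ ≠ 0) (hwR : w R = 0) :
    ∫ r in Ioo 0 R, w r * _root_.deriv w r ≤ 0 := by
  have hi : IntegrableOn (fun r => w r * _root_.deriv w r) (Ioo 0 R) := by
    refine ((integrable_mul_of_memLp hw.weight hw.deriv).const_mul κ⁻¹).congr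
      ((ae_mem_Ioo R).mono fun r hr => ?_)
    have : √r ≠ 0 := (Real.sqrt_pos.2 hr.1).ne'
    simp only
    field_simp
  rcases le_or_gt R 0 with hR | hR
  · simp [Ioo_eq_empty (not_lt.2 hR)]
  have hii : IntervalIntegrable (fun r => w r * _root_.deriv w r) volume 0 R :=
    (intervalIntegrable_iff_integrableOn_Ioo_of_le hR.le).2 hi
  have hle : ∀ δ ∈ Ioo 0 R, ∫ r in δ..R, w r * _root_.deriv w r ≤ 0 := by
    intro δ hδ
    have h := ((hw.ac.mul hw.ac) δ hδ).integral_deriv_eq_sub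
    have hae : ∀ᵐ r ∂volume, r ∈ uIoc δ R →
        _root_.deriv (fun r => w r * w r) r = 2 * (w r * _root_.deriv w r) := by
      have h1 := (ae_restrict_iff' measurableSet_Ioo).1 hw.ac.ae_differentiableAt
      filter_upwards [h1, Measure.ae_ne volume R] with r hr hne hmem
      rw [uIoc_of_le hδ.2.le] at hmem
      have hd := hr ⟨hδ.1.trans hmem.1, lt_of_le_of_ne hmem.2 hne⟩
      rw [deriv_fun_mul hd hd]
      ring
    rw [intervalIntegral.integral_congr_ae hae, intervalIntegral.integral_const_mul, hwR] at h
    nlinarith [mul_self_nonneg (w δ)]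
  rw [← integral_Ioc_eq_integral_Ioo, ← intervalIntegral.integral_of_le hR.le]
  have hcont := intervalIntegral.continuousOn_primitive_interval_left
    ((intervalIntegrable_iff_integrableOn_Icc_of_le hR.le).1 hii |>.mono_set
      (uIcc_of_le hR.le).le)
  have ht : Tendsto (fun δ => ∫ r in δ..R, w r * _root_.deriv w r) (𝓝[>] 0)
      (𝓝 (∫ r in (0 : ℝ)..R, w r * _root_.deriv w r)) :=
    (hcont 0 left_mem_uIcc).mono_left (by
      rw [uIcc_of_le hR.le]
      exact nhdsWithin_le_of_mem (Icc_mem_nhdsGT hR))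
  refine le_of_tendsto ht ?_
  filter_upwards [Ioo_mem_nhdsGT hR] with δ hδ using hle δ hδ

/-- The Dirichlet energy of `w(r) e^{iκφ}` is controlled by its `∂̄`-part. -/
theorem integral_sq_le_integral_sub_sq (hw : RadialProfile R κ w) (hκ : 0 ≤ κ) (hwR : w R = 0) :
    (∫ r in Ioo 0 R, (√r * _root_.deriv w r) ^ 2) + ∫ r in Ioo 0 R, (κ * (w r / √r)) ^ 2 ≤
      ∫ r in Ioo 0 R, (√r * _root_.deriv w r - κ * (w r / √r)) ^ 2 := by
  have i₁ := integrable_sq_of_memLp hw.deriv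
  have i₂ := integrable_sq_of_memLp hw.weight
  have i₃ := integrable_mul_of_memLp hw.deriv hw.weight
  have e : ∀ r, (√r * _root_.deriv w r - κ * (w r / √r)) ^ 2 =
      (√r * _root_.deriv w r) ^ 2 + (κ * (w r / √r)) ^ 2 -
        2 * (√r * _root_.deriv w r * (κ * (w r / √r))) := fun r => by ring
  -- The cross term is `κ ∫ w w'`, which enters the square with a minus sign and so helps.
  have hn : ∫ r in Ioo 0 R, √r * _root_.deriv w r * (κ * (w r / √r)) ≤ 0 := by
    have e' : ∫ r in Ioo 0 R, √r * _root_.deriv w r * (κ * (w r / √r)) =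
        κ * ∫ r in Ioo 0 R, w r * _root_.deriv w r := by
      rw [← integral_const_mul]
      refine setIntegral_congr_fun measurableSet_Ioo fun r hr => ?_
      have : √r ≠ 0 := (Real.sqrt_pos.2 hr.1).ne'
      field_simp
    rw [e']
    rcases hκ.eq_or_lt with rfl | hpos
    · simp
    · exact mul_nonpos_of_nonneg_of_nonpos hκ (hw.integral_mul_deriv_nonpos hpos.ne' hwR)
  simp_rw [e]
  have e₁ := integral_sub (i₁.add i₂) (i₃.const_mul 2)
  simp only [Pi.add_apply] at e₁
  rw [e₁, integral_const_mul, integral_add i₁ i₂]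
  linarith

end RadialProfile

/-- A smooth function `y` on the line that is constant near `0` and vanishes near `R`, with
`√r r^n y' = h`. -/
theorem exists_smooth_primitive {R : ℝ} (n : ℕ) {h : ℝ → ℝ} (hh : ContDiff ℝ ∞ h) {δ : ℝ}
    (hδ : 0 < δ) (h0 : ∀ r, r ≤ δ ∨ R - δ ≤ r → h r = 0) :
    ∃ y : ℝ → ℝ, ContDiff ℝ ∞ y ∧ (∀ r, r ≤ δ → y r = y δ) ∧ (∀ r, R - δ ≤ r → y r = 0) ∧
      ∀ r, 0 < r → √r * r ^ n * deriv y r = h r := by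
  -- The singular factor meets `h = 0` for `s ≤ δ`, so `k` is smooth everywhere, including where the
  -- root and the inverse take default values.
  set k : ℝ → ℝ := fun s => h s * ((s ^ n)⁻¹ * (√s)⁻¹) with hk
  have k0 : ∀ r, r ≤ δ ∨ R - δ ≤ r → k r = 0 := fun r hr => by simp only [hk, h0 r hr, zero_mul]
  have kc : ContDiff ℝ ∞ k := by
    rw [contDiff_iff_contDiffAt]
    intro s
    rcases lt_or_ge s δ with hs | hs
    · have : k =ᶠ[𝓝 s] fun _ => 0 := by
        filter_upwards [Iio_mem_nhds hs] with t ht using k0 t (Or.inl (le_of_lt ht))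
      exact contDiffAt_const.congr_of_eventuallyEq this
    · have hs0 : 0 < s := hδ.trans_le hs
      exact hh.contDiffAt.mul ((((contDiff_id.pow n).contDiffAt).inv (pow_pos hs0 n).ne').mul
        ((Real.contDiffAt_sqrt hs0.ne').inv (Real.sqrt_pos.2 hs0).ne'))
  set y : ℝ → ℝ := fun r => ∫ s in R..r, k s with hy
  have yd : ∀ r, HasDerivAt y (k r) r := fun r =>
    intervalIntegral.integral_hasDerivAt_right (kc.continuous.intervalIntegrable _ _)
      (kc.continuous.stronglyMeasurableAtFilter _ _) kc.continuous.continuousAt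
  have ydd : deriv y = k := funext fun r => (yd r).deriv
  have hdiff : Differentiable ℝ y := fun r => (yd r).differentiableAt
  refine ⟨y, contDiff_infty_iff_deriv.2 ⟨hdiff, ydd ▸ kc⟩, fun r hr => ?_, fun r hr => ?_,
    fun r hr => ?_⟩
  · have : y r - y δ = ∫ s in δ..r, k s := by
      rw [hy]
      exact intervalIntegral.integral_interval_sub_left (kc.continuous.intervalIntegrable _ _)
        (kc.continuous.intervalIntegrable _ _)
    have hz : ∫ s in δ..r, k s = 0 := by
      rw [intervalIntegral.integral_congr (g := fun _ => 0), intervalIntegral.integral_zero]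
      intro s hs
      rw [uIcc_of_ge hr] at hs
      exact k0 s (Or.inl hs.2)
    linarith
  · change ∫ s in R..r, k s = 0
    rw [intervalIntegral.integral_congr (g := fun _ => 0), intervalIntegral.integral_zero]
    intro s hs
    refine k0 s (Or.inr ?_)
    rcases le_total R r with hRr | hRr
    · rw [uIcc_of_le hRr] at hs
      linarith [hs.1]
    · rw [uIcc_of_ge hRr] at hs
      exact hr.trans hs.1
  · rw [ydd]
    have h1 : √r ≠ 0 := (Real.sqrt_pos.2 hr).ne'
    have h2 : r ^ n ≠ 0 := (pow_pos hr n).ne'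
    simp only [hk]
    field_simp

/-! ### Test functions built from a radial cut-off and a smooth factor -/

section RadialTest

variable {R δ : ℝ} {y : ℝ → ℝ} {A : Plane → ℝ}

theorem contDiff_comp_norm (hy : ContDiff ℝ ∞ y) (hδ : 0 < δ) (hc : ∀ r, r ≤ δ → y r = y δ) :
    ContDiff ℝ ∞ fun x : Plane => y ‖x‖ := by
  rw [contDiff_iff_contDiffAt]
  intro x
  rcases lt_or_ge ‖x‖ δ with hx | hx
  · have : (fun x : Plane => y ‖x‖) =ᶠ[𝓝 x] fun _ => y δ := by
      filter_upwards [(isOpen_lt continuous_norm continuous_const).mem_nhds hx] with z hz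
        using hc _ (le_of_lt hz)
    exact contDiffAt_const.congr_of_eventuallyEq this
  · exact hy.contDiffAt.comp x (contDiffAt_norm ℝ (norm_pos_iff.1 (hδ.trans_le hx)))

theorem IsTestFunction.comp_norm_mul (hy : ContDiff ℝ ∞ y) (hδ : 0 < δ)
    (hc : ∀ r, r ≤ δ → y r = y δ) (h0 : ∀ r, R - δ ≤ r → y r = 0) (hA : ContDiff ℝ ∞ A) :
    IsTestFunction (disk R) fun x => y ‖x‖ * A x := by
  have hs : tsupport (fun x => y ‖x‖ * A x) ⊆ Metric.closedBall (0 : Plane) (R - δ) := by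
    refine closure_minimal (fun x hx => ?_) Metric.isClosed_closedBall
    rw [mem_closedBall_zero_iff]
    by_contra hlt
    exact hx (by simp only [h0 _ (not_le.1 hlt).le, zero_mul])
  refine ⟨(contDiff_comp_norm hy hδ hc).mul hA, ?_, hs.trans ?_⟩
  · exact (isCompact_closedBall _ _).of_isClosed_subset (isClosed_tsupport _) hs
  · exact Metric.closedBall_subset_ball (by linarith)

theorem partialDeriv_comp_norm_mul (hy : Differentiable ℝ y) (hA : Differentiable ℝ A)
    {x : Plane} (hx : x ≠ 0) (l : Fin 2) :
    partialDeriv l (fun x => y ‖x‖ * A x) x =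
      deriv y ‖x‖ * dir (angle x) l * A x + y ‖x‖ * partialDeriv l A x := by
  have hn := norm_pos_iff.2 hx
  have h₁ := (hasStrictFDerivAt_norm_sq x).hasFDerivAt.sqrt (by positivity)
  -- The derivative of the norm is read off from that of `√(‖z‖²)`.
  have e₁ : (fun z : Plane => √(‖z‖ ^ 2)) = fun z => ‖z‖ := by
    ext z
    exact Real.sqrt_sq (norm_nonneg z)
  rw [e₁, Real.sqrt_sq hn.le] at h₁
  have h₂ := (hy ‖x‖).hasDerivAt.comp_hasFDerivAt x h₁
  have h₃ := h₂.mul (hA x).hasFDerivAt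
  have hdir : x l = ‖x‖ * dir (angle x) l := by
    conv_lhs => rw [← smul_dir_angle x]
    rfl
  rw [partialDeriv, HasFDerivAt.fderiv (f := fun x => y ‖x‖ * A x) h₃]
  simp [partialDeriv, EuclideanSpace.inner_single_right]
  rw [hdir]
  field_simp
  ring

end RadialTest

/-- The vector field with radial part `d(r)` and angular part `w(r)/r`. -/
noncomputable def polarGrad (κ : ℕ) (α β : ℝ) (d w : ℝ → ℝ) (l : Fin 2) (x : Plane) : ℝ :=
  d ‖x‖ * (ang κ α β (angle x) * dir (angle x) l) +
    w ‖x‖ / ‖x‖ * (dang κ α β (angle x) * tang (angle x) l)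

/-- The field is dominated by `(|α| + |β|)(|d| + κ|w|/r)`; the factor `4π` is `2π` times the `2` of
`(x + y)² ≤ 2x² + 2y²`. Keeping `d` separate from `deriv w` allows `d = w' - W'`, which equals the
derivative of `w - W` only almost everywhere. -/
theorem memLp_polarGrad {R : ℝ} {κ : ℕ} (α β : ℝ) {d w : ℝ → ℝ} (hd : Measurable d)
    (hw : ContinuousOn w (Ioc 0 R)) (hd2 : MemL2 R fun r => √r * d r)
    (hw2 : MemL2 R fun r => (κ : ℝ) * (w r / √r)) (l : Fin 2) :
    MemLp (polarGrad κ α β d w l) 2 (volume.restrict (disk R)) ∧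
      ∫ x in disk R, polarGrad κ α β d w l x ^ 2 ≤ (|α| + |β|) ^ 2 * (4 * Real.pi *
        ((∫ r in Ioo 0 R, (√r * d r) ^ 2) + ∫ r in Ioo 0 R, ((κ : ℝ) * (w r / √r)) ^ 2)) := by
  set M := |α| + |β| with hM
  have hM0 : 0 ≤ M := by positivity
  have mF : AEStronglyMeasurable (polarGrad κ α β d w l) (volume.restrict (disk R)) := by
    have m₁ : AEStronglyMeasurable (fun x : Plane => d ‖x‖) (volume.restrict (disk R)) :=
      (hd.comp measurable_norm).aestronglyMeasurable
    have m₂ := aestronglyMeasurable_comp_norm hw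
    have m₃ : Measurable fun x : Plane => ‖x‖⁻¹ := measurable_norm.inv
    have m₄ : Measurable fun x : Plane => ang κ α β (angle x) * dir (angle x) l :=
      (continuous_ang.measurable.comp measurable_angle).mul
        (((EuclideanSpace.proj (𝕜 := ℝ) l).continuous.comp continuous_dir).measurable.comp
          measurable_angle)
    have m₅ : Measurable fun x : Plane => dang κ α β (angle x) * tang (angle x) l :=
      (continuous_dang.measurable.comp measurable_angle).mul
        ((continuous_tang l).measurable.comp measurable_angle)
    exact (m₁.mul m₄.aestronglyMeasurable).add
      ((m₂.mul m₃.aestronglyMeasurable).mul m₅.aestronglyMeasurable)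
  set H : ℝ → ℝ := fun r => |d r| + κ * (|w r| / r) with hH
  have eH : ∀ r ∈ Ioo 0 R, √r * H r = |√r * d r| + |(κ : ℝ) * (w r / √r)| := by
    intro r hr
    have h0 : 0 < √r := Real.sqrt_pos.2 hr.1
    have hr' : r = √r * √r := (Real.mul_self_sqrt hr.1.le).symm
    simp only [hH]
    rw [abs_mul, abs_mul, abs_div, Nat.abs_cast, abs_of_pos h0, mul_add]
    congr 1
    have e : |w r| / r = |w r| / (√r * √r) := by rw [← hr']
    rw [e]
    field_simp
  have mH : MemL2 R fun r => √r * H r :=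
    (MemLp.add hd2.abs hw2.abs).ae_eq ((ae_mem_Ioo R).mono fun r hr => (eH r hr).symm)
  obtain ⟨h₁, h₂⟩ := memLp_disk_of_radial_bound (M := M) mF mH (fun x hx hx0 => by
    have hn := norm_pos_iff.2 hx0
    have hH0 : 0 ≤ H ‖x‖ := by simp only [hH]; positivity
    rw [abs_of_nonneg hH0, polarGrad]
    refine (abs_add_le _ _).trans ?_
    simp only [hH]
    rw [mul_add, abs_mul, abs_mul, abs_mul, abs_mul, abs_div, abs_of_pos hn]
    have a₁ := mul_le_mul (abs_ang_le (κ := κ) (α := α) (β := β) (angle x))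
      (abs_dir_le (angle x) l) (abs_nonneg _) hM0
    have a₂ := mul_le_mul (abs_dang_le (κ := κ) (α := α) (β := β) (angle x))
      (abs_tang_le (angle x) l) (abs_nonneg _) (by positivity)
    rw [mul_one] at a₁ a₂
    have b₁ := mul_le_mul_of_nonneg_left a₁ (abs_nonneg (d ‖x‖))
    have b₂ := mul_le_mul_of_nonneg_left a₂ (by positivity : 0 ≤ |w ‖x‖| / ‖x‖)
    calc _ ≤ _ := add_le_add b₁ b₂
      _ = _ := by ring)
  refine ⟨h₁, h₂.trans ?_⟩
  refine mul_le_mul_of_nonneg_left ?_ (sq_nonneg _)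
  have i₁ := integrable_sq_of_memLp hd2
  have i₂ := integrable_sq_of_memLp hw2
  have : ∫ r in Ioo 0 R, r * H r ^ 2 ≤
      ∫ r in Ioo 0 R, (2 * (√r * d r) ^ 2 + 2 * ((κ : ℝ) * (w r / √r)) ^ 2) := by
    have e : ∀ r ∈ Ioo 0 R, r * H r ^ 2 = (√r * H r) ^ 2 := fun r hr => by
      rw [mul_pow, Real.sq_sqrt hr.1.le]
    rw [setIntegral_congr_fun measurableSet_Ioo e]
    refine setIntegral_mono_on (integrable_sq_of_memLp mH)
      ((i₁.const_mul 2).add (i₂.const_mul 2)) measurableSet_Ioo fun r hr => ?_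
    rw [eH r hr, ← sq_abs (√r * d r), ← sq_abs ((κ : ℝ) * (w r / √r))]
    nlinarith [sq_nonneg (|√r * d r| - |(κ : ℝ) * (w r / √r)|)]
  rw [integral_add (i₁.const_mul 2) (i₂.const_mul 2), integral_const_mul, integral_const_mul]
    at this
  nlinarith [Real.pi_pos]

/-! ### Radial fields in `H¹` and their boundary values -/

section Field

variable {R : ℝ} {κ : ℕ} {w : ℝ → ℝ}

theorem RadialProfile.memLp_radialGrad (hw : RadialProfile R κ w) (α β : ℝ) (l : Fin 2) :
    MemLp (radialGrad κ α β w l) 2 (volume.restrict (disk R)) :=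
  (memLp_polarGrad α β (measurable_deriv w) hw.ac.continuousOn hw.deriv hw.weight l).1

theorem memLp_radialField_le (κ : ℕ) (hw : ContinuousOn w (Ioc 0 R))
    (hm : MemL2 R fun r => √r * w r)
    (α β : ℝ) : MemLp (radialField κ α β w) 2 (volume.restrict (disk R)) ∧
      ∫ x in disk R, radialField κ α β w x ^ 2 ≤
        (|α| + |β|) ^ 2 * (2 * Real.pi * ∫ r in Ioo 0 R, r * w r ^ 2) := by
  refine memLp_disk_of_radial_bound ((aestronglyMeasurable_comp_norm hw).mul
    (continuous_ang.measurable.comp measurable_angle).aestronglyMeasurable) hm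
    fun x _ _ => ?_
  rw [radialField, abs_mul, mul_comm]
  exact mul_le_mul_of_nonneg_right (abs_ang_le _) (abs_nonneg _)

/-- A radial field with finite energy agrees with a smooth field up to a function in `H¹₀`, and its
weak gradient is the classical one. -/
theorem memH10_radialField_sub (hR : 0 < R) (hw : RadialProfile R κ w) (α β : ℝ) :
    MemH10 (disk R) (fun x => radialField κ α β w x - w R / R ^ κ * harmonicPoly κ α β x) ∧
      ∀ l, IsWeakPartial (disk R) l
        (fun x => radialField κ α β w x - w R / R ^ κ * harmonicPoly κ α β x)
        fun x => radialGrad κ α β w l x - w R / R ^ κ * partialDeriv l (harmonicPoly κ α β) x := by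
  set c := w R / R ^ κ with hc
  have mA := memLp_disk_of_continuous (contDiff_harmonicPoly (κ := κ) (α := α) (β := β)).continuous
    R 2
  -- The operator `w ↦ √r w' - κ w/√r` annihilates `r^κ`. Its value at `w` is approximated in `L²`
  -- by smooth `h j`, and the approximants of `w` solve the equation with right-hand side `h j`
  -- exactly.
  obtain ⟨h, hh, hδ, hlim⟩ := MemL2.exists_smooth_approx (MemLp.sub hw.deriv hw.weight)
  choose δ hδ0 hδ using hδ
  have hy := fun j => exists_smooth_primitive κ (hh j) (hδ0 j) (hδ j)
  choose y yc yconst yzero yderiv using hy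
  -- For this `W` the equation reads `√r r^κ y' = h`. As `y` vanishes near `R`, `W` and `w` agree at
  -- `R`. The field of `W` is `harmonicPoly` times `c + y ‖x‖`, smooth because `y` is constant near
  -- `0`.
  set W : ℕ → ℝ → ℝ := fun j r => r ^ κ * (c + y j r) with hW
  have hWd : ∀ j r, HasDerivAt (W j) (κ * r ^ (κ - 1) * (c + y j r) + r ^ κ * deriv (y j) r) r :=
    fun j r => (hasDerivAt_pow κ r).mul
      (((yc j).differentiable (by simp) r).hasDerivAt.const_add c)
  have hWc : ∀ j, ContDiff ℝ 1 (W j) := fun j =>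
    ((contDiff_id.pow κ).mul (contDiff_const.add (yc j))).of_le (by simp)
  have hWp : ∀ j, RadialProfile R κ (W j) := by
    intro j
    obtain ⟨B, hB⟩ := isCompact_Icc.exists_bound_of_continuousOn (s := Icc 0 R)
      (f := fun r => (κ : ℝ) * (r ^ (κ - 1) * (c + y j r))) (by
        have := (yc j).continuous
        fun_prop)
    refine RadialProfile.of_contDiff hR (hWc j) (M := B) fun r hr => ?_
    have hb := hB r ⟨hr.1.le, hr.2.le⟩
    rw [Real.norm_eq_abs] at hb
    have e : (κ : ℝ) * W j r = κ * (r ^ (κ - 1) * (c + y j r)) * r := by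
      simp only [hW]
      rcases κ with _ | n
      · simp
      · rw [Nat.add_sub_cancel, pow_succ]
        ring
    rw [e, abs_mul, abs_of_pos hr.1]
    exact mul_le_mul_of_nonneg_right hb hr.1.le
  set e : ℕ → ℝ → ℝ := fun j r => w r + (-1) * W j r with he
  have hep : ∀ j, RadialProfile R κ (e j) := fun j => hw.add_mul (hWp j) (-1)
  have heR : ∀ j, e j R = 0 := by
    intro j
    simp only [he, hW, yzero j R (by linarith [hδ0 j]), hc]
    have : R ^ κ ≠ 0 := (pow_pos hR κ).ne'
    field_simp
    ring
  have hed := fun j => RadialProfile.deriv_add_mul hw.ac (hWp j).ac (-1)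
  -- Because the error `e` vanishes at `R`, `RadialProfile.integral_sq_le_integral_sub_sq` upgrades
  -- convergence of the first-order expression to convergence of the full energy.
  have hE : Tendsto (fun j => (∫ r in Ioo 0 R, (√r * deriv (e j) r) ^ 2) +
      ∫ r in Ioo 0 R, ((κ : ℝ) * (e j r / √r)) ^ 2) atTop (𝓝 0) := by
    have hae : ∀ j, (fun r => √r * deriv (e j) r - κ * (e j r / √r)) =ᵐ[volume.restrict (Ioo 0 R)]
        (fun r => √r * deriv w r) - (fun r => (κ : ℝ) * (w r / √r)) - h j := by
      intro j
      filter_upwards [hed j, ae_mem_Ioo R] with r hr hr0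
      have h0 : √r ≠ 0 := (Real.sqrt_pos.2 hr0.1).ne'
      have hpow : (κ : ℝ) * (r ^ κ / √r) = κ * (√r * r ^ (κ - 1)) := by
        rcases κ with _ | n
        · simp
        · rw [Nat.add_sub_cancel, pow_succ, mul_div_assoc, Real.div_sqrt, mul_comm √r]
      have hk := yderiv j r hr0.1
      simp only [he, Pi.sub_apply] at hr ⊢
      rw [hr, (hWd j r).deriv, ← hk]
      simp only [hW]
      linear_combination (c + y j r) * hpow
    have hm : ∀ j, MemLp ((fun r => √r * deriv w r) - (fun r => (κ : ℝ) * (w r / √r)) - h j) 2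
        (volume.restrict (Ioo 0 R)) := fun j =>
      (MemLp.sub (hep j).deriv (hep j).weight).ae_eq (hae j)
    refine squeeze_zero (fun j => add_nonneg (integral_nonneg fun _ => sq_nonneg _)
      (integral_nonneg fun _ => sq_nonneg _)) (fun j => ?_) ((tendsto_eLpNorm_two_iff hm).1 hlim)
    refine ((hep j).integral_sq_le_integral_sub_sq (Nat.cast_nonneg _) (heR j)).trans_eq ?_
    exact integral_congr_ae ((hae j).mono fun r hr => by simp only [hr])
  set φ : ℕ → Plane → ℝ := fun j x => y j ‖x‖ * harmonicPoly κ α β x with hφ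
  have hφt : ∀ j, IsTestFunction (disk R) (φ j) := fun j =>
    IsTestFunction.comp_norm_mul (yc j) (hδ0 j) (yconst j) (yzero j) contDiff_harmonicPoly
  have hfe : ∀ j, (fun x => radialField κ α β w x - c * harmonicPoly κ α β x) - φ j =
      radialField κ α β (e j) := by
    intro j
    ext x
    simp only [Pi.sub_apply, hφ, radialField, he, hW, harmonicPoly_eq]
    ring
  have mf := (memLp_radialField_le κ hw.ac.continuousOn hw.memL2 α β).1
  have hmf : MemLp (fun x => radialField κ α β w x - c * harmonicPoly κ α β x) 2
      (volume.restrict (disk R)) := mf.sub (mA.const_mul c)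
  have mdA : ∀ l, MemLp (partialDeriv l (harmonicPoly κ α β)) 2 (volume.restrict (disk R)) :=
    fun l => memLp_disk_of_continuous (contDiff_partialDeriv contDiff_harmonicPoly l).continuous R 2
  have hmg : ∀ l, MemLp (fun x => radialGrad κ α β w l x -
      c * partialDeriv l (harmonicPoly κ α β) x) 2 (volume.restrict (disk R)) := fun l =>
    (hw.memLp_radialGrad α β l).sub ((mdA l).const_mul c)
  have hne : ∀ᵐ x ∂volume.restrict (disk R), x ≠ (0 : Plane) :=
    ae_restrict_of_ae (by simp [ae_iff])
  have hge : ∀ j l, (fun x => radialGrad κ α β w l x - c * partialDeriv l (harmonicPoly κ α β) x) -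
      partialDeriv l (φ j) =ᵐ[volume.restrict (disk R)]
        polarGrad κ α β (fun r => deriv w r - deriv (W j) r) (e j) l := by
    intro j l
    filter_upwards [hne] with x hx
    have hn : ‖x‖ ≠ 0 := norm_ne_zero_iff.2 hx
    have hp := partialDeriv_comp_norm_mul ((yc j).differentiable (by simp))
      ((contDiff_harmonicPoly (κ := κ) (α := α) (β := β)).differentiable (by simp)) hx l
    have hpow : (κ : ℝ) * (‖x‖ ^ κ / ‖x‖) = κ * ‖x‖ ^ (κ - 1) := by
      rcases κ with _ | n
      · simp
      · rw [Nat.add_sub_cancel, pow_succ, mul_div_assoc, div_self hn, mul_one]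
    simp only [Pi.sub_apply, hφ]
    rw [hp, partialDeriv_harmonicPoly hx, harmonicPoly_eq, polarGrad, radialGrad, (hWd j _).deriv]
    simp only [he, hW]
    linear_combination -(c + y j ‖x‖) * (ang κ α β (angle x) * dir (angle x) l) * hpow
  have hcont : ∀ j, ContinuousOn (e j) (Ioc 0 R) := fun j => (hep j).ac.continuousOn
  have hd2 : ∀ j, (fun r => √r * deriv (e j) r) =ᵐ[volume.restrict (Ioo 0 R)]
      fun r => √r * (deriv w r - deriv (W j) r) := fun j => by
    filter_upwards [hed j] with r hr
    simp only [he] at hr ⊢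
    rw [hr]
    ring
  have hG := fun j l => memLp_polarGrad (R := R) (κ := κ) α β
    ((measurable_deriv w).sub (measurable_deriv (W j))) (hcont j)
    ((hep j).deriv.ae_eq (hd2 j)) (hep j).weight l
  have hF := fun j => memLp_radialField_le κ (hcont j) (hep j).memL2 α β
  refine MemH10.of_tendsto (isOpen_disk R) hφt hmf hmg ?_ fun l => ?_
  · simp_rw [hfe]
    refine (tendsto_eLpNorm_two_iff fun j => (hF j).1).2 ?_
    have hz := hE.const_mul ((|α| + |β|) ^ 2 * (2 * Real.pi * (2 * R ^ 2)))
    rw [mul_zero] at hz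
    refine squeeze_zero (fun j => integral_nonneg fun _ => sq_nonneg _) (fun j => ?_) hz
    refine (hF j).2.trans ?_
    have hp := (hep j).ac.integral_sq_le hR (heR j) (hep j).deriv
    have hpe : ∫ s in Ioo 0 R, s * deriv (e j) s ^ 2 = ∫ r in Ioo 0 R, (√r * deriv (e j) r) ^ 2 :=
      setIntegral_congr_fun measurableSet_Ioo fun r hr => by
        simp only [mul_pow, Real.sq_sqrt hr.1.le]
    rw [hpe] at hp
    have h2 : 0 ≤ ∫ r in Ioo 0 R, ((κ : ℝ) * (e j r / √r)) ^ 2 :=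
      integral_nonneg fun _ => sq_nonneg _
    set D := ∫ r in Ioo 0 R, (√r * deriv (e j) r) ^ 2
    have h3 : ∫ r in Ioo 0 R, r * e j r ^ 2 ≤ 2 * R ^ 2 * (D +
        ∫ r in Ioo 0 R, ((κ : ℝ) * (e j r / √r)) ^ 2) :=
      hp.trans (mul_le_mul_of_nonneg_left (by linarith) (by positivity))
    calc _ = (|α| + |β|) ^ 2 * (2 * Real.pi) * ∫ r in Ioo 0 R, r * e j r ^ 2 := by ring
      _ ≤ _ := mul_le_mul_of_nonneg_left h3 (by positivity)
      _ = _ := by ring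
  · refine Tendsto.congr (fun j => (eLpNorm_congr_ae (hge j l)).symm) ?_
    refine (tendsto_eLpNorm_two_iff fun j => (hG j l).1).2 ?_
    have hz := hE.const_mul ((|α| + |β|) ^ 2 * (4 * Real.pi))
    rw [mul_zero] at hz
    refine squeeze_zero (fun j => integral_nonneg fun _ => sq_nonneg _) (fun j => ?_) hz
    refine (hG j l).2.trans_eq ?_
    have : ∫ r in Ioo 0 R, (√r * (deriv w r - deriv (W j) r)) ^ 2 =
        ∫ r in Ioo 0 R, (√r * deriv (e j) r) ^ 2 :=
      integral_congr_ae ((hd2 j).mono fun r hr => by simp only [hr])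
    rw [← this]
    simp only [Pi.sub_apply]
    ring

/-- A radial field with finite energy belongs to `H¹`. -/
theorem isWeakPartial_radialField (hR : 0 < R) (hw : RadialProfile R κ w) (α β : ℝ) (l : Fin 2) :
    IsWeakPartial (disk R) l (radialField κ α β w) (radialGrad κ α β w l) := by
  set c := w R / R ^ κ with hc
  have hA : ContDiff ℝ ∞ fun x => c * harmonicPoly κ α β x :=
    contDiff_const.mul contDiff_harmonicPoly
  obtain ⟨h₁, h₂⟩ := memH10_radialField_sub hR hw α β
  have h := IsWeakPartial.add h₁.1.memLp (memLp_disk_of_continuous hA.continuous R 2) (h₂ l)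
    (isWeakPartial_of_contDiff hA R l)
  have e : ∀ x, partialDeriv l (fun x => c * harmonicPoly κ α β x) x =
      c * partialDeriv l (harmonicPoly κ α β) x := fun x => by
    rw [partialDeriv, fderiv_const_mul (contDiff_harmonicPoly.differentiable (by simp) x)]
    rfl
  simp only [e, ← hc, sub_add_cancel] at h
  exact h

end Field

end QTensor

namespace QTensor

/-! ### The Euler–Lagrange equation and coercivity on the disk -/

theorem hasDerivAt_intervalIntegral_param {F F' : ℝ → ℝ → ℝ} (hF : Continuous F.uncurry)
    (hF' : Continuous F'.uncurry) (h : ∀ r θ, HasDerivAt (fun r => F r θ) (F' r θ) r) (a b r : ℝ) :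
    HasDerivAt (fun r => ∫ θ in a..b, F r θ) (∫ θ in a..b, F' r θ) r := by
  obtain ⟨C, hC⟩ := (isCompact_Icc.prod isCompact_uIcc).exists_bound_of_continuousOn
    (s := Icc (r - 1) (r + 1) ×ˢ uIcc a b) hF'.continuousOn
  have c₁ : ∀ r, Continuous (F r) := fun r => hF.comp (Continuous.prodMk_right r)
  have c₂ : Continuous (F' r) := hF'.comp (Continuous.prodMk_right r)
  refine (intervalIntegral.hasDerivAt_integral_of_dominated_loc_of_deriv_le (bound := fun _ => C)
    (Icc_mem_nhds (by linarith : r - 1 < r) (by linarith : r < r + 1))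
    (Eventually.of_forall fun r => (c₁ r).aestronglyMeasurable)
    ((c₁ r).intervalIntegrable _ _) c₂.aestronglyMeasurable ?_ intervalIntegrable_const
    (Eventually.of_forall fun θ _ s _ => h s θ)).2
  exact Eventually.of_forall fun θ hθ s hs => hC (s, θ) ⟨hs, uIoc_subset_uIcc hθ⟩

/-! ### Polar derivatives and Fourier coefficients of smooth functions -/

section Polar

variable {φ : Plane → ℝ}

/-- The radial derivative in polar coordinates. -/
noncomputable def radialDeriv (φ : Plane → ℝ) (r θ : ℝ) : ℝ :=
  dir θ 0 * partialDeriv 0 φ (r • dir θ) + dir θ 1 * partialDeriv 1 φ (r • dir θ)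

/-- The angular derivative divided by `r` in polar coordinates. -/
noncomputable def angularDeriv (φ : Plane → ℝ) (r θ : ℝ) : ℝ :=
  tang θ 0 * partialDeriv 0 φ (r • dir θ) + tang θ 1 * partialDeriv 1 φ (r • dir θ)

theorem continuous_smul_dir : Continuous fun p : ℝ × ℝ => p.1 • dir p.2 :=
  continuous_fst.smul (continuous_dir.comp continuous_snd)

theorem hasDerivAt_radial (hφ : ContDiff ℝ ∞ φ) (r θ : ℝ) :
    HasDerivAt (fun r : ℝ => φ (r • dir θ)) (radialDeriv φ r θ) r := by
  have h : HasDerivAt (fun r : ℝ => r • dir θ) (dir θ) r := by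
    simpa using (hasDerivAt_id r).smul_const (dir θ)
  have := (hφ.differentiable (by simp) (r • dir θ)).hasFDerivAt.comp_hasDerivAt r h
  rwa [fderiv_apply_eq] at this

theorem hasDerivAt_angular (hφ : ContDiff ℝ ∞ φ) (r θ : ℝ) :
    HasDerivAt (fun θ : ℝ => φ (r • dir θ)) (r * angularDeriv φ r θ) θ := by
  have h : HasDerivAt (fun θ : ℝ => r • dir θ) (r • tang θ) θ := (hasDerivAt_dir θ).const_smul r
  have := (hφ.differentiable (by simp) (r • dir θ)).hasFDerivAt.comp_hasDerivAt θ h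
  rw [map_smul, fderiv_apply_eq] at this
  exact this

theorem continuous_radialDeriv (hφ : ContDiff ℝ ∞ φ) : Continuous (radialDeriv φ).uncurry := by
  have h := fun l => (contDiff_partialDeriv hφ l).continuous.comp continuous_smul_dir
  have hd : ∀ l, Continuous fun p : ℝ × ℝ => dir p.2 l := fun l =>
    (EuclideanSpace.proj (𝕜 := ℝ) l).continuous.comp (continuous_dir.comp continuous_snd)
  exact ((hd 0).mul (h 0)).add ((hd 1).mul (h 1))

theorem continuous_angularDeriv (hφ : ContDiff ℝ ∞ φ) : Continuous (angularDeriv φ).uncurry := by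
  have h := fun l => (contDiff_partialDeriv hφ l).continuous.comp continuous_smul_dir
  have hd : ∀ l, Continuous fun p : ℝ × ℝ => tang p.2 l := fun l =>
    (continuous_tang l).comp continuous_snd
  exact ((hd 0).mul (h 0)).add ((hd 1).mul (h 1))

/-- The Fourier coefficient of `φ` with respect to `ang κ α β`. -/
noncomputable def fourierCoeff (κ : ℕ) (α β : ℝ) (φ : Plane → ℝ) (r : ℝ) : ℝ :=
  ∫ θ in (-Real.pi)..Real.pi, ang κ α β θ * φ (r • dir θ)

variable {κ : ℕ} {α β : ℝ}

theorem hasDerivAt_fourierCoeff (hφ : ContDiff ℝ ∞ φ) (r : ℝ) :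
    HasDerivAt (fourierCoeff κ α β φ)
      (∫ θ in (-Real.pi)..Real.pi, ang κ α β θ * radialDeriv φ r θ) r := by
  have hc : Continuous fun p : ℝ × ℝ => ang κ α β p.2 := continuous_ang.comp continuous_snd
  exact hasDerivAt_intervalIntegral_param (F := fun r θ => ang κ α β θ * φ (r • dir θ))
    (F' := fun r θ => ang κ α β θ * radialDeriv φ r θ)
    (hc.mul (hφ.continuous.comp continuous_smul_dir)) (hc.mul (continuous_radialDeriv hφ))
    (fun r θ => (hasDerivAt_radial hφ r θ).const_mul _) _ _ r

theorem contDiff_fourierCoeff (hφ : ContDiff ℝ ∞ φ) : ContDiff ℝ 1 (fourierCoeff κ α β φ) := by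
  refine contDiff_one_iff_deriv.2 ⟨fun r => (hasDerivAt_fourierCoeff hφ r).differentiableAt, ?_⟩
  have hd : deriv (fourierCoeff κ α β φ) = fun r =>
      ∫ θ in (-Real.pi)..Real.pi, ang κ α β θ * radialDeriv φ r θ :=
    funext fun r => (hasDerivAt_fourierCoeff hφ r).deriv
  rw [hd]
  have hc : Continuous fun p : ℝ × ℝ => ang κ α β p.2 := continuous_ang.comp continuous_snd
  exact intervalIntegral.continuous_parametric_intervalIntegral_of_continuous'
    (f := fun r θ => ang κ α β θ * radialDeriv φ r θ)
    (hc.mul (continuous_radialDeriv hφ)) _ _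

theorem dang_neg_pi : dang κ α β (-Real.pi) = dang κ α β Real.pi := by
  simp [dang, Real.sin_nat_mul_pi]

theorem dir_neg_pi : dir (-Real.pi) = dir Real.pi := by
  ext l
  fin_cases l <;> simp

/-- Integration by parts over a full period has no boundary term, and the derivative of `dang` is
`-κ²` times `ang`. -/
theorem integral_dang_mul_angularDeriv (hφ : ContDiff ℝ ∞ φ) (r : ℝ) :
    ∫ θ in (-Real.pi)..Real.pi, dang κ α β θ * (r * angularDeriv φ r θ) =
      κ ^ 2 * fourierCoeff κ α β φ r := by
  have hc : Continuous fun θ => r * angularDeriv φ r θ :=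
    continuous_const.mul ((continuous_angularDeriv hφ).uncurry_left r)
  have hc' : Continuous fun θ => -(κ : ℝ) ^ 2 * ang κ α β θ := continuous_const.mul continuous_ang
  rw [intervalIntegral.integral_mul_deriv_eq_deriv_mul (u := dang κ α β)
    (v := fun θ => φ (r • dir θ)) (u' := fun θ => -(κ : ℝ) ^ 2 * ang κ α β θ)
    (v' := fun θ => r * angularDeriv φ r θ) (fun θ _ => hasDerivAt_dang θ)
    (fun θ _ => hasDerivAt_angular hφ r θ) (hc'.intervalIntegrable _ _) (hc.intervalIntegrable _ _),
    dang_neg_pi, dir_neg_pi, sub_self, zero_sub, fourierCoeff,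
    ← intervalIntegral.integral_const_mul, ← intervalIntegral.integral_neg]
  congr 1
  ext θ
  ring

theorem integral_ang (hκ : κ ≠ 0) : ∫ θ in (-Real.pi)..Real.pi, ang κ α β θ = 0 := by
  have h : ∀ θ ∈ uIcc (-Real.pi) Real.pi,
      HasDerivAt (fun θ => -(dang κ α β θ) / κ ^ 2) (ang κ α β θ) θ := fun θ _ => by
    refine ((hasDerivAt_dang θ).neg.div_const _).congr_deriv ?_
    have : (κ : ℝ) ≠ 0 := Nat.cast_ne_zero.2 hκ
    field_simp
  rw [intervalIntegral.integral_eq_sub_of_hasDerivAt h (continuous_ang.intervalIntegrable _ _),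
    dang_neg_pi, sub_self]

/-- At `r = 0` the function is constant in the angle while `ang` has mean zero for `κ ≠ 0`; so the
coefficient vanishes there and is `O(r)` by Lipschitz continuity. This supplies the weight condition
of `RadialProfile`. -/
theorem exists_abs_fourierCoeff_le (hφ : ContDiff ℝ ∞ φ) (R : ℝ) :
    ∃ M, ∀ r ∈ Ioo 0 R, |(κ : ℝ) * fourierCoeff κ α β φ r| ≤ M * r := by
  rcases eq_or_ne κ 0 with rfl | hκ
  · exact ⟨0, by simp⟩
  obtain ⟨K, hK⟩ := (contDiff_fourierCoeff (κ := κ) (α := α) (β := β) hφ).contDiffOn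
    |>.exists_lipschitzOnWith (s := Icc 0 R) (by decide) (convex_Icc _ _) isCompact_Icc
  have h0 : fourierCoeff κ α β φ 0 = 0 := by
    simp only [fourierCoeff, zero_smul]
    rw [intervalIntegral.integral_mul_const, integral_ang hκ, zero_mul]
  refine ⟨κ * K, fun r hr => ?_⟩
  have := hK.dist_le_mul r (Ioo_subset_Icc_self hr) 0 ⟨le_rfl, hr.1.le.trans hr.2.le⟩
  rw [Real.dist_eq, Real.dist_eq, h0, sub_zero, sub_zero, abs_of_pos hr.1] at this
  rw [abs_mul, Nat.abs_cast, mul_assoc]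
  exact mul_le_mul_of_nonneg_left this (Nat.cast_nonneg _)

end Polar

/-! ### From the interval to the disk -/

section Equation

variable {R : ℝ} {κ : ℕ} {q w : ℝ → ℝ} {φ : Plane → ℝ}

theorem fourierCoeff_eq_zero {r : ℝ} (α β : ℝ) (hφ : IsTestFunction (disk R) φ) (hr : R ≤ r)
    (hr0 : 0 < r) : fourierCoeff κ α β φ r = 0 := by
  have : ∀ θ, φ (r • dir θ) = 0 := fun θ => hφ.apply_eq_zero (by
    rw [disk, mem_ball_zero_iff, norm_smul_dir hr0]; exact not_lt.2 hr)
  simp [fourierCoeff, this]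

theorem setIntegral_Ioo_pi (f : ℝ → ℝ) :
    ∫ θ in Ioo (-Real.pi) Real.pi, f θ = ∫ θ in (-Real.pi)..Real.pi, f θ := by
  rw [intervalIntegral.integral_of_le (by linarith [Real.pi_pos]), integral_Ioc_eq_integral_Ioo]

/-- Integrating over the angle replaces `φ` by its Fourier coefficient, leaving the integrand of the
radial weak equation. -/
theorem setIntegral_angular_density (w q : ℝ → ℝ) (α β : ℝ) (hφ : ContDiff ℝ ∞ φ) {r : ℝ}
    (hr : 0 < r) :
    ∫ θ in Ioo (-Real.pi) Real.pi,
      r * (∑ l, radialGrad κ α β w l (r • dir θ) * partialDeriv l φ (r • dir θ) +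
        q ‖r • dir θ‖ * radialField κ α β w (r • dir θ) * φ (r • dir θ)) =
      (deriv w r * deriv (fourierCoeff κ α β φ) r +
        (κ : ℝ) ^ 2 / r ^ 2 * (w r * fourierCoeff κ α β φ r) +
        q r * w r * fourierCoeff κ α β φ r) * r := by
  have e : ∀ θ ∈ Ioo (-Real.pi) Real.pi,
      r * (∑ l, radialGrad κ α β w l (r • dir θ) * partialDeriv l φ (r • dir θ) +
        q ‖r • dir θ‖ * radialField κ α β w (r • dir θ) * φ (r • dir θ)) =
      r * deriv w r * (ang κ α β θ * radialDeriv φ r θ) +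
        w r / r * (dang κ α β θ * (r * angularDeriv φ r θ)) +
        r * q r * w r * (ang κ α β θ * φ (r • dir θ)) := by
    intro θ hθ
    rw [Fin.sum_univ_two]
    simp only [radialGrad, radialField, norm_smul_dir hr, angle_smul_dir hr hθ, radialDeriv,
      angularDeriv]
    field_simp
    ring
  have c₁ : Continuous fun θ => ang κ α β θ * radialDeriv φ r θ :=
    continuous_ang.mul ((continuous_radialDeriv hφ).uncurry_left r)
  have c₂ : Continuous fun θ => dang κ α β θ * (r * angularDeriv φ r θ) :=
    continuous_dang.mul (continuous_const.mul
      ((continuous_angularDeriv hφ).uncurry_left r))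
  have c₃ : Continuous fun θ => ang κ α β θ * φ (r • dir θ) :=
    continuous_ang.mul (hφ.continuous.comp (continuous_dir.const_smul r))
  have i₁ := (c₁.intervalIntegrable (μ := volume) (-Real.pi) Real.pi).const_mul (r * deriv w r)
  have i₂ := (c₂.intervalIntegrable (μ := volume) (-Real.pi) Real.pi).const_mul (w r / r)
  have i₃ := (c₃.intervalIntegrable (μ := volume) (-Real.pi) Real.pi).const_mul (r * q r * w r)
  rw [setIntegral_congr_fun measurableSet_Ioo e, setIntegral_Ioo_pi,
    intervalIntegral.integral_add (i₁.add i₂) i₃, intervalIntegral.integral_add i₁ i₂,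
    intervalIntegral.integral_const_mul, intervalIntegral.integral_const_mul,
    intervalIntegral.integral_const_mul, integral_dang_mul_angularDeriv hφ,
    (hasDerivAt_fourierCoeff hφ r).deriv, fourierCoeff]
  field_simp

/-- A weak solution of the radial equation gives a weak solution on the disk. -/
theorem RadialWeakSolution.integral_disk_eq_zero (hR : 0 < R) (hw : RadialProfile R κ w)
    (hs : RadialWeakSolution R κ q w) {K : ℝ} (mq : Measurable q) (hq : ∀ r, |q r| ≤ K) (α β : ℝ)
    (hφ : IsTestFunction (disk R) φ) :
    ∫ x in disk R, (∑ l, radialGrad κ α β w l x * partialDeriv l φ x +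
      q ‖x‖ * radialField κ α β w x * φ x) = 0 := by
  have mqn : Measurable fun x : Plane => q ‖x‖ := mq.comp measurable_norm
  have i : IntegrableOn (fun x => ∑ l, radialGrad κ α β w l x * partialDeriv l φ x +
      q ‖x‖ * radialField κ α β w x * φ x) (disk R) := by
    refine Integrable.add (integrable_finsetSum _ fun l _ =>
      integrable_mul_of_memLp (hw.memLp_radialGrad α β l) (hφ.memLp_partialDeriv l)) ?_
    exact integrable_mul_of_memLp (memLp_bdd_mul (memLp_radialField_le κ hw.ac.continuousOn
      hw.memL2 α β).1 mqn.aestronglyMeasurable (Eventually.of_forall fun x => hq ‖x‖)) (hφ.memLp 2)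
  rw [integrableOn_disk_iff, IntegrableOn, volume_restrict_polarRect] at i
  rw [setIntegral_disk_eq, volume_restrict_polarRect, integral_prod _ i]
  obtain ⟨M, hM⟩ := exists_abs_fourierCoeff_le (κ := κ) (α := α) (β := β) hφ.smooth R
  obtain ⟨B, hB⟩ := isCompact_Icc.exists_bound_of_continuousOn (s := Icc 0 R)
    (contDiff_fourierCoeff (κ := κ) (α := α) (β := β) hφ.smooth).continuous.continuousOn
  refine Eq.trans (setIntegral_congr_fun measurableSet_Ioo fun r hr => ?_)
    (hs (fourierCoeff κ α β φ) (.of_contDiff hR (contDiff_fourierCoeff hφ.smooth) hM)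
      ⟨B, fun r hr => hB r (Ioo_subset_Icc_self hr)⟩ (fourierCoeff_eq_zero α β hφ le_rfl hR))
  exact setIntegral_angular_density w q α β hφ.smooth hr.1

/-- Coercivity of the quadratic form on test functions. -/
theorem RadialWeakSolution.coercive_disk (hR : 0 < R) {v : ℝ → ℝ} {n ρ K : ℝ} (hn : 0 < n)
    (hv : RadialProfile R 0 v) (hs : RadialWeakSolution R 0 q v)
    (hvn : ∀ r ∈ Ioc 0 R, v r ≤ -n) (hvρ : ∀ r ∈ Ioc 0 R, |v r| ≤ ρ)
    (mq : Measurable q) (hq : ∀ r, |q r| ≤ K) (hφ : IsTestFunction (disk R) φ) :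
    n ^ 2 / (2 * R ^ 2 * ρ ^ 2) * ∫ x in disk R, φ x ^ 2 ≤
      ∫ x in disk R, (∑ l, partialDeriv l φ x ^ 2 + q ‖x‖ * φ x ^ 2) := by
  set C := n ^ 2 / (2 * R ^ 2 * ρ ^ 2)
  have mqn : Measurable fun x : Plane => q ‖x‖ := mq.comp measurable_norm
  have cφ := hφ.smooth.continuous.comp continuous_smul_dir
  have compact : ∀ f : ℝ × ℝ → ℝ, Continuous f → IntegrableOn f (polarRect R) := fun f hf =>
    (hf.continuousOn.integrableOn_compact
      ((isCompact_Icc (a := 0) (b := R)).prod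
        (isCompact_Icc (a := -Real.pi) (b := Real.pi)))).mono_set
      (prod_mono Ioo_subset_Icc_self Ioo_subset_Icc_self)
  have iq : IntegrableOn (fun x => q ‖x‖ * φ x ^ 2) (disk R) :=
    (integrable_mul_of_memLp (memLp_bdd_mul (hφ.memLp 2) mqn.aestronglyMeasurable
      (Eventually.of_forall fun x => hq ‖x‖)) (hφ.memLp 2)).congr
      (Eventually.of_forall fun x => by simp only; ring)
  have iG : IntegrableOn (fun x => ∑ l, partialDeriv l φ x ^ 2 + q ‖x‖ * φ x ^ 2) (disk R) :=
    Integrable.add (integrable_finsetSum _ fun l _ =>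
      integrable_sq_of_memLp (hφ.memLp_partialDeriv l)) iq
  rw [integrableOn_disk_iff] at iG
  have iq' : IntegrableOn (fun p : ℝ × ℝ => p.1 * (q p.1 * φ (p.1 • dir p.2) ^ 2)) (polarRect R) :=
    (integrableOn_congr_fun (fun p hp => by simp only [norm_smul_dir hp.1.1])
      (measurableSet_polarRect R)).1 (integrableOn_disk_iff.1 iq)
  have iφ : IntegrableOn (fun p : ℝ × ℝ => φ (p.1 • dir p.2) ^ 2 * p.1) (polarRect R) :=
    compact _ ((cφ.pow 2).mul continuous_fst)
  have iD : IntegrableOn (fun p : ℝ × ℝ => (radialDeriv φ p.1 p.2 ^ 2 +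
      q p.1 * φ (p.1 • dir p.2) ^ 2) * p.1) (polarRect R) := by
    refine ((compact (fun p => radialDeriv φ p.1 p.2 ^ 2 * p.1)
      (((continuous_radialDeriv hφ.smooth).pow 2).mul continuous_fst)).add iq').congr
      (Eventually.of_forall fun p => ?_)
    simp only [Pi.add_apply]
    ring
  -- The gradient splits orthogonally into radial and tangential parts; the tangential part is
  -- discarded.
  have hle : ∫ p in polarRect R, (radialDeriv φ p.1 p.2 ^ 2 +
      q p.1 * φ (p.1 • dir p.2) ^ 2) * p.1 ≤
      ∫ x in disk R, (∑ l, partialDeriv l φ x ^ 2 + q ‖x‖ * φ x ^ 2) := by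
    rw [setIntegral_disk_eq]
    refine setIntegral_mono_on iD iG (measurableSet_polarRect R) fun p hp => ?_
    rw [norm_smul_dir hp.1.1, mul_comm, Fin.sum_univ_two]
    refine mul_le_mul_of_nonneg_left (add_le_add_left ?_ _) hp.1.1.le
    rw [radialDeriv]
    have h1 : dir p.2 0 ^ 2 + dir p.2 1 ^ 2 = 1 := Real.cos_sq_add_sin_sq p.2
    set x := partialDeriv 0 φ (p.1 • dir p.2)
    set y := partialDeriv 1 φ (p.1 • dir p.2)
    have h2 : (dir p.2 0 * x + dir p.2 1 * y) ^ 2 + (dir p.2 0 * y - dir p.2 1 * x) ^ 2 =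
        x ^ 2 + y ^ 2 := by linear_combination (x ^ 2 + y ^ 2) * h1
    linarith [sq_nonneg (dir p.2 0 * y - dir p.2 1 * x)]
  refine le_trans ?_ hle
  have e : ∫ x in disk R, φ x ^ 2 = ∫ p in polarRect R, φ (p.1 • dir p.2) ^ 2 * p.1 := by
    rw [setIntegral_disk_eq]
    exact integral_congr_ae (Eventually.of_forall fun p => mul_comm _ _)
  rw [e]
  rw [IntegrableOn, volume_restrict_polarRect] at iφ iD
  -- Fubini with the angle outermost: on each ray `φ` is a `C¹` function vanishing at `R`, to which
  -- the one-dimensional estimate applies.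
  rw [volume_restrict_polarRect, integral_prod_symm _ iφ, integral_prod_symm _ iD,
    ← integral_const_mul]
  refine integral_mono (iφ.integral_prod_right.const_mul C) iD.integral_prod_right fun θ => ?_
  have hp : ContDiff ℝ 1 fun r : ℝ => φ (r • dir θ) :=
    (hφ.smooth.comp (contDiff_id.smul contDiff_const)).of_le (by simp)
  have h := hs.coercive hR hn hv hvn hvρ mq.aestronglyMeasurable (fun r _ => hq r) hp
    (hφ.apply_eq_zero (by rw [disk, mem_ball_zero_iff, norm_smul_dir hR]; exact lt_irrefl R))
  simpa only [(hasDerivAt_radial hφ.smooth _ θ).deriv] using h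

end Equation

/-! ### Passage from test functions to `H¹₀` -/

section Density

variable {Ω : Set Plane} {f H Q : Plane → ℝ} {G : Fin 2 → Plane → ℝ}

/-- A linear functional that vanishes on test functions vanishes on `H¹₀`. -/
theorem MemH10.integral_eq_zero (hf : MemH10 Ω f) (hG : ∀ l, MemLp (G l) 2 (volume.restrict Ω))
    (hH : MemLp H 2 (volume.restrict Ω))
    (h : ∀ φ, IsTestFunction Ω φ → ∫ x in Ω, (∑ l, G l x * partialDeriv l φ x + H x * φ x) = 0) :
    ∫ x in Ω, (∑ l, G l x * weakPartial Ω l f x + H x * f x) = 0 := by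
  obtain ⟨mf, φ, hφ, h₁, h₂⟩ := hf
  have mw := fun l => (mf.isWeakPartial l).memLp
  have split : ∀ {p : Fin 2 → Plane → ℝ} {g : Plane → ℝ}
      (_ : ∀ l, MemLp (p l) 2 (volume.restrict Ω)) (_ : MemLp g 2 (volume.restrict Ω)),
      ∫ x in Ω, (∑ l, G l x * p l x + H x * g x) =
        (∑ l, ∫ x in Ω, G l x * p l x) + ∫ x in Ω, H x * g x := fun hp hg => by
    rw [integral_add (integrable_finsetSum _ fun l _ => integrable_mul_of_memLp (hG l) (hp l))
      (integrable_mul_of_memLp hH hg),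
      integral_finsetSum _ fun l _ => integrable_mul_of_memLp (hG l) (hp l)]
  have z : ∀ {F : Plane → ℝ}, Tendsto (fun _ : ℕ => eLpNorm (F - F) 2 (volume.restrict Ω)) atTop
      (𝓝 0) := by simp
  have flip : ∀ {F : Plane → ℝ} {p : ℕ → Plane → ℝ},
      Tendsto (fun m => eLpNorm (F - p m) 2 (volume.restrict Ω)) atTop (𝓝 0) →
      Tendsto (fun m => eLpNorm (p m - F) 2 (volume.restrict Ω)) atTop (𝓝 0) := fun h => by
    simpa only [eLpNorm_sub_comm] using h
  have t := (tendsto_finsetSum Finset.univ fun l _ => tendsto_integral_mul (fun _ => hG l)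
    (fun m => (hφ m).memLp_partialDeriv l) (hG l) (mw l) z (flip (h₂ l))).add
    (tendsto_integral_mul (fun _ => hH) (fun m => (hφ m).memLp 2) hH mf.memLp z (flip h₁))
  rw [split mw mf.memLp]
  refine tendsto_nhds_unique t (tendsto_const_nhds.congr fun m => ?_)
  rw [← split (fun l => (hφ m).memLp_partialDeriv l) ((hφ m).memLp 2), h _ (hφ m)]

/-- Coercivity on test functions extends to `H¹₀`. -/
theorem MemH10.coercive (hf : MemH10 Ω f) {C K : ℝ}
    (mQ : AEStronglyMeasurable Q (volume.restrict Ω)) (hQ : ∀ x, |Q x| ≤ K)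
    (h : ∀ φ, IsTestFunction Ω φ → C * ∫ x in Ω, φ x ^ 2 ≤
      ∫ x in Ω, (∑ l, partialDeriv l φ x ^ 2 + Q x * φ x ^ 2)) :
    C * ∫ x in Ω, f x ^ 2 ≤ ∫ x in Ω, (∑ l, weakPartial Ω l f x ^ 2 + Q x * f x ^ 2) := by
  obtain ⟨mf, φ, hφ, h₁, h₂⟩ := hf
  have mw := fun l => (mf.isWeakPartial l).memLp
  have bQ : ∀ᵐ x ∂volume.restrict Ω, |Q x| ≤ K := Eventually.of_forall hQ
  have split : ∀ {p : Fin 2 → Plane → ℝ} {g : Plane → ℝ}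
      (_ : ∀ l, MemLp (p l) 2 (volume.restrict Ω)) (_ : MemLp g 2 (volume.restrict Ω)),
      ∫ x in Ω, (∑ l, p l x ^ 2 + Q x * g x ^ 2) =
        (∑ l, ∫ x in Ω, p l x * p l x) + ∫ x in Ω, Q x * g x * g x := fun {p g} hp hg => by
    rw [← integral_finsetSum _ fun l _ => integrable_mul_of_memLp (hp l) (hp l), ← integral_add
      (integrable_finsetSum _ fun l _ => integrable_mul_of_memLp (hp l) (hp l))
      (integrable_mul_of_memLp (memLp_bdd_mul hg mQ bQ) hg)]
    congr 1
    ext x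
    simp only [pow_two, mul_assoc]
  have flip : ∀ {F : Plane → ℝ} {p : ℕ → Plane → ℝ},
      Tendsto (fun m => eLpNorm (F - p m) 2 (volume.restrict Ω)) atTop (𝓝 0) →
      Tendsto (fun m => eLpNorm (p m - F) 2 (volume.restrict Ω)) atTop (𝓝 0) := fun h => by
    simpa only [eLpNorm_sub_comm] using h
  have t := (tendsto_finsetSum Finset.univ fun l _ => tendsto_integral_mul
    (fun m => (hφ m).memLp_partialDeriv l) (fun m => (hφ m).memLp_partialDeriv l) (mw l) (mw l)
    (flip (h₂ l)) (flip (h₂ l))).add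
    (tendsto_integral_mul (fun m => memLp_bdd_mul ((hφ m).memLp 2) mQ bQ)
      (fun m => (hφ m).memLp 2) (memLp_bdd_mul mf.memLp mQ bQ) mf.memLp
      (tendsto_eLpNorm_bdd_mul bQ (flip h₁)) (flip h₁))
  have s := (tendsto_integral_mul (fun m => (hφ m).memLp 2) (fun m => (hφ m).memLp 2) mf.memLp
    mf.memLp (flip h₁) (flip h₁)).const_mul C
  rw [split mw mf.memLp]
  simp only [← pow_two] at s
  refine le_of_tendsto_of_tendsto s t (Eventually.of_forall fun m => (h _ (hφ m)).trans_eq ?_)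
  exact split (fun l => (hφ m).memLp_partialDeriv l) ((hφ m).memLp 2)

end Density

end QTensor

namespace QTensor

/-! ### The ansatz as a sum of radial fields -/

theorem cos_int_mul (k : ℤ) (θ : ℝ) : Real.cos (k * θ) = Real.cos (k.natAbs * θ) := by
  rcases Int.natAbs_eq k with h | h <;> rw [h] <;> simp

theorem sin_int_mul (k : ℤ) (θ : ℝ) :
    Real.sin (k * θ) = k.sign * Real.sin (k.natAbs * θ) := by
  rcases lt_trichotomy k 0 with h | rfl | h
  · have : (k : ℝ) = -(k.natAbs : ℝ) := by
      rw [Nat.cast_natAbs, abs_of_neg h, Int.cast_neg, neg_neg]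
    rw [Int.sign_eq_neg_one_of_neg h, this]
    simp
  · simp
  · have : (k : ℝ) = (k.natAbs : ℝ) := by
      rw [Nat.cast_natAbs, abs_of_pos h]
    rw [Int.sign_eq_one_of_pos h, this]
    simp

/-- The coefficient of `cos |k|φ` in `F_n`. -/
noncomputable def fnCos : Mat3 := (√2 / 2) • !![1, 0, 0; 0, -1, 0; 0, 0, 0]

/-- The coefficient of `sin |k|φ` in `F_n`. -/
noncomputable def fnSin (k : ℤ) : Mat3 := (√2 / 2 * k.sign) • !![0, 1, 0; 1, 0, 0; 0, 0, 0]

/-- By the double-angle formulas `n ⊗ n` involves only `kφ`. The sign of `k` is moved to the sine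
coefficient because `harmonicPoly` needs the natural exponent `|k|`. -/
theorem Fn_apply (k : ℤ) (θ : ℝ) (i j : Fin 3) :
    Fn k θ i j = ang k.natAbs (fnCos i j) (fnSin k i j) θ := by
  have e : (k : ℝ) / 2 * θ + k / 2 * θ = k * θ := by ring
  have hc := Real.cos_add (k / 2 * θ) (k / 2 * θ)
  have hs := Real.sin_add (k / 2 * θ) (k / 2 * θ)
  have sc := Real.sin_sq_add_cos_sq (k / 2 * θ)
  rw [e, cos_int_mul] at hc
  rw [e, sin_int_mul] at hs
  rw [ang]
  generalize Real.cos (k.natAbs * θ) = C at *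
  generalize Real.sin (k.natAbs * θ) = S at *
  simp only [Fn, director, fnCos, fnSin]
  generalize Real.cos (k / 2 * θ) = c at *
  generalize Real.sin (k / 2 * θ) = s at *
  fin_cases i <;> fin_cases j <;>
    simp [Matrix.diagonal]
  · linear_combination -(√2 / 2) * hc + √2 / 2 * sc
  · linear_combination -(√2 / 2) * hs
  · linear_combination -(√2 / 2) * hs
  · linear_combination (√2 / 2) * hc + √2 / 2 * sc

theorem F3_eq : F3 = √(3 / 2) • !![-1 / 3, 0, 0; 0, -1 / 3, 0; 0, 0, 2 / 3] := by
  rw [F3]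
  congr 1
  ext i j
  fin_cases i <;> fin_cases j <;> norm_num [Matrix.vecMulVec_apply, Matrix.one_apply]

theorem ansatz_apply (k : ℤ) (u v : ℝ → ℝ) (x : Plane) (i j : Fin 3) :
    ansatz k u v x i j = radialField k.natAbs (fnCos i j) (fnSin k i j) u x +
      radialField 0 (F3 i j) 0 v x := by
  rw [radialField, radialField, ← Fn_apply]
  simp [ansatz, ang]

/-- This form reduces the pointwise algebra of `Y` to `C² + S² = 1`. -/
theorem ansatz_eq (k : ℤ) (u v : ℝ → ℝ) (x : Plane) : ∃ C S : ℝ, C ^ 2 + S ^ 2 = 1 ∧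
    ansatz k u v x = (u ‖x‖ * (√2 / 2)) • !![C, S, 0; S, -C, 0; 0, 0, 0] +
      (v ‖x‖ * √(3 / 2)) • !![-1 / 3, 0, 0; 0, -1 / 3, 0; 0, 0, 2 / 3] := by
  refine ⟨Real.cos (k * angle x), Real.sin (k * angle x), Real.cos_sq_add_sin_sq _, ?_⟩
  rw [ansatz, F3_eq, smul_smul]
  congr 1
  ext i j
  rw [Matrix.smul_apply, Fn_apply, ang, cos_int_mul, sin_int_mul]
  fin_cases i <;> fin_cases j <;> simp [fnCos, fnSin] <;> ring

theorem ansatz_mem_S0 (k : ℤ) (u v : ℝ → ℝ) (x : Plane) : ansatz k u v x ∈ S0 := by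
  obtain ⟨C, S, -, h⟩ := ansatz_eq k u v x
  rw [h]
  constructor
  · ext i j
    fin_cases i <;> fin_cases j <;> simp
  · simp [Matrix.trace, Fin.sum_univ_three]
    ring

theorem normSq_ansatz (k : ℤ) (u v : ℝ → ℝ) (x : Plane) :
    normSq (ansatz k u v x) = u ‖x‖ ^ 2 + v ‖x‖ ^ 2 := by
  obtain ⟨C, S, hCS, h⟩ := ansatz_eq k u v x
  have h2 : √(2 : ℝ) ^ 2 = 2 := Real.sq_sqrt (by norm_num)
  have h3 : √(3 / 2 : ℝ) ^ 2 = 3 / 2 := Real.sq_sqrt (by norm_num)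
  rw [h, normSq]
  generalize √(3 / 2 : ℝ) = t at *
  generalize √(2 : ℝ) = p at *
  simp [Matrix.trace, Fin.sum_univ_three]
  linear_combination (u ‖x‖ ^ 2 * p ^ 2 / 2) * hCS + u ‖x‖ ^ 2 / 2 * h2 +
    v ‖x‖ ^ 2 * (2 / 3) * h3

theorem normSq_eq_sum {Q : Mat3} (hQ : Q ∈ S0) : normSq Q = ∑ i, ∑ j, Q i j ^ 2 := by
  rw [normSq, Matrix.trace]
  refine Finset.sum_congr rfl fun i _ => ?_
  rw [Matrix.diag_apply, Matrix.mul_apply]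
  refine Finset.sum_congr rfl fun j _ => ?_
  have : Q j i = Q i j := congrFun (congrFun hQ.1 i) j
  rw [this, pow_two]

theorem S0_add {P Q : Mat3} (hP : P ∈ S0) (hQ : Q ∈ S0) : P + Q ∈ S0 :=
  ⟨by rw [Matrix.transpose_add, hP.1, hQ.1], by rw [Matrix.trace_add, hP.2, hQ.2, add_zero]⟩

theorem S0_sub {P Q : Mat3} (hP : P ∈ S0) (hQ : Q ∈ S0) : P - Q ∈ S0 :=
  ⟨by rw [Matrix.transpose_sub, hP.1, hQ.1], by rw [Matrix.trace_sub, hP.2, hQ.2, sub_zero]⟩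

/-! ### Admissibility of the ansatz -/

section Ansatz

variable {a b c L R : ℝ} {k : ℤ} {u v : ℝ → ℝ}

/-- The gradient of the ansatz. -/
noncomputable def ansatzGrad (k : ℤ) (u v : ℝ → ℝ) (i j : Fin 3) (l : Fin 2) (x : Plane) : ℝ :=
  radialGrad k.natAbs (fnCos i j) (fnSin k i j) u l x + radialGrad 0 (F3 i j) 0 v l x

theorem MemS.profile_v_cast (h : MemS a b c R u v) : RadialProfile R ((0 : ℕ) : ℝ) v := by
  rw [Nat.cast_zero]
  exact h.profile_v

theorem MemS.memLp_ansatz (h : MemS a b c R u v) (k : ℤ) (i j : Fin 3) :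
    MemLp (fun x => ansatz k u v x i j) 2 (volume.restrict (disk R)) := by
  simp only [ansatz_apply]
  exact (memLp_radialField_le _ h.ac_u.continuousOn (h.profile_u 0).memL2 _ _).1.add
    (memLp_radialField_le _ h.ac_v.continuousOn h.profile_v.memL2 _ _).1

theorem MemS.isWeakPartial_ansatz (hR : 0 < R) (h : MemS a b c R u v) (k : ℤ) (i j : Fin 3)
    (l : Fin 2) :
    IsWeakPartial (disk R) l (fun x => ansatz k u v x i j) (ansatzGrad k u v i j l) := by
  simp only [ansatz_apply]
  exact IsWeakPartial.add
    (memLp_radialField_le _ h.ac_u.continuousOn (h.profile_u 0).memL2 _ _).1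
    (memLp_radialField_le _ h.ac_v.continuousOn h.profile_v.memL2 _ _).1
    (isWeakPartial_radialField hR (h.profile_u _) _ _ l)
    (isWeakPartial_radialField hR h.profile_v_cast _ _ l)

/-- Since `√6 = 2 √(3/2)`, the boundary value is `s₊ (n ⊗ n - I₂/2) - (s₊/2)(e₃ ⊗ e₃ - I/3)`, and
the diagonal parts add up to `-s₊ I/3`. -/
theorem ansatz_boundary (h : MemS a b c R u v) {x : Plane}
    (hx : x ∈ Metric.sphere (0 : Plane) R) :
    ansatz k u v x = sPlus a b c • Qk k (angle x) := by
  rw [mem_sphere_zero_iff_norm] at hx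
  have h2 : √(2 : ℝ) ≠ 0 := by positivity
  have h6 : √(6 : ℝ) = 2 * √(3 / 2) := by
    rw [show (6 : ℝ) = 2 ^ 2 * (3 / 2) by norm_num, Real.sqrt_mul (by norm_num),
      Real.sqrt_sq (by norm_num)]
  have h3 : √(3 / 2 : ℝ) ≠ 0 := by positivity
  rw [ansatz, hx, h.boundary_u, h.boundary_v, h6, Fn, F3, Qk, smul_smul, smul_smul]
  have e₁ : sPlus a b c / √2 * √2 = sPlus a b c := by field_simp
  have e₂ : -(sPlus a b c / (2 * √(3 / 2))) * √(3 / 2) = -(sPlus a b c / 2) := by field_simp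
  rw [e₁, e₂]
  generalize sPlus a b c = s
  generalize Matrix.vecMulVec (director k (angle x)) (director k (angle x)) = N
  ext i j
  fin_cases i <;> fin_cases j <;>
    simp [Matrix.diagonal] <;> ring

theorem MemS.admissible (hR : 0 < R) (h : MemS a b c R u v) :
    Admissible a b c R k (ansatz k u v) := by
  refine ⟨⟨Eventually.of_forall fun x => ansatz_mem_S0 k u v x, fun i j =>
    ⟨h.memLp_ansatz k i j, fun l => ⟨_, h.isWeakPartial_ansatz hR k i j l⟩⟩⟩,
    -- The smooth extension chosen is the harmonic one, given entrywise by polynomials scaled to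
    -- match at radius `R`.
    fun x => Matrix.of fun i j =>
      u R / R ^ k.natAbs * harmonicPoly k.natAbs (fnCos i j) (fnSin k i j) x +
        v R / R ^ 0 * harmonicPoly 0 (F3 i j) 0 x, fun i j => ?_, fun x hx => ?_, fun i j => ?_⟩
  · exact (contDiff_const.mul contDiff_harmonicPoly).add
      (contDiff_const.mul contDiff_harmonicPoly)
  · refine Eq.trans ?_ (ansatz_boundary h hx)
    rw [mem_sphere_zero_iff_norm] at hx
    ext i j
    have : R ^ k.natAbs ≠ 0 := (pow_pos hR _).ne'
    rw [ansatz_apply, radialField, radialField, hx]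
    change u R / R ^ k.natAbs * harmonicPoly k.natAbs (fnCos i j) (fnSin k i j) x +
      v R / R ^ 0 * harmonicPoly 0 (F3 i j) 0 x = _
    rw [harmonicPoly_eq, harmonicPoly_eq, hx]
    field_simp
  · have hm := MemH10.add (isOpen_disk R)
      (memH10_radialField_sub hR (h.profile_u k.natAbs) (fnCos i j) (fnSin k i j)).1
      (memH10_radialField_sub hR h.profile_v_cast (F3 i j) 0).1
    convert hm using 2 with x
    rw [ansatz_apply]
    exact add_sub_add_comm _ _ _ _

end Ansatz

/-! ### The second variation of the energy -/

section Energy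

variable {a b c L R : ℝ} {Q Y P : Plane → Mat3}

/-- Used in Hölder's inequality, so that `|Q|²` is square integrable for `Q` in `L⁴` and the quartic
energy term is finite. -/
instance holderTriple_four_four_two : ENNReal.HolderTriple 4 4 2 where
  inv_add_inv_eq_inv := by
    rw [← two_mul, show (4 : ENNReal) = 2 * 2 by norm_num, ENNReal.mul_inv (by simp) (by simp),
      ← mul_assoc, ENNReal.mul_inv_cancel (by simp) (by simp), one_mul]

theorem memLp_normSq {μ : Measure Plane} (h : ∀ i j, MemLp (fun x => Q x i j) 4 μ) :
    MemLp (fun x => normSq (Q x)) 2 μ := by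
  have e : (fun x => normSq (Q x)) = fun x => ∑ i, ∑ j, Q x i j * Q x j i := by
    ext x
    rw [normSq, Matrix.trace]
    exact Finset.sum_congr rfl fun i _ => by rw [Matrix.diag_apply, Matrix.mul_apply]
  rw [e]
  exact memLp_finsetSum _ fun i _ => memLp_finsetSum _ fun j _ => (h j i).mul (h i j)

theorem isFiniteMeasure_restrict_disk (R : ℝ) :
    IsFiniteMeasure ((volume : Measure Plane).restrict (disk R)) :=
  ⟨by rw [Measure.restrict_apply_univ]; exact measure_ball_lt_top⟩

theorem integrable_energyDensity (hb : b ^ 2 = 0) (h₁ : ∀ i j, MemH1 (disk R) fun x => Q x i j)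
    (h₄ : ∀ i j, MemLp (fun x => Q x i j) 4 (volume.restrict (disk R))) :
    IntegrableOn (fun x => 1 / 2 * gradNormSq (disk R) Q x + 1 / L * bulk a b c (Q x))
      (disk R) := by
  have := isFiniteMeasure_restrict_disk R
  have hn := memLp_normSq h₄
  refine Integrable.add (Integrable.const_mul ?_ _) (Integrable.const_mul ?_ _)
  · exact integrable_finsetSum _ fun i _ => integrable_finsetSum _ fun j _ =>
      integrable_finsetSum _ fun l _ => integrable_sq_of_memLp ((h₁ i j).isWeakPartial l).memLp
  · simp only [bulk, hb, zero_div, zero_mul, sub_zero]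
    exact ((hn.integrable (by norm_num)).const_mul _).add ((integrable_sq_of_memLp hn).const_mul _)

/-- If `Y` solves the linear equation with the potential `q` determined by `|Y|²` and the quadratic
form of `q` is coercive, then `Y` is a strict minimiser. -/
theorem le_energy_add_sub (hb : b ^ 2 = 0) (hL : 0 < L)
    (hY : ∀ᵐ x ∂volume.restrict (disk R), Y x ∈ S0)
    {g : Fin 3 → Fin 3 → Fin 2 → Plane → ℝ}
    (h₂ : ∀ i j, MemLp (fun x => Y x i j) 2 (volume.restrict (disk R)))
    (h₄ : ∀ i j, MemLp (fun x => Y x i j) 4 (volume.restrict (disk R)))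
    (hg : ∀ i j l, IsWeakPartial (disk R) l (fun x => Y x i j) (g i j l))
    {q : Plane → ℝ} {K C : ℝ} (mq : AEStronglyMeasurable q (volume.restrict (disk R)))
    (hq : ∀ x, |q x| ≤ K)
    (hqY : ∀ᵐ x ∂volume.restrict (disk R), q x = (c ^ 2 * normSq (Y x) - a ^ 2) / L)
    (hlin : ∀ i j f, MemH10 (disk R) f →
      ∫ x in disk R, (∑ l, g i j l x * weakPartial (disk R) l f x + q x * Y x i j * f x) = 0)
    (hcoer : ∀ f, MemH10 (disk R) f → C * ∫ x in disk R, f x ^ 2 ≤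
      ∫ x in disk R, (∑ l, weakPartial (disk R) l f x ^ 2 + q x * f x ^ 2))
    (hP : MemH10S0 (disk R) P) :
    C / 2 * ∫ x in disk R, normSq (P x) ≤
      energy a b c L (disk R) (Y + P) - energy a b c L (disk R) Y := by
  have bq : ∀ᵐ x ∂volume.restrict (disk R), |q x| ≤ K := Eventually.of_forall hq
  set p : Fin 3 → Fin 3 → Fin 2 → Plane → ℝ := fun i j l =>
    weakPartial (disk R) l fun x => P x i j with hp
  have mP := fun i j => (hP.memH10 i j).1.memLp
  have mp := fun i j l => ((hP.memH10 i j).1.isWeakPartial l).memLp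
  have hYP : ∀ i j l, IsWeakPartial (disk R) l (fun x => (Y + P) x i j)
      fun x => g i j l x + p i j l x := fun i j l =>
    IsWeakPartial.add (h₂ i j) (mP i j) (hg i j l) ((hP.memH10 i j).1.isWeakPartial l)
  have iY := integrable_energyDensity (a := a) (c := c) (L := L) hb
    (fun i j => ⟨h₂ i j, fun l => ⟨_, hg i j l⟩⟩) h₄
  have iYP := integrable_energyDensity (Q := Y + P) (a := a) (c := c) (L := L) hb
    (fun i j => ⟨(h₂ i j).add (mP i j), fun l => ⟨_, hYP i j l⟩⟩)
    (fun i j => (h₄ i j).add (hP.memH10 i j).memLp_four)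
  have i₁ : ∀ i j, Integrable (fun x => ∑ l, g i j l x * p i j l x + q x * Y x i j * P x i j)
      (volume.restrict (disk R)) := fun i j =>
    Integrable.add (integrable_finsetSum _ fun l _ =>
      integrable_mul_of_memLp (hg i j l).memLp (mp i j l))
      (integrable_mul_of_memLp (memLp_bdd_mul (h₂ i j) mq bq) (mP i j))
  have i₂ : ∀ i j, Integrable (fun x => ∑ l, p i j l x ^ 2 + q x * P x i j ^ 2)
      (volume.restrict (disk R)) := fun i j => by
    refine Integrable.add (integrable_finsetSum _ fun l _ => integrable_sq_of_memLp (mp i j l)) ?_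
    exact (integrable_mul_of_memLp (memLp_bdd_mul (mP i j) mq bq) (mP i j)).congr
      (Eventually.of_forall fun x => by simp only; ring)
  have hae : ∀ᵐ x ∂volume.restrict (disk R),
      ∑ i, ∑ j, (∑ l, g i j l x * p i j l x + q x * Y x i j * P x i j) +
        1 / 2 * ∑ i, ∑ j, (∑ l, p i j l x ^ 2 + q x * P x i j ^ 2) ≤
      (1 / 2 * gradNormSq (disk R) (Y + P) x + 1 / L * bulk a b c ((Y + P) x)) -
        (1 / 2 * gradNormSq (disk R) Y x + 1 / L * bulk a b c (Y x)) := by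
    have w₁ : ∀ᵐ x ∂volume.restrict (disk R), ∀ i j l,
        weakPartial (disk R) l (fun y => (Y + P) y i j) x = g i j l x + p i j l x := by
      simp only [ae_all_iff]
      exact fun i j l => (hYP i j l).weakPartial_ae_eq (isOpen_disk R)
    have w₂ : ∀ᵐ x ∂volume.restrict (disk R), ∀ i j l,
        weakPartial (disk R) l (fun y => Y y i j) x = g i j l x := by
      simp only [ae_all_iff]
      exact fun i j l => (hg i j l).weakPartial_ae_eq (isOpen_disk R)
    filter_upwards [w₁, w₂, hY, hP.memS0, hqY] with x e₁ e₂ hYx hPx hqx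
    have hN : normSq ((Y + P) x) =
        normSq (Y x) + (2 * ∑ i, ∑ j, Y x i j * P x i j + normSq (P x)) := by
      rw [Pi.add_apply, normSq_eq_sum (S0_add hYx hPx), normSq_eq_sum hYx, normSq_eq_sum hPx]
      simp only [Matrix.add_apply, add_sq, Finset.sum_add_distrib, Finset.mul_sum, mul_assoc]
      ring
    have hG : gradNormSq (disk R) (Y + P) x = gradNormSq (disk R) Y x +
        2 * ∑ i, ∑ j, ∑ l, g i j l x * p i j l x + ∑ i, ∑ j, ∑ l, p i j l x ^ 2 := by
      simp only [gradNormSq, e₁, e₂, add_sq, Finset.sum_add_distrib, Finset.mul_sum, mul_assoc]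
    have hA : ∑ i, ∑ j, (∑ l, g i j l x * p i j l x + q x * Y x i j * P x i j) =
        ∑ i, ∑ j, ∑ l, g i j l x * p i j l x + q x * ∑ i, ∑ j, Y x i j * P x i j := by
      simp only [Finset.sum_add_distrib, Finset.mul_sum, mul_assoc]
    have hB : ∑ i, ∑ j, (∑ l, p i j l x ^ 2 + q x * P x i j ^ 2) =
        ∑ i, ∑ j, ∑ l, p i j l x ^ 2 + q x * normSq (P x) := by
      rw [normSq_eq_sum hPx]
      simp only [Finset.sum_add_distrib, Finset.mul_sum]
    rw [hA, hB, hG, bulk, bulk, hN, hb, hqx]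
    generalize ∑ i, ∑ j, Y x i j * P x i j = s
    generalize normSq (P x) = t
    generalize normSq (Y x) = n
    rw [← sub_nonneg]
    -- With `s = Y:P` and `t = |P|²`, this square is exactly the excess of the density difference
    -- over the linear and quadratic terms.
    have : 0 ≤ c ^ 2 / (4 * L) * (2 * s + t) ^ 2 := by positivity
    refine this.trans_eq ?_
    field_simp
    ring
  have hint : ∫ x in disk R,
      (∑ i, ∑ j, (∑ l, g i j l x * p i j l x + q x * Y x i j * P x i j) +
        1 / 2 * ∑ i, ∑ j, (∑ l, p i j l x ^ 2 + q x * P x i j ^ 2)) ≤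
      energy a b c L (disk R) (Y + P) - energy a b c L (disk R) Y := by
    rw [energy, energy, ← integral_sub iYP iY]
    exact integral_mono_ae (Integrable.add (integrable_finsetSum Finset.univ fun i _ =>
      integrable_finsetSum Finset.univ fun j _ => i₁ i j)
      ((integrable_finsetSum Finset.univ fun i _ =>
        integrable_finsetSum Finset.univ fun j _ => i₂ i j).const_mul (1 / 2))) (iYP.sub iY) hae
  refine le_trans ?_ hint
  rw [integral_add (integrable_finsetSum Finset.univ fun i _ =>
      integrable_finsetSum Finset.univ fun j _ => i₁ i j)
      ((integrable_finsetSum Finset.univ fun i _ =>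
        integrable_finsetSum Finset.univ fun j _ => i₂ i j).const_mul (1 / 2)),
    integral_const_mul,
    integral_finsetSum _ fun i _ => integrable_finsetSum Finset.univ fun j _ => i₁ i j,
    integral_finsetSum _ fun i _ => integrable_finsetSum Finset.univ fun j _ => i₂ i j]
  -- The first variation vanishes entry by entry; coercivity below is likewise applied to each entry
  -- separately.
  have z : ∑ i, ∫ x in disk R, ∑ j, (∑ l, g i j l x * p i j l x + q x * Y x i j * P x i j) = 0 :=
    Finset.sum_eq_zero fun i _ => by
      rw [integral_finsetSum _ fun j _ => i₁ i j]
      exact Finset.sum_eq_zero fun j _ => hlin i j _ (hP.memH10 i j)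
  have hn : ∫ x in disk R, normSq (P x) = ∑ i, ∑ j, ∫ x in disk R, P x i j ^ 2 := by
    rw [integral_congr_ae (hP.memS0.mono fun x hx => normSq_eq_sum hx),
      integral_finsetSum _ fun i _ => integrable_finsetSum Finset.univ fun j _ =>
        integrable_sq_of_memLp (mP i j)]
    exact Finset.sum_congr rfl fun i _ =>
      integral_finsetSum _ fun j _ => integrable_sq_of_memLp (mP i j)
  rw [z, zero_add, hn, div_mul_eq_mul_div, div_eq_inv_mul, one_div]
  refine mul_le_mul_of_nonneg_left ?_ (by norm_num)
  rw [Finset.mul_sum]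
  refine Finset.sum_le_sum fun i _ => ?_
  rw [integral_finsetSum _ fun j _ => i₂ i j, Finset.mul_sum]
  exact Finset.sum_le_sum fun j _ => hcoer _ (hP.memH10 i j)

end Energy

/-! ### Strict minimality of the ansatz -/

section Main

variable {a b c L R : ℝ} {k : ℤ} {u v : ℝ → ℝ}

theorem memLp_radialField_top (κ : ℕ) {w : ℝ → ℝ} {N : ℝ} (hw : ContinuousOn w (Ioc 0 R))
    (hN : ∀ r ∈ Ioc 0 R, |w r| ≤ N) (α β : ℝ) (p : ENNReal) :
    MemLp (radialField κ α β w) p (volume.restrict (disk R)) := by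
  have := isFiniteMeasure_restrict_disk R
  refine MemLp.of_bound ((aestronglyMeasurable_comp_norm hw).mul
    (continuous_ang.measurable.comp measurable_angle).aestronglyMeasurable) (N * (|α| + |β|)) ?_
  have hne : ∀ᵐ x ∂volume.restrict (disk R), x ≠ (0 : Plane) :=
    ae_restrict_of_ae (by simp [ae_iff])
  filter_upwards [ae_restrict_mem measurableSet_ball, hne] with x hx hx0
  have hw' := hN ‖x‖ ⟨norm_pos_iff.2 hx0, (mem_ball_zero_iff.1 hx).le⟩
  rw [Real.norm_eq_abs, radialField, abs_mul]
  exact mul_le_mul hw' (abs_ang_le _) (abs_nonneg _) ((abs_nonneg _).trans hw')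

/-- A weak solution of the radial equation gives a weak solution on the disk, tested against
`H¹₀`. -/
theorem RadialWeakSolution.integral_memH10_eq_zero {κ : ℕ} {q w : ℝ → ℝ} (hR : 0 < R)
    (hw : RadialProfile R κ w) (hs : RadialWeakSolution R κ q w) {K : ℝ} (mq : Measurable q)
    (hq : ∀ r, |q r| ≤ K) (α β : ℝ) {f : Plane → ℝ} (hf : MemH10 (disk R) f) :
    Integrable (fun x => ∑ l, radialGrad κ α β w l x * weakPartial (disk R) l f x +
      q ‖x‖ * radialField κ α β w x * f x) (volume.restrict (disk R)) ∧
    ∫ x in disk R, (∑ l, radialGrad κ α β w l x * weakPartial (disk R) l f x +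
      q ‖x‖ * radialField κ α β w x * f x) = 0 := by
  have mH : MemLp (fun x => q ‖x‖ * radialField κ α β w x) 2 (volume.restrict (disk R)) :=
    memLp_bdd_mul (memLp_radialField_le κ hw.ac.continuousOn hw.memL2 α β).1
      (mq.comp measurable_norm).aestronglyMeasurable (Eventually.of_forall fun x => hq ‖x‖)
  exact ⟨Integrable.add (integrable_finsetSum _ fun l _ => integrable_mul_of_memLp
    (hw.memLp_radialGrad α β l) (hf.1.isWeakPartial l).memLp)
    (integrable_mul_of_memLp mH hf.1.memLp),
    hf.integral_eq_zero (fun l => hw.memLp_radialGrad α β l) mH fun φ hφ =>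
      hs.integral_disk_eq_zero hR hw mq hq α β hφ⟩

/-- The second variation at the ansatz built from a minimiser of the reduced energy. -/
theorem IsReducedMinimiser.le_energy_add_sub (ha : 0 < a) (hb : b ^ 2 = 0) (hc : 0 < c)
    (hL : 0 < L) (hR : 0 < R) (hk : k ≠ 0) (h : IsReducedMinimiser a b c L R k u v)
    {P : Plane → Mat3} (hP : MemH10S0 (disk R) P) :
    (sPlus a b c / √6) ^ 2 / (2 * R ^ 2 * (a / c) ^ 2) / 2 * ∫ x in disk R, normSq (P x) ≤
      energy a b c L (disk R) (ansatz k u v + P) - energy a b c L (disk R) (ansatz k u v) := by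
  have hS := h.1
  have hN := h.bounds ha hb hc hL hR hk
  have hN2 : ∀ r ∈ Ioc 0 R, |u r| ≤ a / c ∧ |v r| ≤ a / c := fun r hr =>
    ⟨(hN r hr).1, (hN r hr).2.1⟩
  have hn : 0 < sPlus a b c / √6 := div_pos (sPlus_pos ha hc) (by positivity)
  -- `u` and `v` are arbitrary outside `(0, R]`; extending the coefficient by zero makes it
  -- measurable and bounded on the whole line.
  set q : ℝ → ℝ := (Ioc 0 R).piecewise (linCoeff a c L u v) fun _ => 0 with hqdef
  have cu := hS.ac_u.continuousOn
  have cv := hS.ac_v.continuousOn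
  have mq : Measurable q := by
    refine ContinuousOn.measurable_piecewise ?_ continuousOn_const measurableSet_Ioc
    unfold linCoeff
    fun_prop
  have hq : ∀ r, |q r| ≤ (c ^ 2 * ((a / c) ^ 2 + (a / c) ^ 2) + a ^ 2) / L := by
    intro r
    by_cases hr : r ∈ Ioc 0 R
    · rw [hqdef, piecewise_eq_of_mem _ _ _ hr, linCoeff, abs_div, abs_of_pos hL]
      refine div_le_div_of_nonneg_right ?_ hL.le
      have h₁ : u r ^ 2 ≤ (a / c) ^ 2 :=
        sq_le_sq' (abs_le.1 (hN2 r hr).1).1 (abs_le.1 (hN2 r hr).1).2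
      have h₂ : v r ^ 2 ≤ (a / c) ^ 2 :=
        sq_le_sq' (abs_le.1 (hN2 r hr).2).1 (abs_le.1 (hN2 r hr).2).2
      have h₃ : c ^ 2 * (u r ^ 2 + v r ^ 2) ≤ c ^ 2 * ((a / c) ^ 2 + (a / c) ^ 2) :=
        mul_le_mul_of_nonneg_left (add_le_add h₁ h₂) (sq_nonneg _)
      rw [abs_le]
      constructor <;> nlinarith [sq_nonneg a, mul_nonneg (sq_nonneg c) (add_nonneg (sq_nonneg (u r))
        (sq_nonneg (v r)))]
    · rw [hqdef, piecewise_eq_of_notMem _ _ _ hr, abs_zero]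
      positivity
  have hqe : ∀ r ∈ Ioo 0 R, q r = linCoeff a c L u v r := fun r hr => by
    rw [hqdef, piecewise_eq_of_mem _ _ _ (Ioo_subset_Ioc_self hr)]
  have congr_q : ∀ {κ : ℝ} {w : ℝ → ℝ}, RadialWeakSolution R κ (linCoeff a c L u v) w →
      RadialWeakSolution R κ q w := fun hw ξ h₁ h₂ h₃ => by
    refine Eq.trans ?_ (hw ξ h₁ h₂ h₃)
    exact setIntegral_congr_fun measurableSet_Ioo fun r hr => by simp only [hqe r hr]
  have su := congr_q (h.weakSolution_u hb hR hk hN2)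
  have sv := congr_q (h.weakSolution_v hb hR hk hN2)
  have sv' : RadialWeakSolution R ((0 : ℕ) : ℝ) q v := by rwa [Nat.cast_zero]
  refine QTensor.le_energy_add_sub hb hL (Eventually.of_forall fun x => ansatz_mem_S0 k u v x)
    (fun i j => hS.memLp_ansatz k i j) (fun i j => ?_)
    (fun i j l => hS.isWeakPartial_ansatz hR k i j l)
    (q := fun x => q ‖x‖) (mq.comp measurable_norm).aestronglyMeasurable (fun x => hq ‖x‖)
    ?_ ?_ ?_ hP
  · simp only [ansatz_apply]
    exact (memLp_radialField_top _ cu (fun r hr => (hN2 r hr).1) _ _ 4).add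
      (memLp_radialField_top _ cv (fun r hr => (hN2 r hr).2) _ _ 4)
  · have hne : ∀ᵐ x ∂volume.restrict (disk R), x ≠ (0 : Plane) :=
      ae_restrict_of_ae (by simp [ae_iff])
    filter_upwards [ae_restrict_mem measurableSet_ball, hne] with x hx hx0
    rw [hqe _ ⟨norm_pos_iff.2 hx0, mem_ball_zero_iff.1 hx⟩, linCoeff, normSq_ansatz]
  · intro i j f hf
    obtain ⟨i₁, z₁⟩ := su.integral_memH10_eq_zero hR (hS.profile_u _) mq hq (fnCos i j)
      (fnSin k i j) hf
    obtain ⟨i₂, z₂⟩ := sv'.integral_memH10_eq_zero hR hS.profile_v_cast mq hq (F3 i j) 0 hf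
    have e := integral_add i₁ i₂
    rw [z₁, z₂, add_zero] at e
    rw [← e]
    congr 1
    ext x
    simp only [ansatzGrad, ansatz_apply, add_mul, mul_add, Finset.sum_add_distrib]
    ring
  · exact fun f hf => hf.coercive (mq.comp measurable_norm).aestronglyMeasurable (fun x => hq ‖x‖)
      fun φ hφ => sv.coercive_disk hR hn hS.profile_v (fun r hr => (hN r hr).2.2)
        (fun r hr => (hN r hr).2.1) mq hq hφ

/-- `Q - Y = (Q - G) - (Y - G') + (G - G')`. The two smooth extensions agree on the circle, so
`memH10_of_eq_zero_on_sphere` handles the last difference. -/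
theorem Admissible.sub (hR : 0 < R) {Q Y : Plane → Mat3} (hQ : Admissible a b c R k Q)
    (hY : Admissible a b c R k Y) : MemH10S0 (disk R) (Q - Y) := by
  obtain ⟨⟨sQ, mQ⟩, G, hG, hG', hQG⟩ := hQ
  obtain ⟨⟨sY, mY⟩, G', hG₂, hG₂', hYG⟩ := hY
  refine ⟨?_, fun i j => ?_⟩
  · filter_upwards [sQ, sY] with x h₁ h₂ using S0_sub h₁ h₂
  · have hd : MemH10 (disk R) fun x => G x i j - G' x i j :=
      memH10_of_eq_zero_on_sphere hR ((hG i j).sub (hG₂ i j)) fun x hx => by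
        rw [hG' x hx, hG₂' x hx, sub_self]
    have := MemH10.add (isOpen_disk R) (MemH10.add (isOpen_disk R) (hQG i j)
      (MemH10.neg (isOpen_disk R) (hYG i j))) hd
    convert this using 2 with x
    rw [Pi.sub_apply, Matrix.sub_apply]
    ring

theorem integral_normSq_nonneg {P : Plane → Mat3} (hP : MemH10S0 (disk R) P) :
    0 ≤ ∫ x in disk R, normSq (P x) :=
  integral_nonneg_of_ae (hP.memS0.mono fun x hx => by
    simp only [normSq_eq_sum hx]
    exact Finset.sum_nonneg fun i _ => Finset.sum_nonneg fun j _ => sq_nonneg _)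

theorem ae_eq_zero_of_integral_normSq {P : Plane → Mat3} (hP : MemH10S0 (disk R) P)
    (h : ∫ x in disk R, normSq (P x) ≤ 0) : P =ᵐ[volume.restrict (disk R)] 0 := by
  have e : (fun x => normSq (P x)) =ᵐ[volume.restrict (disk R)] fun x => ∑ i, ∑ j, P x i j ^ 2 :=
    hP.memS0.mono fun x hx => normSq_eq_sum hx
  have hi : Integrable (fun x => ∑ i, ∑ j, P x i j ^ 2) (volume.restrict (disk R)) :=
    integrable_finsetSum _ fun i _ => integrable_finsetSum _ fun j _ =>
      integrable_sq_of_memLp (hP.memH10 i j).1.memLp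
  rw [integral_congr_ae e] at h
  have hnn : ∀ x, 0 ≤ ∑ i, ∑ j, P x i j ^ 2 := fun x =>
    Finset.sum_nonneg fun i _ => Finset.sum_nonneg fun j _ => sq_nonneg _
  have h0 := (integral_eq_zero_iff_of_nonneg hnn hi).1 (le_antisymm h (integral_nonneg hnn))
  filter_upwards [h0] with x hx
  ext i j
  have h₁ := (Finset.sum_eq_zero_iff_of_nonneg fun i _ =>
    Finset.sum_nonneg fun j _ => sq_nonneg (P x i j)).1 hx i (Finset.mem_univ i)
  have h₂ := (Finset.sum_eq_zero_iff_of_nonneg fun j _ => sq_nonneg (P x i j)).1 h₁ j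
    (Finset.mem_univ j)
  exact pow_eq_zero_iff two_ne_zero |>.1 h₂

end Main

end QTensor

theorem theorem4p3 (a b c L R : ℝ) (k : ℤ) (ha : 0 < a) (hb : b ^ 2 = 0) (hc : 0 < c)
    (hL : 0 < L) (hR : 0 < R) (hk : k ≠ 0) (u v : ℝ → ℝ)
    (huv : QTensor.IsReducedMinimiser a b c L R k u v) :
    QTensor.IsUniqueGlobalMinimiser a b c L R k (QTensor.ansatz k u v) ∧
    ∃ C : ℝ, 0 < C ∧ ∀ P : QTensor.Plane → QTensor.Mat3, QTensor.MemH10S0 (QTensor.disk R) P →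
      C * ∫ x in QTensor.disk R, QTensor.normSq (P x) ≤
        QTensor.energy a b c L (QTensor.disk R) (QTensor.ansatz k u v + P) -
          QTensor.energy a b c L (QTensor.disk R) (QTensor.ansatz k u v) := by
  have hs := QTensor.sPlus_pos (b := b) ha hc
  -- The constant is `n²/(2R²ρ²)` from the Hardy and Poincaré steps, halved by the factor `½` of the
  -- quadratic term.
  have hC : 0 < (QTensor.sPlus a b c / √6) ^ 2 / (2 * R ^ 2 * (a / c) ^ 2) / 2 := by positivity
  have key := fun P (hP : QTensor.MemH10S0 (QTensor.disk R) P) =>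
    huv.le_energy_add_sub ha hb hc hL hR hk hP
  have hY : QTensor.Admissible a b c R k (QTensor.ansatz k u v) := huv.1.admissible hR
  refine ⟨⟨hY, fun Q hQ => ?_, fun Q hQ hle => ?_⟩, _, hC, key⟩
  -- Every competitor is `Y + P` with `P = Q - Y` in `H¹₀`, so the coercive estimate yields
  -- minimality here and uniqueness below.
  · have hP := hQ.sub hR hY
    have h := key _ hP
    rw [add_sub_cancel] at h
    linarith [mul_nonneg hC.le (QTensor.integral_normSq_nonneg hP)]
  · have hP := hQ.sub hR hY
    have h := key _ hP
    rw [add_sub_cancel] at h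
    have h0 := QTensor.ae_eq_zero_of_integral_normSq hP
      (nonpos_of_mul_nonpos_right (h.trans (sub_nonpos.2 hle)) hC)
    filter_upwards [h0] with x hx
    exact sub_eq_zero.1 hx
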